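/- Let $A$ be a set of visible actions, $Act=A\uplus\{\tau,\mathrm t\}$ and $A_\tau=A\cup\{\tau\}$. In a labelled transition system over $Act$ write $P\Rightarrow Q$ for the reflexive-transitive closure of $\xrightarrow{\tau}$; $P\xrightarrow{(\alpha)}Q$ if $P\xrightarrow{\alpha}Q$ or ($\alpha=\tau$ and $P=Q$); $P\not\xrightarrow{\tau}$ if $P$ has no outgoing $\tau$-transition; and $\mathcal I(P)=\{\alpha\in A_\tau\mid \exists Q.\ P\xrightarrow{\alpha}Q\}$. Say that $P$ idles on $X\subseteq A$ if $\mathcal I(P)\cap(X\cup\{\tau\})=\emptyset$. **Equivalences.** A *concrete branching reactive bisimulation* is a symmetric relation $\mathcal R$ consisting of pairs $(P,Q)$ and triples $(P,X,Q)$ with $X\subseteq A$, such that 1. if $\mathcal R(P,Q)$ then (a) if $P\xrightarrow{\alpha}P'$ with $\alpha\in A_\tau$, there is a path $Q\Rightarrow Q_1\xrightarrow{(\alpha)}Q_2$ with $\mathcal R(P,Q_1)$, $\mathcal R(P',Q_2)$; (b) $\mathcal R(P,Y,Q)$ for all $Y\subseteq A$; 2. if $\mathcal R(P,X,Q)$ then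 (a) if $P\xrightarrow{\tau}P'$, there is a path $Q\Rightarrow Q_1\xrightarrow{(\tau)}Q_2$ with $\mathcal R(P,X,Q_1)$, $\mathcal R(P',X,Q_2)$; (b) if $P\xrightarrow{a}P'$ with $a\in X$, there is a path $Q\Rightarrow Q_1\xrightarrow{a}Q_2$ with $\mathcal R(P,X,Q_1)$, $\mathcal R(P',Q_2)$; (c) if $P$ idles on $X$, there is a path $Q\Rightarrow Q_0$ with $\mathcal R(P,Q_0)$; (d) if $P$ idles on $X$ and $P\xrightarrow{\mathrm t}P'$, there is a path $Q\Rightarrow Q_1\xrightarrow{\mathrm t}Q_2$ with $\mathcal R(P',X,Q_2)$; (e) if $P\not\xrightarrow{\tau}$, there is a path $Q\Rightarrow Q_0\not\xrightarrow{\tau}$. Write $P\leftrightarrow Q$ (resp. $P\leftrightarrow^X Q$) if some such $\mathcal R$ has $\mathcal R(P,Q)$ (resp. $\mathcal R(P,X,Q)$). A *rooted concrete branching reactive bisimulation* is a symmetric relation $\mathcal R$ of pairs and triples such that 1. if $\mathcal R(P,Q)$ then (a) if $P\xrightarrow{\alpha}P'$ with $\alpha\in A_\tau$, there is $Q\xrightarrow{\alpha}Q'$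 with $P'\leftrightarrow Q'$; (b) $\mathcal R(P,Y,Q)$ for all $Y\subseteq A$; 2. if $\mathcal R(P,X,Q)$ then (a) if $P\xrightarrow{\tau}P'$, there is $Q\xrightarrow{\tau}Q'$ with $P'\leftrightarrow^XQ'$; (b) if $P\xrightarrow{a}P'$ with $a\in X$, there is $Q\xrightarrow{a}Q'$ with $P'\leftrightarrow Q'$; (c) if $P$ idles on $X$, then $\mathcal R(P,Q)$; (d) if $P$ idles on $X$ and $P\xrightarrow{\mathrm t}P'$, there is $Q\xrightarrow{\mathrm t}Q'$ with $P'\leftrightarrow^XQ'$. $P$ and $Q$ are *rooted concrete branching reactive bisimilar* if some such $\mathcal R$ has $\mathcal R(P,Q)$. A *stability-respecting branching bisimulation* is a symmetric binary relation $\mathcal R$ such that $\mathcal R(P,Q)$ implies: if $P\xrightarrow{\alpha}P'$ with $\alpha\in Act$, there is a path $Q\Rightarrow Q_1\xrightarrow{(\alpha)}Q_2$ with $\mathcal R(P,Q_1)$, $\mathcal R(P',Q_2)$; and if $P\not\xrightarrow{\tau}$, there is a path $Q\Rightarrow Q_0\not\xrightarrow{\tau}$. $P\leftrightarrow_{b}Q$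 means that some such $\mathcal R$ has $\mathcal R(P,Q)$. $P$ and $Q$ are *rooted stability-respecting branching bisimilar* if $\mathcal R(P,Q)$ for some symmetric $\mathcal R$ such that $\mathcal R(P,Q)$ and $P\xrightarrow{\alpha}P'$, $\alpha\in Act$, imply $Q\xrightarrow{\alpha}Q'$ for some $Q'$ with $P'\leftrightarrow_bQ'$. **The algebra $\mathrm{CCSP}^\theta_{\mathrm t}$.** Let $V$ be a countable set of variables. Expressions are $$E::=0\mid x\mid\alpha.E\mid E+F\mid E\parallel_SF\mid\tau_I(E)\mid\mathcal R(E)\mid\theta_L^U(E)\mid\psi_X(E)\mid\langle y|\mathcal S\rangle$$ with $x\in V$, $\alpha\in Act$, $S,I,L,U,X\subseteq A$, $L\subseteq U$, $\mathcal R\subseteq A\times A$ such that each $\{b\mid(a,b)\in\mathcal R\}$ is finite, $\mathcal S=\{x=\mathcal S_x\mid x\in V_{\mathcal S}\}$ a recursive specification with $V_{\mathcal S}\subseteq V$ (possibly infinite) and expressions $\mathcal S_x$, and $y\in V_{\mathcal S}$. All $\mathcal S_x$ are subexpressions of $\langle y|\mathcal S\rangle$, which binds the variables in $V_{\mathcal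 S}$. An expression $E$ is *valid* if it has no subexpression $\theta_L^U(F)$ or $\psi_X(F)$ with a variable occurrence that is free in $F$ and bound in $E$. *Processes* are the valid expressions without free variables. Their transitions are given by the following rules, where $\alpha\in Act$, $a,b\in A$, and $\theta_X:=\theta_X^X$: - $\alpha.x\xrightarrow{\alpha}x$; if $x\xrightarrow{\alpha}x'$ then $x+y\xrightarrow{\alpha}x'$ and $y+x\xrightarrow{\alpha}x'$; - if $x\xrightarrow{\alpha}x'$ and $\alpha\notin S$ then $x\parallel_Sy\xrightarrow{\alpha}x'\parallel_Sy$ and $y\parallel_Sx\xrightarrow{\alpha}y\parallel_Sx'$; if $x\xrightarrow{a}x'$, $y\xrightarrow{a}y'$ and $a\in S$ then $x\parallel_Sy\xrightarrow{a}x'\parallel_Sy'$; - if $x\xrightarrow{\alpha}x'$ and $\alpha\notin I$ then $\tau_I(x)\xrightarrow{\alpha}\tau_I(x')$; if $x\xrightarrow{a}x'$ and $a\in I$ then $\tau_I(x)\xrightarrow{\tau}\tau_I(x')$; - if $x\xrightarrow{a}x'$ and $(a,b)\in\mathcal R$ then $\mathcal R(x)\xrightarrow{b}\mathcal R(x')$;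 if $x\xrightarrow{\alpha}x'$ with $\alpha\in\{\tau,\mathrm t\}$ then $\mathcal R(x)\xrightarrow{\alpha}\mathcal R(x')$; - if $x\xrightarrow{\tau}x'$ then $\theta_L^U(x)\xrightarrow{\tau}\theta_L^U(x')$; if $x\xrightarrow{a}x'$ and $a\in U$ then $\theta_L^U(x)\xrightarrow{a}x'$; if $x\xrightarrow{\alpha}x'$ and $x$ idles on $L$ then $\theta_L^U(x)\xrightarrow{\alpha}x'$; - if $x\xrightarrow{\alpha}x'$ and $\alpha\neq\mathrm t$ then $\psi_X(x)\xrightarrow{\alpha}x'$; if $x\xrightarrow{\mathrm t}x'$ and $x$ idles on $X$ then $\psi_X(x)\xrightarrow{\mathrm t}\theta_X(x')$; - if $\langle\mathcal S_x|\mathcal S\rangle\xrightarrow{\alpha}x'$ then $\langle x|\mathcal S\rangle\xrightarrow{\alpha}x'$, where $\langle E|\mathcal S\rangle$ is $E$ with each $y\in V_{\mathcal S}$ replaced by $\langle y|\mathcal S\rangle$. A relation $\sim$ on processes is extended to valid expressions by: $E\sim F$ iff $E[\rho]\sim F[\rho]$ for all substitutions $\rho$ mapping every variable to a process. An equivalence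 relation $\sim$ on valid expressions is a *full congruence* if 1. it is a congruence for all operators $0$, $\alpha.\_$, $+$, $\parallel_S$, $\tau_I$, $\mathcal R$, $\theta_L^U$, $\psi_X$ of the language: $E_i\sim F_i$ for all $i$ implies $f(E_0,\dots,E_{n-1})\sim f(F_0,\dots,F_{n-1})$; and 2. for all recursive specifications $\mathcal S,\mathcal S'$ with $V_{\mathcal S}=V_{\mathcal S'}$ and all $x\in V_{\mathcal S}$ such that $\langle x|\mathcal S\rangle$ and $\langle x|\mathcal S'\rangle$ are processes, if $\mathcal S_y\sim\mathcal S'_y$ for all $y\in V_{\mathcal S}$ then $\langle x|\mathcal S\rangle\sim\langle x|\mathcal S'\rangle$. **Theorem.** Rooted concrete branching reactive bisimilarity and rooted stability-respecting branching bisimilarity, on the processes of $\mathrm{CCSP}^\theta_{\mathrm t}$ and extended to valid expressions, are full congruences. -/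

import Mathlib

namespace CCSP

universe u v w

/-! ### Actions and labelled transition systems with time-outs -/

/-- `Act = A ⊎ {τ, t}`: visible actions, the hidden action and the time-out action. -/
inductive Act (A : Type u) : Type u
  | vis (a : A)
  | tau
  | timeout

/-- For a set `I` of actions, `Idle I X` is `I ∩ (X ∪ {τ}) = ∅`. -/
def Idle {A : Type u} (I : Set (Act A)) (X : Set A) : Prop :=
  Act.tau ∉ I ∧ ∀ a ∈ X, Act.vis a ∉ I

/-- A labelled transition system over `Act`, with set of states `P`. -/
abbrev LTS (A : Type u) (P : Type w) : Type (max u w) := P → Act A → P → Prop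

section Bisimilarities

variable {A : Type u} {P : Type w}

/-- The set `I(p)` of initial actions of `p`, a subset of `A ∪ {τ}`. -/
def LTS.initials (T : LTS A P) (p : P) : Set (Act A) :=
  {α | α ≠ Act.timeout ∧ ∃ q, T p α q}

/-- `p` has no outgoing `τ`-transition. -/
def LTS.Stable (T : LTS A P) (p : P) : Prop := ∀ q, ¬ T p Act.tau q

/-- The reflexive-transitive closure of the `τ`-transitions. -/
def LTS.TauPath (T : LTS A P) : P → P → Prop :=
  Relation.ReflTransGen (fun p q => T p Act.tau q)

/-- The optional transition: either `α = τ` and `p = q`, or `p` moves to `q` by `α`. -/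
def LTS.OptStep (T : LTS A P) (p : P) (α : Act A) (q : P) : Prop :=
  (α = Act.tau ∧ p = q) ∨ T p α q

/-- Concrete branching reactive bisimulations: `R` is the set of pairs and `RX` the set of
triples `(p, X, q)`. -/
structure IsCBRBisimulation (T : LTS A P) (R : P → P → Prop) (RX : P → Set A → P → Prop) :
    Prop where
  symm : ∀ p q, R p q → R q p
  symmX : ∀ p X q, RX p X q → RX q X p
  step : ∀ p q, R p q → ∀ α p', α ≠ Act.timeout → T p α p' →
    ∃ q₁ q₂, T.TauPath q q₁ ∧ T.OptStep q₁ α q₂ ∧ R p q₁ ∧ R p' q₂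
  settle : ∀ p q, R p q → ∀ Y, RX p Y q
  tauX : ∀ p X q, RX p X q → ∀ p', T p Act.tau p' →
    ∃ q₁ q₂, T.TauPath q q₁ ∧ T.OptStep q₁ Act.tau q₂ ∧ RX p X q₁ ∧ RX p' X q₂
  visX : ∀ p X q, RX p X q → ∀ a ∈ X, ∀ p', T p (Act.vis a) p' →
    ∃ q₁ q₂, T.TauPath q q₁ ∧ T q₁ (Act.vis a) q₂ ∧ RX p X q₁ ∧ R p' q₂
  idleX : ∀ p X q, RX p X q → Idle (T.initials p) X → ∃ q₀, T.TauPath q q₀ ∧ R p q₀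
  timeoutX : ∀ p X q, RX p X q → Idle (T.initials p) X → ∀ p', T p Act.timeout p' →
    ∃ q₁ q₂, T.TauPath q q₁ ∧ T q₁ Act.timeout q₂ ∧ RX p' X q₂
  stableX : ∀ p X q, RX p X q → T.Stable p → ∃ q₀, T.TauPath q q₀ ∧ T.Stable q₀

/-- Concrete branching reactive bisimilarity. -/
def CBRBisim (T : LTS A P) (p q : P) : Prop :=
  ∃ R RX, IsCBRBisimulation T R RX ∧ R p q

/-- Concrete branching `X`-bisimilarity. -/
def CBRBisimX (T : LTS A P) (X : Set A) (p q : P) : Prop :=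
  ∃ R RX, IsCBRBisimulation T R RX ∧ RX p X q

/-- Rooted concrete branching reactive bisimulations. -/
structure IsRootedCBRBisimulation (T : LTS A P) (R : P → P → Prop)
    (RX : P → Set A → P → Prop) : Prop where
  symm : ∀ p q, R p q → R q p
  symmX : ∀ p X q, RX p X q → RX q X p
  step : ∀ p q, R p q → ∀ α p', α ≠ Act.timeout → T p α p' →
    ∃ q', T q α q' ∧ CBRBisim T p' q'
  settle : ∀ p q, R p q → ∀ Y, RX p Y q
  tauX : ∀ p X q, RX p X q → ∀ p', T p Act.tau p' →
    ∃ q', T q Act.tau q' ∧ CBRBisimX T X p' q'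
  visX : ∀ p X q, RX p X q → ∀ a ∈ X, ∀ p', T p (Act.vis a) p' →
    ∃ q', T q (Act.vis a) q' ∧ CBRBisim T p' q'
  idleX : ∀ p X q, RX p X q → Idle (T.initials p) X → R p q
  timeoutX : ∀ p X q, RX p X q → Idle (T.initials p) X → ∀ p', T p Act.timeout p' →
    ∃ q', T q Act.timeout q' ∧ CBRBisimX T X p' q'

/-- Rooted concrete branching reactive bisimilarity. -/
def RootedCBRBisim (T : LTS A P) (p q : P) : Prop :=
  ∃ R RX, IsRootedCBRBisimulation T R RX ∧ R p q

/-- Stability-respecting branching bisimulations. -/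
structure IsSRBBisimulation (T : LTS A P) (R : P → P → Prop) : Prop where
  symm : ∀ p q, R p q → R q p
  step : ∀ p q, R p q → ∀ α p', T p α p' →
    ∃ q₁ q₂, T.TauPath q q₁ ∧ T.OptStep q₁ α q₂ ∧ R p q₁ ∧ R p' q₂
  stable : ∀ p q, R p q → T.Stable p → ∃ q₀, T.TauPath q q₀ ∧ T.Stable q₀

/-- Stability-respecting branching bisimilarity. -/
def SRBBisim (T : LTS A P) (p q : P) : Prop := ∃ R, IsSRBBisimulation T R ∧ R p q

/-- Rooted stability-respecting branching bisimulations. -/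
structure IsRootedSRBBisimulation (T : LTS A P) (R : P → P → Prop) : Prop where
  symm : ∀ p q, R p q → R q p
  step : ∀ p q, R p q → ∀ α p', T p α p' → ∃ q', T q α q' ∧ SRBBisim T p' q'

/-- Rooted stability-respecting branching bisimilarity. -/
def RootedSRBBisim (T : LTS A P) (p q : P) : Prop := ∃ R, IsRootedSRBBisimulation T R ∧ R p q

end Bisimilarities

/-! ### Syntax -/

/-- The expressions over visible actions `A` and variables `V`. In `fix D S y`, which is
`⟨y | S⟩`, the recursive specification `S` has the equations `x = S x` for `x ∈ D`. -/
inductive Exp (A : Type u) (V : Type v) : Type (max u v)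
  | nil
  | var (x : V)
  | act (α : Act A) (E : Exp A V)
  | sum (E F : Exp A V)
  | par (S : Set A) (E F : Exp A V)
  | hide (I : Set A) (E : Exp A V)
  | ren (R : Set (A × A)) (hR : ∀ a, {b | (a, b) ∈ R}.Finite) (E : Exp A V)
  | theta (L U : Set A) (hLU : L ⊆ U) (E : Exp A V)
  | psi (X : Set A) (E : Exp A V)
  | fix (D : Set V) (S : D → Exp A V) (y : D)

namespace Exp

variable {A : Type u} {V : Type v}

/-- The variables with a free occurrence in an expression. -/
def fv : Exp A V → Set V
  | nil => ∅
  | var x => {x}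
  | act _ E => fv E
  | sum E F => fv E ∪ fv F
  | par _ E F => fv E ∪ fv F
  | hide _ E => fv E
  | ren _ _ E => fv E
  | theta _ _ _ E => fv E
  | psi _ E => fv E
  | fix D S _ => (⋃ z, fv (S z)) \ D

/-- Validity of an expression that occurs in the scope of binders of the variables in `B`: no
variable that is free in the argument of an environment operator is bound further outside. -/
def ValidIn : Set V → Exp A V → Prop
  | _, nil => True
  | _, var _ => True
  | B, act _ E => ValidIn B E
  | B, sum E F => ValidIn B E ∧ ValidIn B F
  | B, par _ E F => ValidIn B E ∧ ValidIn B F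
  | B, hide _ E => ValidIn B E
  | B, ren _ _ E => ValidIn B E
  | B, theta _ _ _ E => Disjoint (fv E) B ∧ ValidIn B E
  | B, psi _ E => Disjoint (fv E) B ∧ ValidIn B E
  | B, fix D S _ => ∀ z, ValidIn (B ∪ D) (S z)

/-- An expression is valid if it has no subexpression `θ_L^U(F)` or `ψ_X(F)` with a variable
occurrence that is free in `F` but bound in the whole expression. -/
def Valid (E : Exp A V) : Prop := ValidIn ∅ E

/-- Valid and without free variables. -/
def Closed (E : Exp A V) : Prop := Valid E ∧ fv E = ∅

open Classical in
/-- The substitution that is `var` on `D` and `σ` elsewhere. -/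
noncomputable def shield (D : Set V) (σ : V → Exp A V) : V → Exp A V :=
  fun x => if x ∈ D then var x else σ x

/-- Simultaneous substitution for the free variable occurrences. It is only ever applied to
substitutions by closed expressions, so that no bound variable has to be renamed. -/
noncomputable def subst : (V → Exp A V) → Exp A V → Exp A V
  | _, nil => nil
  | σ, var x => σ x
  | σ, act α E => act α (subst σ E)
  | σ, sum E F => sum (subst σ E) (subst σ F)
  | σ, par S E F => par S (subst σ E) (subst σ F)
  | σ, hide I E => hide I (subst σ E)
  | σ, ren R hR E => ren R hR (subst σ E)
  | σ, theta L U h E => theta L U h (subst σ E)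
  | σ, psi X E => psi X (subst σ E)
  | σ, fix D S y => fix D (fun z => subst (shield D σ) (S z)) y

open Classical in
/-- The substitution `x ↦ ⟨x | S⟩` for `x ∈ D`. -/
noncomputable def solution (D : Set V) (S : D → Exp A V) : V → Exp A V :=
  fun x => if h : x ∈ D then fix D S ⟨x, h⟩ else var x

/-! ### Operational semantics -/

/-- The transitions that the rules of the operational semantics derive when the negative
premises `I(x) ∩ (L ∪ {τ}) = ∅` are evaluated with `N x` in place of `I(x)`. -/
inductive Derivable (N : Exp A V → Set (Act A)) : Exp A V → Act A → Exp A V → Prop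
  | act (α E) : Derivable N (act α E) α E
  | sum_left (E F α E') : Derivable N E α E' → Derivable N (sum E F) α E'
  | sum_right (E F α F') : Derivable N F α F' → Derivable N (sum E F) α F'
  | par_left (S E F α E') : Derivable N E α E' → α ∉ Act.vis '' S →
      Derivable N (par S E F) α (par S E' F)
  | par_right (S E F α F') : Derivable N F α F' → α ∉ Act.vis '' S →
      Derivable N (par S E F) α (par S E F')
  | par_sync (S E F a E' F') : Derivable N E (Act.vis a) E' → Derivable N F (Act.vis a) F' →
      a ∈ S → Derivable N (par S E F) (Act.vis a) (par S E' F')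
  | hide_out (I E α E') : Derivable N E α E' → α ∉ Act.vis '' I →
      Derivable N (hide I E) α (hide I E')
  | hide_in (I E a E') : Derivable N E (Act.vis a) E' → a ∈ I →
      Derivable N (hide I E) Act.tau (hide I E')
  | ren_vis (R hR E a b E') : Derivable N E (Act.vis a) E' → (a, b) ∈ R →
      Derivable N (ren R hR E) (Act.vis b) (ren R hR E')
  | ren_tau (R hR E E') : Derivable N E Act.tau E' →
      Derivable N (ren R hR E) Act.tau (ren R hR E')
  | ren_timeout (R hR E E') : Derivable N E Act.timeout E' →
      Derivable N (ren R hR E) Act.timeout (ren R hR E')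
  | theta_tau (L U h E E') : Derivable N E Act.tau E' →
      Derivable N (theta L U h E) Act.tau (theta L U h E')
  | theta_vis (L U h E a E') : Derivable N E (Act.vis a) E' → a ∈ U →
      Derivable N (theta L U h E) (Act.vis a) E'
  | theta_idle (L U h E α E') : Derivable N E α E' → Idle (N E) L →
      Derivable N (theta L U h E) α E'
  | psi_act (X E α E') : Derivable N E α E' → α ≠ Act.timeout →
      Derivable N (psi X E) α E'
  | psi_timeout (X E E') : Derivable N E Act.timeout E' → Idle (N E) X →
      Derivable N (psi X E) Act.timeout (theta X X subset_rfl E')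
  | fix (D S y α E') : Derivable N (subst (solution D S) (S y)) α E' →
      Derivable N (fix D S y) α E'

/-- The initial actions that can be derived from `N`. -/
def derivedInitials (N : Exp A V → Set (Act A)) (E : Exp A V) : Set (Act A) :=
  {α | α ≠ Act.timeout ∧ ∃ E', Derivable N E α E'}

/-- The initial actions that certainly exist: the least fixed point of the (monotone) square of
the (antitone) operator `derivedInitials`. -/
def certainInitials : Exp A V → Set (Act A) :=
  sInf {K | derivedInitials (derivedInitials K) ≤ K}

/-- The transition relation: the well-founded model of the rules, in which a negative premise
holds if the initial actions that it excludes are underivable. By `step_iff` below, on closed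
expressions this is the relation in which the negative premises have their literal meaning. -/
def Step : Exp A V → Act A → Exp A V → Prop :=
  Derivable (derivedInitials certainInitials)

end Exp

/-! ### Closed expressions are preserved by substitution and by transitions -/

namespace Exp

variable {A : Type u} {V : Type v}

theorem ValidIn.anti {E : Exp A V} : ∀ {B C : Set V}, C ⊆ B → ValidIn B E → ValidIn C E := by
  induction E with
  | nil => intros; trivial
  | var => intros; trivial
  | act α E ih => intro B C h hE; exact ih h hE
  | sum E F ihE ihF => intro B C h hE; exact ⟨ihE h hE.1, ihF h hE.2⟩
  | par S E F ihE ihF => intro B C h hE; exact ⟨ihE h hE.1, ihF h hE.2⟩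
  | hide I E ih => intro B C h hE; exact ih h hE
  | ren R hR E ih => intro B C h hE; exact ih h hE
  | theta L U hLU E ih => intro B C h hE; exact ⟨hE.1.mono_right h, ih h hE.2⟩
  | psi X E ih => intro B C h hE; exact ⟨hE.1.mono_right h, ih h hE.2⟩
  | fix D S y ih => intro B C h hE z; exact ih z (Set.union_subset_union_left D h) (hE z)

theorem ValidIn.extend {E : Exp A V} : ∀ {B C : Set V}, ValidIn B E → Disjoint (fv E) C →
    ValidIn (B ∪ C) E := by
  induction E with
  | nil => intros; trivial
  | var => intros; trivial
  | act α E ih => intro B C hE h; exact ih hE h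
  | sum E F ihE ihF =>
    intro B C hE h
    have h := Set.disjoint_union_left.1 h
    exact ⟨ihE hE.1 h.1, ihF hE.2 h.2⟩
  | par S E F ihE ihF =>
    intro B C hE h
    have h := Set.disjoint_union_left.1 h
    exact ⟨ihE hE.1 h.1, ihF hE.2 h.2⟩
  | hide I E ih => intro B C hE h; exact ih hE h
  | ren R hR E ih => intro B C hE h; exact ih hE h
  | theta L U hLU E ih =>
    intro B C hE h
    exact ⟨Set.disjoint_union_right.2 ⟨hE.1, h⟩, ih hE.2 h⟩
  | psi X E ih =>
    intro B C hE h
    exact ⟨Set.disjoint_union_right.2 ⟨hE.1, h⟩, ih hE.2 h⟩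
  | fix D S y ih =>
    intro B C hE h z
    have h1 : Disjoint (fv (S z)) (C \ D) := by
      rw [Set.disjoint_left] at h ⊢
      intro x hx hxC
      exact h ⟨Set.mem_iUnion.2 ⟨z, hx⟩, hxC.2⟩ hxC.1
    refine (ih z (hE z) h1).anti ?_
    intro x hx
    by_cases hD : x ∈ D
    · exact Or.inl (Or.inr hD)
    · rcases hx with (hB | hC) | hD'
      · exact Or.inl (Or.inl hB)
      · exact Or.inr ⟨hC, hD⟩
      · exact absurd hD' hD

theorem Closed.validIn {E : Exp A V} (h : Closed E) (B : Set V) : ValidIn B E :=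
  (h.1.extend (C := B) (by rw [h.2]; exact Set.empty_disjoint B)).anti Set.subset_union_right

/-- Every variable is either mapped to a closed expression or left unchanged. -/
def ClosedSubst (σ : V → Exp A V) : Prop := ∀ x, σ x = var x ∨ Closed (σ x)

theorem ClosedSubst.shield {σ : V → Exp A V} (h : ClosedSubst σ) (D : Set V) :
    ClosedSubst (shield D σ) := by
  intro x
  by_cases hx : x ∈ D
  · exact Or.inl (by simp [Exp.shield, hx])
  · simpa [Exp.shield, hx] using h x

theorem fv_subst {E : Exp A V} : ∀ {σ : V → Exp A V}, ClosedSubst σ →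
    fv (subst σ E) ⊆ {x | x ∈ fv E ∧ σ x = var x} := by
  induction E with
  | nil => intro σ _ x hx; exact hx.elim
  | var y =>
    intro σ h x hx
    simp only [subst] at hx
    rcases h y with hy | hy
    · rw [hy] at hx
      have : x = y := hx
      subst this
      exact ⟨rfl, hy⟩
    · rw [hy.2] at hx
      exact hx.elim
  | act α E ih => intro σ h; exact ih h
  | sum E F ihE ihF =>
    intro σ h x hx
    rcases hx with hx | hx
    · exact ⟨Or.inl (ihE h hx).1, (ihE h hx).2⟩
    · exact ⟨Or.inr (ihF h hx).1, (ihF h hx).2⟩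
  | par S E F ihE ihF =>
    intro σ h x hx
    rcases hx with hx | hx
    · exact ⟨Or.inl (ihE h hx).1, (ihE h hx).2⟩
    · exact ⟨Or.inr (ihF h hx).1, (ihF h hx).2⟩
  | hide I E ih => intro σ h; exact ih h
  | ren R hR E ih => intro σ h; exact ih h
  | theta L U hLU E ih => intro σ h; exact ih h
  | psi X E ih => intro σ h; exact ih h
  | fix D S y ih =>
    intro σ h x hx
    obtain ⟨hx, hD⟩ := hx
    obtain ⟨z, hz⟩ := Set.mem_iUnion.1 hx
    have h1 := ih z (h.shield D) hz
    refine ⟨⟨Set.mem_iUnion.2 ⟨z, h1.1⟩, hD⟩, ?_⟩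
    simpa [Exp.shield, hD] using h1.2

theorem ValidIn.subst {E : Exp A V} : ∀ {B : Set V} {σ : V → Exp A V}, ClosedSubst σ →
    ValidIn B E → ValidIn B (subst σ E) := by
  induction E with
  | nil => intros; trivial
  | var y =>
    intro B σ h _
    rcases h y with hy | hy
    · simp only [Exp.subst, hy]; trivial
    · exact hy.validIn B
  | act α E ih => intro B σ h hE; exact ih h hE
  | sum E F ihE ihF => intro B σ h hE; exact ⟨ihE h hE.1, ihF h hE.2⟩
  | par S E F ihE ihF => intro B σ h hE; exact ⟨ihE h hE.1, ihF h hE.2⟩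
  | hide I E ih => intro B σ h hE; exact ih h hE
  | ren R hR E ih => intro B σ h hE; exact ih h hE
  | theta L U hLU E ih =>
    intro B σ h hE
    exact ⟨hE.1.mono_left fun x hx => (fv_subst h hx).1, ih h hE.2⟩
  | psi X E ih =>
    intro B σ h hE
    exact ⟨hE.1.mono_left fun x hx => (fv_subst h hx).1, ih h hE.2⟩
  | fix D S y ih => intro B σ h hE z; exact ih z (h.shield D) (hE z)

theorem Closed.subst {E : Exp A V} (hE : Valid E) {σ : V → Exp A V} (h : ∀ x, Closed (σ x)) :
    Closed (subst σ E) := by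
  refine ⟨ValidIn.subst (fun x => Or.inr (h x)) hE, Set.eq_empty_of_forall_notMem ?_⟩
  intro x hx
  have h1 := (fv_subst (fun x => Or.inr (h x)) hx).2
  have h2 := (h x).2
  rw [h1] at h2
  exact (Set.singleton_ne_empty x) h2

theorem Closed.closedSubst {D : Set V} {S : D → Exp A V} {y : D} (h : Closed (fix D S y)) :
    ClosedSubst (solution D S) := by
  intro x
  by_cases hx : x ∈ D
  · exact Or.inr (by simp only [solution, hx, dif_pos]; exact h)
  · exact Or.inl (by simp [solution, hx])

theorem Closed.unfold {D : Set V} {S : D → Exp A V} {y : D} (h : Closed (fix D S y)) :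
    Closed (Exp.subst (solution D S) (S y)) := by
  refine ⟨ValidIn.subst h.closedSubst ((h.1 y).anti (Set.empty_subset _)),
    Set.eq_empty_of_forall_notMem ?_⟩
  intro x hx
  obtain ⟨h1, h2⟩ := fv_subst h.closedSubst hx
  by_cases hD : x ∈ D
  · simp [solution, hD] at h2
  · have h3 : x ∈ fv (fix D S y) := ⟨Set.mem_iUnion.2 ⟨y, h1⟩, hD⟩
    rw [h.2] at h3
    exact h3

theorem closed_sum {E F : Exp A V} : Closed (sum E F) ↔ Closed E ∧ Closed F := by
  simp only [Closed, Valid, ValidIn, fv, Set.union_empty_iff]; tauto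

theorem closed_par {S : Set A} {E F : Exp A V} :
    Closed (par S E F) ↔ Closed E ∧ Closed F := by
  simp only [Closed, Valid, ValidIn, fv, Set.union_empty_iff]; tauto

theorem closed_theta {L U : Set A} {h : L ⊆ U} {E : Exp A V} :
    Closed (theta L U h E) ↔ Closed E := by
  simp [Closed, Valid, ValidIn, fv]

theorem closed_psi {X : Set A} {E : Exp A V} : Closed (psi X E) ↔ Closed E := by
  simp [Closed, Valid, ValidIn, fv]

theorem Derivable.closed {N : Exp A V → Set (Act A)} {E E' : Exp A V} {α : Act A}
    (h : Derivable N E α E') : Closed E → Closed E' := by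
  induction h with
  | act α E => exact id
  | sum_left E F α E' _ ih => exact fun h => ih (closed_sum.1 h).1
  | sum_right E F α F' _ ih => exact fun h => ih (closed_sum.1 h).2
  | par_left S E F α E' _ _ ih =>
    exact fun h => closed_par.2 ⟨ih (closed_par.1 h).1, (closed_par.1 h).2⟩
  | par_right S E F α F' _ _ ih =>
    exact fun h => closed_par.2 ⟨(closed_par.1 h).1, ih (closed_par.1 h).2⟩
  | par_sync S E F a E' F' _ _ _ ihE ihF =>
    exact fun h => closed_par.2 ⟨ihE (closed_par.1 h).1, ihF (closed_par.1 h).2⟩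
  | hide_out I E α E' _ _ ih => exact ih
  | hide_in I E a E' _ _ ih => exact ih
  | ren_vis R hR E a b E' _ _ ih => exact ih
  | ren_tau R hR E E' _ ih => exact ih
  | ren_timeout R hR E E' _ ih => exact ih
  | theta_tau L U h E E' _ ih => exact fun h => closed_theta.2 (ih (closed_theta.1 h))
  | theta_vis L U h E a E' _ _ ih => exact fun h => ih (closed_theta.1 h)
  | theta_idle L U h E α E' _ _ ih => exact fun h => ih (closed_theta.1 h)
  | psi_act X E α E' _ _ ih => exact fun h => ih (closed_psi.1 h)
  | psi_timeout X E E' _ _ ih => exact fun h => closed_theta.2 (ih (closed_psi.1 h))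
  | fix D S y α E' _ ih => exact fun h => ih h.unfold

/-! ### The negative premises are decided on closed expressions -/

theorem Derivable.anti {M N : Exp A V → Set (Act A)} (hMN : M ≤ N) {E E' : Exp A V}
    {α : Act A} (h : Derivable N E α E') : Derivable M E α E' := by
  induction h with
  | act => constructor
  | sum_left => apply Derivable.sum_left; assumption
  | sum_right => apply Derivable.sum_right; assumption
  | par_left => apply Derivable.par_left <;> assumption
  | par_right => apply Derivable.par_right <;> assumption
  | par_sync => apply Derivable.par_sync <;> assumption
  | hide_out => apply Derivable.hide_out <;> assumption
  | hide_in => apply Derivable.hide_in <;> assumption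
  | ren_vis => apply Derivable.ren_vis <;> assumption
  | ren_tau => apply Derivable.ren_tau; assumption
  | ren_timeout => apply Derivable.ren_timeout; assumption
  | theta_tau => apply Derivable.theta_tau; assumption
  | theta_vis => apply Derivable.theta_vis <;> assumption
  | theta_idle L U h E α E' _ hI ih =>
    exact .theta_idle L U h E α E' ih ⟨fun h => hI.1 (hMN E h), fun a ha h => hI.2 a ha (hMN E h)⟩
  | psi_act => apply Derivable.psi_act <;> assumption
  | psi_timeout X E E' _ hI ih =>
    exact .psi_timeout X E E' ih ⟨fun h => hI.1 (hMN E h), fun a ha h => hI.2 a ha (hMN E h)⟩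
  | fix => apply Derivable.fix; assumption

theorem derivedInitials_anti : Antitone (derivedInitials (A := A) (V := V)) :=
  fun _ _ h _ _ hα => ⟨hα.1, hα.2.imp fun _ hE' => hE'.anti h⟩

theorem certainInitials_eq :
    derivedInitials (derivedInitials certainInitials) = certainInitials (A := A) (V := V) :=
  OrderHom.map_lfp (⟨fun K => derivedInitials (derivedInitials K),
    fun _ _ h => derivedInitials_anti (derivedInitials_anti h)⟩ :
    (Exp A V → Set (Act A)) →o (Exp A V → Set (Act A)))

/-- The arguments of the unguarded environment operators satisfy `p`. -/
def Args (p : Exp A V → Prop) : Exp A V → Prop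
  | nil => True
  | var _ => True
  | act _ _ => True
  | sum E F => Args p E ∧ Args p F
  | par _ E F => Args p E ∧ Args p F
  | hide _ E => Args p E
  | ren _ _ E => Args p E
  | theta _ _ _ E => p E ∧ Args p E
  | psi _ E => p E ∧ Args p E
  | fix _ S _ => ∀ z, Args p (S z)

theorem subst_eq_self {E : Exp A V} : ∀ {σ : V → Exp A V}, (∀ x ∈ fv E, σ x = var x) →
    subst σ E = E := by
  induction E with
  | nil => intros; rfl
  | var y => intro σ h; exact h y rfl
  | act α E ih => intro σ h; simp only [subst, ih h]
  | sum E F ihE ihF =>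
    intro σ h
    simp only [subst, ihE fun x hx => h x (Or.inl hx), ihF fun x hx => h x (Or.inr hx)]
  | par S E F ihE ihF =>
    intro σ h
    simp only [subst, ihE fun x hx => h x (Or.inl hx), ihF fun x hx => h x (Or.inr hx)]
  | hide I E ih => intro σ h; simp only [subst, ih h]
  | ren R hR E ih => intro σ h; simp only [subst, ih h]
  | theta L U hLU E ih => intro σ h; simp only [subst, ih h]
  | psi X E ih => intro σ h; simp only [subst, ih h]
  | fix D S y ih =>
    intro σ h
    simp only [subst]
    congr 1
    funext z
    apply ih z
    intro x hx
    by_cases hD : x ∈ D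
    · simp [shield, hD]
    · simpa [shield, hD] using h x ⟨Set.mem_iUnion.2 ⟨z, hx⟩, hD⟩

theorem Closed.subst_eq {E : Exp A V} (h : Closed E) (σ : V → Exp A V) : Exp.subst σ E = E :=
  subst_eq_self fun x hx => by rw [h.2] at hx; exact hx.elim

theorem Args.subst {p : Exp A V → Prop} (hp : ∀ E, p E → Closed E) {E : Exp A V} :
    ∀ {σ : V → Exp A V}, (∀ x, Args p (σ x)) → Args p E → Args p (subst σ E) := by
  induction E with
  | nil => intros; trivial
  | var y => intro σ h _; exact h y
  | act α E ih => intros; trivial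
  | sum E F ihE ihF => intro σ h hE; exact ⟨ihE h hE.1, ihF h hE.2⟩
  | par S E F ihE ihF => intro σ h hE; exact ⟨ihE h hE.1, ihF h hE.2⟩
  | hide I E ih => intro σ h hE; exact ih h hE
  | ren R hR E ih => intro σ h hE; exact ih h hE
  | theta L U hLU E ih =>
    intro σ h hE
    exact ⟨by rw [(hp E hE.1).subst_eq]; exact hE.1, ih h hE.2⟩
  | psi X E ih =>
    intro σ h hE
    exact ⟨by rw [(hp E hE.1).subst_eq]; exact hE.1, ih h hE.2⟩
  | fix D S y ih =>
    intro σ h hE z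
    refine ih z (fun x => ?_) (hE z)
    by_cases hD : x ∈ D
    · simp [shield, hD, Args]
    · simpa [shield, hD] using h x

/-- The derivable transitions only depend on the value of `N` at arguments of environment
operators. -/
theorem Derivable.of_args {M N : Exp A V → Set (Act A)} {E E' : Exp A V} {α : Act A}
    (h : Derivable N E α E') : Args (fun F => Closed F ∧ M F = N F) E → Derivable M E α E' := by
  induction h with
  | act => intro _; constructor
  | sum_left _ _ _ _ _ ih => exact fun h => .sum_left _ _ _ _ (ih h.1)
  | sum_right _ _ _ _ _ ih => exact fun h => .sum_right _ _ _ _ (ih h.2)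
  | par_left _ _ _ _ _ _ hα ih => exact fun h => .par_left _ _ _ _ _ (ih h.1) hα
  | par_right _ _ _ _ _ _ hα ih => exact fun h => .par_right _ _ _ _ _ (ih h.2) hα
  | par_sync _ _ _ _ _ _ _ _ ha ihE ihF =>
    exact fun h => .par_sync _ _ _ _ _ _ (ihE h.1) (ihF h.2) ha
  | hide_out _ _ _ _ _ hα ih => exact fun h => .hide_out _ _ _ _ (ih h) hα
  | hide_in _ _ _ _ _ ha ih => exact fun h => .hide_in _ _ _ _ (ih h) ha
  | ren_vis _ _ _ _ _ _ _ hab ih => exact fun h => .ren_vis _ _ _ _ _ _ (ih h) hab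
  | ren_tau _ _ _ _ _ ih => exact fun h => .ren_tau _ _ _ _ (ih h)
  | ren_timeout _ _ _ _ _ ih => exact fun h => .ren_timeout _ _ _ _ (ih h)
  | theta_tau _ _ _ _ _ _ ih => exact fun h => .theta_tau _ _ _ _ _ (ih h.2)
  | theta_vis _ _ _ _ _ _ _ ha ih => exact fun h => .theta_vis _ _ _ _ _ _ (ih h.2) ha
  | theta_idle _ _ _ _ _ _ _ hI ih =>
    exact fun h => .theta_idle _ _ _ _ _ _ (ih h.2) (by rw [h.1.2]; exact hI)
  | psi_act _ _ _ _ _ hα ih => exact fun h => .psi_act _ _ _ _ (ih h.2) hα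
  | psi_timeout _ _ _ _ hI ih =>
    exact fun h => .psi_timeout _ _ _ (ih h.2) (by rw [h.1.2]; exact hI)
  | fix D S y _ _ _ ih =>
    intro h
    refine .fix _ _ _ _ _ (ih (Args.subst (fun _ h => h.1) (fun x => ?_) (h y)))
    by_cases hx : x ∈ D
    · simp only [solution, hx, dif_pos]; exact h
    · simp [solution, hx, Args]

theorem certain_args (E : Exp A V) : ∀ B, fv E ⊆ B → ValidIn B E →
    Args (fun F => Closed F ∧ certainInitials F = derivedInitials certainInitials F) E := by
  have key : ∀ (B : Set V) (E : Exp A V), Disjoint (fv E) B → ValidIn B E → fv E ⊆ B →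
      Args (fun F => Closed F ∧ certainInitials F = derivedInitials certainInitials F) E →
      Closed E ∧ certainInitials E = derivedInitials certainInitials E := by
    intro B E hd hv hB hE
    refine ⟨⟨hv.anti (Set.empty_subset B), ?_⟩, ?_⟩
    · exact Set.eq_empty_of_forall_notMem fun x hx => Set.disjoint_left.1 hd hx (hB hx)
    · have hsymm : Args (fun F => Closed F ∧ derivedInitials certainInitials F =
          certainInitials F) E := by
        simpa only [eq_comm] using hE
      conv_lhs => rw [← certainInitials_eq]
      ext α
      exact ⟨fun h => ⟨h.1, h.2.imp fun _ h' => h'.of_args hE⟩,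
        fun h => ⟨h.1, h.2.imp fun _ h' => h'.of_args hsymm⟩⟩
  induction E with
  | nil => intros; trivial
  | var => intros; trivial
  | act => intros; trivial
  | sum E F ihE ihF =>
    intro B hB hE
    exact ⟨ihE B (Set.union_subset_iff.1 hB).1 hE.1, ihF B (Set.union_subset_iff.1 hB).2 hE.2⟩
  | par S E F ihE ihF =>
    intro B hB hE
    exact ⟨ihE B (Set.union_subset_iff.1 hB).1 hE.1, ihF B (Set.union_subset_iff.1 hB).2 hE.2⟩
  | hide I E ih => intro B hB hE; exact ih B hB hE
  | ren R hR E ih => intro B hB hE; exact ih B hB hE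
  | theta L U hLU E ih =>
    intro B hB hE
    exact ⟨key B E hE.1 hE.2 hB (ih B hB hE.2), ih B hB hE.2⟩
  | psi X E ih =>
    intro B hB hE
    exact ⟨key B E hE.1 hE.2 hB (ih B hB hE.2), ih B hB hE.2⟩
  | fix D S y ih =>
    intro B hB hE z
    refine ih z (B ∪ D) (fun x hx => ?_) (hE z)
    by_cases hD : x ∈ D
    · exact Or.inr hD
    · exact Or.inl (hB ⟨Set.mem_iUnion.2 ⟨z, hx⟩, hD⟩)

/-- On closed expressions, `Step` is generated by the rules of the operational semantics with the
negative premises evaluated in `Step` itself. -/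
theorem step_iff {E : Exp A V} (hE : Closed E) (α : Act A) (E' : Exp A V) :
    Step E α E' ↔ Derivable (LTS.initials Step) E α E' := by
  have h0 : LTS.initials (Step (A := A) (V := V)) = certainInitials := certainInitials_eq
  have h1 := certain_args E ∅ (by rw [hE.2]) hE.1
  rw [h0]
  exact ⟨fun h => h.of_args h1, fun h => h.of_args (by simpa only [eq_comm] using h1)⟩

end Exp

/-! ### Valid expressions, processes and their transitions -/

variable {A : Type u} {V : Type v}

/-- The valid expressions. -/
def ValidExp (A : Type u) (V : Type v) : Type (max u v) := {E : Exp A V // E.Valid}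

/-- The closed valid expressions, that is, the processes of the algebra. -/
def Proc (A : Type u) (V : Type v) : Type (max u v) := {E : Exp A V // E.Closed}

/-- The labelled transition system of the processes. By `Exp.Derivable.closed`, all transitions
of a process lead to processes. -/
def procLTS (A : Type u) (V : Type v) : LTS A (Proc A V) := fun P α Q => Exp.Step P.1 α Q.1

namespace ValidExp

def act (α : Act A) (E : ValidExp A V) : ValidExp A V := ⟨.act α E.1, E.2⟩

def sum (E F : ValidExp A V) : ValidExp A V := ⟨.sum E.1 F.1, E.2, F.2⟩

def par (S : Set A) (E F : ValidExp A V) : ValidExp A V := ⟨.par S E.1 F.1, E.2, F.2⟩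

def hide (I : Set A) (E : ValidExp A V) : ValidExp A V := ⟨.hide I E.1, E.2⟩

def ren (R : Set (A × A)) (hR : ∀ a, {b | (a, b) ∈ R}.Finite) (E : ValidExp A V) :
    ValidExp A V := ⟨.ren R hR E.1, E.2⟩

def theta (L U : Set A) (hLU : L ⊆ U) (E : ValidExp A V) : ValidExp A V :=
  ⟨.theta L U hLU E.1, Set.disjoint_empty _, E.2⟩

def psi (X : Set A) (E : ValidExp A V) : ValidExp A V :=
  ⟨.psi X E.1, Set.disjoint_empty _, E.2⟩

/-- The process `E[ρ]`, for `ρ` a substitution of processes for all variables. -/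
noncomputable def inst (E : ValidExp A V) (ρ : V → Proc A V) : Proc A V :=
  ⟨Exp.subst (fun x => (ρ x).1) E.1, Exp.Closed.subst E.2 fun x => (ρ x).2⟩

end ValidExp

/-- The extension of a relation on processes to valid expressions. -/
def openExt (r : Proc A V → Proc A V → Prop) (E F : ValidExp A V) : Prop :=
  ∀ ρ : V → Proc A V, r (E.inst ρ) (F.inst ρ)

/-- Full congruences: equivalences that are preserved by all operators of the language, and by
the recursion construct in the sense that pointwise related recursive specifications with the
same variables have related components, whenever these are closed. (For the constant `0`,
preservation is reflexivity.) -/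
structure IsFullCongruence (r : ValidExp A V → ValidExp A V → Prop) : Prop where
  equivalence : Equivalence r
  act : ∀ α E F, r E F → r (E.act α) (F.act α)
  sum : ∀ E₁ F₁ E₂ F₂, r E₁ F₁ → r E₂ F₂ → r (E₁.sum E₂) (F₁.sum F₂)
  par : ∀ S E₁ F₁ E₂ F₂, r E₁ F₁ → r E₂ F₂ → r (E₁.par S E₂) (F₁.par S F₂)
  hide : ∀ I E F, r E F → r (E.hide I) (F.hide I)
  ren : ∀ R hR E F, r E F → r (E.ren R hR) (F.ren R hR)
  theta : ∀ L U hLU E F, r E F → r (E.theta L U hLU) (F.theta L U hLU)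
  psi : ∀ X E F, r E F → r (E.psi X) (F.psi X)
  fix : ∀ (D : Set V) (S S' : D → ValidExp A V) (x : D)
    (h : Exp.Closed (.fix D (fun y => (S y).1) x))
    (h' : Exp.Closed (.fix D (fun y => (S' y).1) x)),
    (∀ y, r (S y) (S' y)) →
      r ⟨.fix D (fun y => (S y).1) x, h.1⟩ ⟨.fix D (fun y => (S' y).1) x, h'.1⟩

end CCSP

namespace CCSP

universe u v w

/-! The delicate point is the negative premises, which ask what a process cannot do. If `p` is
stable and bisimilar to `q`, the stability clause lets `q` reach a stable `q₀` by τ-steps, and `p`,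
which cannot move silently, is still bisimilar to `q₀` (`stay`, `exists_stable`). Between bisimilar
stable states the branching conditions collapse to one-to-one matching (`step_of_stable`), so both
states have the same initial actions and idle on the same sets (`initials_eq`). Hence a transition
with a negative premise can be matched after some τ-steps.

Rooted bisimilarity of two processes just says that their first transitions match one by one, up to
unrooted bisimilarity of the targets (`rootedSRBBisim_iff`, `rootedCBRBisim_iff`). Rooted congruence
for an operator therefore reduces to unrooted congruence for whatever is left of it after one step.
Prefix and choice disappear, ψ_X disappears or leaves θ_X, and only relabelling (abstraction and
renaming at once), parallel composition and θ remain. For these, unrooted congruence is proved by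
explicit bisimulations.

In the reactive case an environment `X` of a composite process has to be translated into an
environment of a component: `relabelEnv` for relabelling, `parEnv` for a parallel component whose
partner is stuck as far as `X` alone is concerned. Placing `X`-bisimilar processes under θ_X makes
them fully bisimilar (`CBRBisimX.theta`), which is what the time-out rule of ψ_X needs.

For recursion, let S and S' be pointwise rooted bisimilar, and relate expressions that differ by
replacing ⟨y|S⟩ by ⟨y|S'⟩ outside environment operators (`Exp.Replace`). Validity makes the
arguments of unguarded environment operators closed, so the replacement never has to enter them and
their negative premises are untouched. By induction on derivations a transition of one side is
matched by the other, up to `Replace` followed by bisimilarity: ⟨S_y|S⟩ is compared with ⟨S_y|S'⟩ by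
the induction hypothesis, and ⟨S_y|S'⟩ with ⟨S'_y|S'⟩ by the assumption. The up-to principles
`rootedSRBBisim_of_upTo` and `rootedCBRBisim_of_upTo` conclude. Time-outs in the reactive case
depend on the environment and need a second induction, `Exp.Replace.timeout`, which uses that
related processes have equal initial actions, a consequence of the first one. -/

theorem Act.tau_ne_timeout {A : Type u} : (Act.tau : Act A) ≠ Act.timeout := nofun

theorem Act.vis_ne_timeout {A : Type u} (a : A) : Act.vis a ≠ Act.timeout := nofun

theorem Act.vis_ne_tau {A : Type u} (a : A) : Act.vis a ≠ Act.tau := nofun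

/-! ### Stability, idling and τ-paths. -/

section Simulations

variable {A : Type u} {P : Type w} {T : LTS A P}

theorem LTS.stable_iff {p : P} : T.Stable p ↔ Act.tau ∉ T.initials p :=
  ⟨fun h h' => h'.2.elim h, fun h q hq => h ⟨Act.tau_ne_timeout, q, hq⟩⟩

theorem Idle.stable {p : P} {X : Set A} (h : Idle (T.initials p) X) : T.Stable p :=
  LTS.stable_iff.2 h.1

theorem LTS.initials_vis {p q : P} {a : A} (h : T p (Act.vis a) q) :
    Act.vis a ∈ T.initials p := ⟨(Act.vis_ne_timeout _), q, h⟩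

theorem Idle.not_vis {p q : P} {X : Set A} {a : A} (h : Idle (T.initials p) X) (ha : a ∈ X)
    (hq : T p (Act.vis a) q) : False := h.2 a ha (LTS.initials_vis hq)

theorem LTS.Stable.idle {p : P} {X : Set A} (h : T.Stable p)
    (hX : ∀ a ∈ X, ∀ q, ¬ T p (Act.vis a) q) : Idle (T.initials p) X :=
  ⟨LTS.stable_iff.1 h, fun a ha h' => h'.2.elim (hX a ha)⟩

theorem LTS.Stable.eq_of_tauPath {p q : P} (h : T.Stable p) (hq : T.TauPath p q) : q = p := by
  rcases hq.cases_head with rfl | ⟨r, hr, _⟩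
  · rfl
  · exact (h r hr).elim

theorem LTS.OptStep.of_ne {p q : P} {α : Act A} (h : T.OptStep p α q) (hα : α ≠ Act.tau) :
    T p α q := h.resolve_left fun h' => hα h'.1

theorem LTS.OptStep.tauPath {p q : P} (h : T.OptStep p Act.tau q) : T.TauPath p q := by
  rcases h with ⟨_, rfl⟩ | h
  · exact .refl
  · exact .single h

theorem LTS.OptStep.map {Q : Type*} {U : LTS A Q} {f : P → Q}
    {α β : Act A} (hαβ : α = Act.tau → β = Act.tau)
    (hf : ∀ p q, T p α q → U (f p) β (f q)) {p q : P} (h : T.OptStep p α q) :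
    U.OptStep (f p) β (f q) := by
  rcases h with ⟨hα, rfl⟩ | h
  · exact Or.inl ⟨hαβ hα, rfl⟩
  · exact Or.inr (hf _ _ h)

theorem LTS.TauPath.map {Q : Type*} {U : LTS A Q} {f : P → Q}
    (hf : ∀ p q, T p Act.tau q → U (f p) Act.tau (f q)) {p q : P} (h : T.TauPath p q) :
    U.TauPath (f p) (f q) := Relation.ReflTransGen.lift f hf _ _ h

/-- A relation that is forward closed under `τ`-steps, matched by `τ`-paths, is forward closed
under `τ`-paths. -/
theorem LTS.TauPath.transfer {R : P → P → Prop}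
    (hR : ∀ p q, R p q → ∀ p', T p Act.tau p' → ∃ q', T.TauPath q q' ∧ R p' q')
    {p p' q : P} (h : T.TauPath p p') (hpq : R p q) : ∃ q', T.TauPath q q' ∧ R p' q' := by
  induction h with
  | refl => exact ⟨q, .refl, hpq⟩
  | tail _ h ih =>
    obtain ⟨q₁, h1, h2⟩ := ih
    obtain ⟨q₂, h3, h4⟩ := hR _ _ h2 _ h
    exact ⟨q₂, h1.trans h3, h4⟩

/-! ### Stability-respecting branching bisimilarity -/

/-- The conditions on a stability-respecting branching bisimulation other than symmetry. -/
structure IsSRBSimulation (T : LTS A P) (R : P → P → Prop) : Prop where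
  step : ∀ p q, R p q → ∀ α p', T p α p' →
    ∃ q₁ q₂, T.TauPath q q₁ ∧ T.OptStep q₁ α q₂ ∧ R p q₁ ∧ R p' q₂
  stable : ∀ p q, R p q → T.Stable p → ∃ q₀, T.TauPath q q₀ ∧ T.Stable q₀

namespace IsSRBSimulation

variable {R S : P → P → Prop}

theorem path (h : IsSRBSimulation T R) {p q p' : P} (hp : T.TauPath p p') (hR : R p q) :
    ∃ q', T.TauPath q q' ∧ R p' q' :=
  hp.transfer (fun p q hpq p' hp' => by
    obtain ⟨q₁, q₂, h1, h2, _, h4⟩ := h.step p q hpq _ p' hp'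
    exact ⟨q₂, h1.trans h2.tauPath, h4⟩) hR

theorem comp (hR : IsSRBSimulation T R) (hS : IsSRBSimulation T S) :
    IsSRBSimulation T (Relation.Comp R S) where
  step := by
    rintro p r ⟨q, hpq, hqr⟩ α p' hp
    obtain ⟨q₁, q₂, h1, h2, h3, h4⟩ := hR.step p q hpq α p' hp
    obtain ⟨r₁, k1, k2⟩ := hS.path h1 hqr
    rcases h2 with ⟨rfl, rfl⟩ | h2
    -- Here `q₁` answers the τ-step by staying put, so `r₁` may stay put as well.
    · exact ⟨r₁, r₁, k1, Or.inl ⟨rfl, rfl⟩, ⟨q₁, h3, k2⟩, ⟨q₁, h4, k2⟩⟩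
    · obtain ⟨r₂, r₃, k3, k4, k5, k6⟩ := hS.step _ _ k2 α _ h2
      exact ⟨r₂, r₃, k1.trans k3, k4, ⟨q₁, h3, k5⟩, ⟨q₂, h4, k6⟩⟩
  stable := by
    rintro p r ⟨q, hpq, hqr⟩ hp
    obtain ⟨q₀, h1, h2⟩ := hR.stable p q hpq hp
    obtain ⟨r₁, k1, k2⟩ := hS.path h1 hqr
    obtain ⟨r₀, k3, k4⟩ := hS.stable _ _ k2 h2
    exact ⟨r₀, k1.trans k3, k4⟩

theorem bisimulation (h : IsSRBSimulation T R) (hs : ∀ p q, R p q → R q p) :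
    IsSRBBisimulation T R := ⟨hs, h.step, h.stable⟩

theorem bisim (h : IsSRBSimulation T R) (hs : ∀ p q, R p q → R q p) {p q : P} (hpq : R p q) :
    SRBBisim T p q := ⟨R, h.bisimulation hs, hpq⟩

end IsSRBSimulation

namespace SRBBisim

theorem symm {p q : P} : SRBBisim T p q → SRBBisim T q p :=
  fun ⟨R, hR, h⟩ => ⟨R, hR, hR.symm _ _ h⟩

theorem simulation : IsSRBSimulation T (SRBBisim T) where
  step := by
    rintro p q ⟨R, hR, h⟩ α p' hp
    obtain ⟨q₁, q₂, h1, h2, h3, h4⟩ := hR.step p q h α p' hp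
    exact ⟨q₁, q₂, h1, h2, ⟨R, hR, h3⟩, ⟨R, hR, h4⟩⟩
  stable := fun p q ⟨_, hR, h⟩ => hR.stable p q h

theorem refl (p : P) : SRBBisim T p p := by
  refine IsSRBSimulation.bisim (R := Eq) ⟨?_, ?_⟩ (fun _ _ => Eq.symm) rfl
  · rintro p _ rfl α p' h
    exact ⟨p, p', .refl, Or.inr h, rfl, rfl⟩
  · rintro p _ rfl h
    exact ⟨p, .refl, h⟩

theorem trans {p q r : P} (h : SRBBisim T p q) (h' : SRBBisim T q r) : SRBBisim T p r :=
  (simulation.comp simulation).bisim (fun _ _ ⟨m, h1, h2⟩ => ⟨m, h2.symm, h1.symm⟩) ⟨q, h, h'⟩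

/-- By symmetry `p` has to follow the path from `q` to `q'`, and a stable state can follow only by
staying where it is. -/
theorem stay {p q q' : P} (h : SRBBisim T p q) (hp : T.Stable p) (hq : T.TauPath q q') :
    SRBBisim T p q' := by
  obtain ⟨p', h1, h2⟩ := simulation.path hq h.symm
  rw [hp.eq_of_tauPath h1] at h2
  exact h2.symm

theorem exists_stable {p q : P} (h : SRBBisim T p q) (hp : T.Stable p) :
    ∃ q₀, T.TauPath q q₀ ∧ SRBBisim T p q₀ ∧ T.Stable q₀ := by
  obtain ⟨q₀, h1, h2⟩ := simulation.stable p q h hp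
  exact ⟨q₀, h1, h.stay hp h1, h2⟩

/-- Stability of `q` excludes a preliminary τ-path, and stability of `p` excludes the empty answer,
which is reserved for τ. -/
theorem step_of_stable {p q p' : P} {α : Act A} (h : SRBBisim T p q) (hp : T.Stable p)
    (hq : T.Stable q) (hp' : T p α p') : ∃ q', T q α q' ∧ SRBBisim T p' q' := by
  obtain ⟨q₁, q₂, h1, h2, _, h4⟩ := simulation.step p q h α p' hp'
  rw [hq.eq_of_tauPath h1] at h2
  exact ⟨q₂, h2.of_ne (by rintro rfl; exact hp _ hp'), h4⟩

theorem initials_eq {p q : P} (h : SRBBisim T p q) (hp : T.Stable p) (hq : T.Stable q) :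
    T.initials p = T.initials q := by
  ext α
  constructor
  · rintro ⟨h1, p', h2⟩
    exact ⟨h1, (h.step_of_stable hp hq h2).imp fun _ => And.left⟩
  · rintro ⟨h1, p', h2⟩
    exact ⟨h1, (h.symm.step_of_stable hq hp h2).imp fun _ => And.left⟩

end SRBBisim

/-- Every transition of `p` is matched by a transition of `q` up to stability-respecting
branching bisimilarity. -/
def SRBMatch (T : LTS A P) (p q : P) : Prop :=
  ∀ α p', T p α p' → ∃ q', T q α q' ∧ SRBBisim T p' q'

/-- The rooted conditions constrain the targets only through unrooted bisimilarity, never through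
the rooted relation itself, so nothing coinductive remains. -/
theorem rootedSRBBisim_iff {p q : P} :
    RootedSRBBisim T p q ↔ SRBMatch T p q ∧ SRBMatch T q p := by
  constructor
  · rintro ⟨R, hR, h⟩
    exact ⟨hR.step p q h, hR.step q p (hR.symm p q h)⟩
  · exact fun h => ⟨fun p q => SRBMatch T p q ∧ SRBMatch T q p,
      ⟨fun _ _ => And.symm, fun _ _ h => h.1⟩, h⟩

theorem SRBMatch.initials_le {p q : P} (h : SRBMatch T p q) : T.initials p ⊆ T.initials q := by
  rintro α ⟨h1, p', h2⟩
  exact ⟨h1, (h α p' h2).imp fun _ => And.left⟩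

namespace RootedSRBBisim

theorem symm {p q : P} (h : RootedSRBBisim T p q) : RootedSRBBisim T q p :=
  rootedSRBBisim_iff.2 (rootedSRBBisim_iff.1 h).symm

theorem step {p q : P} (h : RootedSRBBisim T p q) : SRBMatch T p q := (rootedSRBBisim_iff.1 h).1

theorem initials_eq {p q : P} (h : RootedSRBBisim T p q) : T.initials p = T.initials q :=
  h.step.initials_le.antisymm h.symm.step.initials_le

theorem equivalence : Equivalence (RootedSRBBisim T) where
  refl p := rootedSRBBisim_iff.2 ⟨fun _ p' h => ⟨p', h, .refl p'⟩, fun _ p' h => ⟨p', h, .refl p'⟩⟩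
  symm := symm
  trans := by
    have key : ∀ {p q r : P}, SRBMatch T p q → SRBMatch T q r → SRBMatch T p r := by
      intro p q r h h' α p' hp
      obtain ⟨q', h1, h2⟩ := h α p' hp
      obtain ⟨r', h3, h4⟩ := h' α q' h1
      exact ⟨r', h3, h2.trans h4⟩
    exact fun {_ _ _} h h' => rootedSRBBisim_iff.2 ⟨key h.step h'.step, key h'.symm.step h.symm.step⟩

end RootedSRBBisim

/-- A symmetric relation whose transitions are matched one by one, up to bisimilarity of the
targets, is included in rooted bisimilarity. -/
theorem rootedSRBBisim_of_upTo {C : P → P → Prop} (symm : ∀ p q, C p q → C q p)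
    (step : ∀ p q, C p q → ∀ α p', T p α p' → ∃ q', T q α q' ∧ Relation.Comp C (SRBBisim T) p' q')
    {p q : P} (h : C p q) : SRBBisim T p q ∧ RootedSRBBisim T p q := by
  have hstable : ∀ {p q}, C p q → T.Stable p → T.Stable q := fun hC hp q' hq' =>
    (step _ _ (symm _ _ hC) _ q' hq').elim fun p' h' => hp p' h'.1
  have hsim : IsSRBSimulation T (Relation.Comp C (SRBBisim T)) := by
    refine ⟨?_, ?_⟩
    · rintro p q ⟨m, hm, hmq⟩ α p' hp
      obtain ⟨m', h1, n, h2, h3⟩ := step _ _ hm α p' hp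
      obtain ⟨q₁, q₂, k1, k2, k3, k4⟩ := SRBBisim.simulation.step _ _ hmq α m' h1
      exact ⟨q₁, q₂, k1, k2, ⟨m, hm, k3⟩, ⟨n, h2, h3.trans k4⟩⟩
    · rintro p q ⟨m, hm, hmq⟩ hp
      exact SRBBisim.simulation.stable _ _ hmq (hstable hm hp)
  have hbis : ∀ {p q}, C p q → SRBBisim T p q := by
    intro p q h
    -- The composition of `C` with bisimilarity need not be symmetric. Composing with bisimilarity
    -- on the left as well restores symmetry, because `C` is symmetric.
    refine (SRBBisim.simulation.comp hsim).bisim ?_ ⟨p, .refl p, q, h, .refl q⟩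
    rintro p q ⟨m, hm, n, hn, hq⟩
    exact ⟨n, hq.symm, m, symm _ _ hn, hm.symm⟩
  have hmatch : ∀ {p q}, C p q → SRBMatch T p q := by
    intro p q h α p' hp
    obtain ⟨q', h1, n, h2, h3⟩ := step _ _ h α p' hp
    exact ⟨q', h1, (hbis h2).trans h3⟩
  exact ⟨hbis h, rootedSRBBisim_iff.2 ⟨hmatch h, hmatch (symm _ _ h)⟩⟩

theorem RootedSRBBisim.bisim {p q : P} (h : RootedSRBBisim T p q) : SRBBisim T p q := by
  have key : IsSRBSimulation T (fun p q => RootedSRBBisim T p q ∨ SRBBisim T p q) := by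
    refine ⟨?_, ?_⟩
    · rintro p q (h | h) α p' hp
      · obtain ⟨q', h1, h2⟩ := h.step α p' hp
        exact ⟨q, q', .refl, Or.inr h1, Or.inl h, Or.inr h2⟩
      · obtain ⟨q₁, q₂, h1, h2, h3, h4⟩ := SRBBisim.simulation.step p q h α p' hp
        exact ⟨q₁, q₂, h1, h2, Or.inr h3, Or.inr h4⟩
    · rintro p q (h | h) hp
      · exact ⟨q, .refl, by rwa [LTS.stable_iff, ← h.initials_eq, ← LTS.stable_iff]⟩
      · exact SRBBisim.simulation.stable p q h hp
  exact key.bisim (fun _ _ h => h.imp RootedSRBBisim.symm SRBBisim.symm) (Or.inl h)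

/-! ### Concrete branching reactive bisimilarity -/

/-- The conditions on a concrete branching reactive bisimulation other than symmetry. -/
structure IsCBRSimulation (T : LTS A P) (R : P → P → Prop) (RX : P → Set A → P → Prop) :
    Prop where
  step : ∀ p q, R p q → ∀ α p', α ≠ Act.timeout → T p α p' →
    ∃ q₁ q₂, T.TauPath q q₁ ∧ T.OptStep q₁ α q₂ ∧ R p q₁ ∧ R p' q₂
  settle : ∀ p q, R p q → ∀ Y, RX p Y q
  tauX : ∀ p X q, RX p X q → ∀ p', T p Act.tau p' →
    ∃ q₁ q₂, T.TauPath q q₁ ∧ T.OptStep q₁ Act.tau q₂ ∧ RX p X q₁ ∧ RX p' X q₂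
  visX : ∀ p X q, RX p X q → ∀ a ∈ X, ∀ p', T p (Act.vis a) p' →
    ∃ q₁ q₂, T.TauPath q q₁ ∧ T q₁ (Act.vis a) q₂ ∧ RX p X q₁ ∧ R p' q₂
  idleX : ∀ p X q, RX p X q → Idle (T.initials p) X → ∃ q₀, T.TauPath q q₀ ∧ R p q₀
  timeoutX : ∀ p X q, RX p X q → Idle (T.initials p) X → ∀ p', T p Act.timeout p' →
    ∃ q₁ q₂, T.TauPath q q₁ ∧ T q₁ Act.timeout q₂ ∧ RX p' X q₂
  stableX : ∀ p X q, RX p X q → T.Stable p → ∃ q₀, T.TauPath q q₀ ∧ T.Stable q₀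

namespace IsCBRSimulation

variable {R S : P → P → Prop} {RX SX : P → Set A → P → Prop}

theorem bisimulation (h : IsCBRSimulation T R RX) (hs : ∀ p q, R p q → R q p)
    (hX : ∀ p X q, RX p X q → RX q X p) : IsCBRBisimulation T R RX :=
  ⟨hs, hX, h.step, h.settle, h.tauX, h.visX, h.idleX, h.timeoutX, h.stableX⟩

theorem path (h : IsCBRSimulation T R RX) {p q p' : P} (hp : T.TauPath p p') (hR : R p q) :
    ∃ q', T.TauPath q q' ∧ R p' q' :=
  hp.transfer (fun p q hpq p' hp' => by
    obtain ⟨q₁, q₂, h1, h2, _, h4⟩ := h.step p q hpq _ p' Act.tau_ne_timeout hp'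
    exact ⟨q₂, h1.trans h2.tauPath, h4⟩) hR

theorem pathX (h : IsCBRSimulation T R RX) {p q p' : P} {X : Set A} (hp : T.TauPath p p')
    (hR : RX p X q) : ∃ q', T.TauPath q q' ∧ RX p' X q' :=
  hp.transfer (R := fun p q => RX p X q) (fun p q hpq p' hp' => by
    obtain ⟨q₁, q₂, h1, h2, _, h4⟩ := h.tauX p X q hpq p' hp'
    exact ⟨q₂, h1.trans h2.tauPath, h4⟩) hR

end IsCBRSimulation

theorem CBRBisim.symm {p q : P} : CBRBisim T p q → CBRBisim T q p :=
  fun ⟨R, RX, hR, h⟩ => ⟨R, RX, hR, hR.symm _ _ h⟩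

theorem CBRBisimX.symm {X : Set A} {p q : P} : CBRBisimX T X p q → CBRBisimX T X q p :=
  fun ⟨R, RX, hR, h⟩ => ⟨R, RX, hR, hR.symmX _ _ _ h⟩

theorem CBRBisim.simulation :
    IsCBRSimulation T (CBRBisim T) (fun p X q => CBRBisimX T X p q) where
  step := by
    rintro p q ⟨R, RX, hR, h⟩ α p' hα hp
    obtain ⟨q₁, q₂, h1, h2, h3, h4⟩ := hR.step p q h α p' hα hp
    exact ⟨q₁, q₂, h1, h2, ⟨R, RX, hR, h3⟩, ⟨R, RX, hR, h4⟩⟩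
  settle := fun p q ⟨R, RX, hR, h⟩ Y => ⟨R, RX, hR, hR.settle p q h Y⟩
  tauX := by
    rintro p X q ⟨R, RX, hR, h⟩ p' hp
    obtain ⟨q₁, q₂, h1, h2, h3, h4⟩ := hR.tauX p X q h p' hp
    exact ⟨q₁, q₂, h1, h2, ⟨R, RX, hR, h3⟩, ⟨R, RX, hR, h4⟩⟩
  visX := by
    rintro p X q ⟨R, RX, hR, h⟩ a ha p' hp
    obtain ⟨q₁, q₂, h1, h2, h3, h4⟩ := hR.visX p X q h a ha p' hp
    exact ⟨q₁, q₂, h1, h2, ⟨R, RX, hR, h3⟩, ⟨R, RX, hR, h4⟩⟩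
  idleX := by
    rintro p X q ⟨R, RX, hR, h⟩ hp
    obtain ⟨q₀, h1, h2⟩ := hR.idleX p X q h hp
    exact ⟨q₀, h1, ⟨R, RX, hR, h2⟩⟩
  timeoutX := by
    rintro p X q ⟨R, RX, hR, h⟩ hp p' hp'
    obtain ⟨q₁, q₂, h1, h2, h3⟩ := hR.timeoutX p X q h hp p' hp'
    exact ⟨q₁, q₂, h1, h2, ⟨R, RX, hR, h3⟩⟩
  stableX := fun p X q ⟨_, _, hR, h⟩ => hR.stableX p X q h

namespace IsCBRSimulation

variable {R S : P → P → Prop} {RX SX : P → Set A → P → Prop}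

theorem bisim (h : IsCBRSimulation T R RX) (hs : ∀ p q, R p q → R q p)
    (hX : ∀ p X q, RX p X q → RX q X p) {p q : P} (hpq : R p q) :
    CBRBisim T p q := ⟨R, RX, h.bisimulation hs hX, hpq⟩

theorem bisimX (h : IsCBRSimulation T R RX) (hs : ∀ p q, R p q → R q p)
    (hX : ∀ p X q, RX p X q → RX q X p) {p q : P} {X : Set A} (hpq : RX p X q) :
    CBRBisimX T X p q := ⟨R, RX, h.bisimulation hs hX, hpq⟩

end IsCBRSimulation

namespace CBRBisim

theorem settle {p q : P} (h : CBRBisim T p q) (X : Set A) : CBRBisimX T X p q :=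
  simulation.settle p q h X

/-- As for `SRBBisim.stay`: a stable `p` can answer the silent moves of `q` only by not moving. -/
theorem stay {p q q' : P} (h : CBRBisim T p q) (hp : T.Stable p) (hq : T.TauPath q q') :
    CBRBisim T p q' := by
  obtain ⟨p', h1, h2⟩ := simulation.path hq h.symm
  rw [hp.eq_of_tauPath h1] at h2
  exact h2.symm

theorem exists_stable {p q : P} (h : CBRBisim T p q) (hp : T.Stable p) :
    ∃ q₀, T.TauPath q q₀ ∧ CBRBisim T p q₀ ∧ T.Stable q₀ := by
  -- Pairs inherit the stability clause from triples; the environment plays no role in it, and `∅`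
  -- is an arbitrary choice.
  obtain ⟨q₀, h1, h2⟩ := simulation.stableX p ∅ q (h.settle ∅) hp
  exact ⟨q₀, h1, h.stay hp h1, h2⟩

theorem step_of_stable {p q p' : P} {α : Act A} (h : CBRBisim T p q) (hp : T.Stable p)
    (hq : T.Stable q) (hα : α ≠ Act.timeout) (hp' : T p α p') :
    ∃ q', T q α q' ∧ CBRBisim T p' q' := by
  obtain ⟨q₁, q₂, h1, h2, _, h4⟩ := simulation.step p q h α p' hα hp'
  rw [hq.eq_of_tauPath h1] at h2
  exact ⟨q₂, h2.of_ne (by rintro rfl; exact hp _ hp'), h4⟩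

theorem initials_eq {p q : P} (h : CBRBisim T p q) (hp : T.Stable p) (hq : T.Stable q) :
    T.initials p = T.initials q := by
  ext α
  constructor
  · rintro ⟨h1, p', h2⟩
    exact ⟨h1, (h.step_of_stable hp hq h1 h2).imp fun _ => And.left⟩
  · rintro ⟨h1, p', h2⟩
    exact ⟨h1, (h.symm.step_of_stable hq hp h1 h2).imp fun _ => And.left⟩

theorem timeout_of_stable {p q p' : P} {X : Set A} (h : CBRBisim T p q)
    (hp : Idle (T.initials p) X) (hq : T.Stable q) (hp' : T p Act.timeout p') :
    ∃ q', T q Act.timeout q' ∧ CBRBisimX T X p' q' := by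
  obtain ⟨q₁, q₂, h1, h2, h3⟩ := simulation.timeoutX p X q (h.settle X) hp p' hp'
  rw [hq.eq_of_tauPath h1] at h2
  exact ⟨q₂, h2, h3⟩

end CBRBisim

namespace CBRBisimX

/-- When `p` idles on `X`, the environment may change, so `X`-bisimilarity improves to full
bisimilarity after some τ-steps of `q`; further τ-steps then reach a stable state without losing it.
-/
theorem exists_idle {p q : P} {X : Set A} (h : CBRBisimX T X p q) (hp : Idle (T.initials p) X) :
    ∃ q₀, T.TauPath q q₀ ∧ CBRBisim T p q₀ ∧ T.Stable q₀ := by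
  obtain ⟨q₁, h1, h2⟩ := CBRBisim.simulation.idleX p X q h hp
  obtain ⟨q₀, h3, h4, h5⟩ := h2.exists_stable hp.stable
  exact ⟨q₀, h1.trans h3, h4, h5⟩

theorem stay {p q q' : P} {X : Set A} (h : CBRBisimX T X p q) (hp : T.Stable p)
    (hq : T.TauPath q q') : CBRBisimX T X p q' := by
  obtain ⟨p', h1, h2⟩ := CBRBisim.simulation.pathX hq h.symm
  rw [hp.eq_of_tauPath h1] at h2
  exact h2.symm

theorem exists_stable {p q : P} {X : Set A} (h : CBRBisimX T X p q) (hp : T.Stable p) :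
    ∃ q₀, T.TauPath q q₀ ∧ CBRBisimX T X p q₀ ∧ T.Stable q₀ := by
  obtain ⟨q₀, h1, h2⟩ := CBRBisim.simulation.stableX p X q h hp
  exact ⟨q₀, h1, h.stay hp h1, h2⟩

theorem vis_of_stable {p q p' : P} {X : Set A} {a : A} (h : CBRBisimX T X p q)
    (hq : T.Stable q) (ha : a ∈ X) (hp' : T p (Act.vis a) p') :
    ∃ q', T q (Act.vis a) q' ∧ CBRBisim T p' q' := by
  obtain ⟨q₁, q₂, h1, h2, _, h4⟩ := CBRBisim.simulation.visX p X q h a ha p' hp'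
  rw [hq.eq_of_tauPath h1] at h2
  exact ⟨q₂, h2, h4⟩

end CBRBisimX

/-- Unlike in `IsSRBSimulation.comp`, the left factor is bisimilarity itself: the clauses about
idling need the middle state to idle on `X` too, and this comes from `CBRBisim.initials_eq`, which
uses symmetry. The right factor may be any simulation, which the up-to principle exploits. -/
theorem IsCBRSimulation.bisim_comp {S : P → P → Prop} {SX : P → Set A → P → Prop}
    (hS : IsCBRSimulation T S SX) :
    IsCBRSimulation T (Relation.Comp (CBRBisim T) S)
      (fun p X => Relation.Comp (CBRBisimX T X) (fun q => SX q X) p) where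
  step := by
    rintro p r ⟨q, hpq, hqr⟩ α p' hα hp
    obtain ⟨q₁, q₂, h1, h2, h3, h4⟩ := CBRBisim.simulation.step p q hpq α p' hα hp
    obtain ⟨r₁, k1, k2⟩ := hS.path h1 hqr
    rcases h2 with ⟨rfl, rfl⟩ | h2
    · exact ⟨r₁, r₁, k1, Or.inl ⟨rfl, rfl⟩, ⟨q₁, h3, k2⟩, ⟨q₁, h4, k2⟩⟩
    · obtain ⟨r₂, r₃, k3, k4, k5, k6⟩ := hS.step _ _ k2 α _ hα h2
      exact ⟨r₂, r₃, k1.trans k3, k4, ⟨q₁, h3, k5⟩, ⟨q₂, h4, k6⟩⟩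
  settle := by
    rintro p r ⟨q, hpq, hqr⟩ Y
    exact ⟨q, hpq.settle Y, hS.settle q r hqr Y⟩
  tauX := by
    rintro p X r ⟨q, hpq, hqr⟩ p' hp
    obtain ⟨q₁, q₂, h1, h2, h3, h4⟩ := CBRBisim.simulation.tauX p X q hpq p' hp
    obtain ⟨r₁, k1, k2⟩ := hS.pathX h1 hqr
    rcases h2 with ⟨_, rfl⟩ | h2
    · exact ⟨r₁, r₁, k1, Or.inl ⟨rfl, rfl⟩, ⟨q₁, h3, k2⟩, ⟨q₁, h4, k2⟩⟩
    · obtain ⟨r₂, r₃, k3, k4, k5, k6⟩ := hS.tauX _ _ _ k2 _ h2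
      exact ⟨r₂, r₃, k1.trans k3, k4, ⟨q₁, h3, k5⟩, ⟨q₂, h4, k6⟩⟩
  visX := by
    rintro p X r ⟨q, hpq, hqr⟩ a ha p' hp
    obtain ⟨q₁, q₂, h1, h2, h3, h4⟩ := CBRBisim.simulation.visX p X q hpq a ha p' hp
    obtain ⟨r₁, k1, k2⟩ := hS.pathX h1 hqr
    obtain ⟨r₂, r₃, k3, k4, k5, k6⟩ := hS.visX _ _ _ k2 a ha _ h2
    exact ⟨r₂, r₃, k1.trans k3, k4, ⟨q₁, h3, k5⟩, ⟨q₂, h4, k6⟩⟩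
  idleX := by
    rintro p X r ⟨q, hpq, hqr⟩ hp
    obtain ⟨q₀, h1, h2, h3⟩ := hpq.exists_idle hp
    obtain ⟨r₁, k1, k2⟩ := hS.pathX h1 hqr
    obtain ⟨r₀, k3, k4⟩ := hS.idleX _ _ _ k2 (by rwa [← h2.initials_eq hp.stable h3])
    exact ⟨r₀, k1.trans k3, q₀, h2, k4⟩
  timeoutX := by
    rintro p X r ⟨q, hpq, hqr⟩ hp p' hp'
    obtain ⟨q₀, h1, h2, h3⟩ := hpq.exists_idle hp
    obtain ⟨q₁, h4, h5⟩ := h2.timeout_of_stable hp h3 hp'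
    obtain ⟨r₁, k1, k2⟩ := hS.pathX h1 hqr
    obtain ⟨r₂, r₃, k3, k4, k5⟩ :=
      hS.timeoutX _ _ _ k2 (by rwa [← h2.initials_eq hp.stable h3]) _ h4
    exact ⟨r₂, r₃, k1.trans k3, k4, q₁, h5, k5⟩
  stableX := by
    rintro p X r ⟨q, hpq, hqr⟩ hp
    obtain ⟨q₀, h1, h2⟩ := CBRBisim.simulation.stableX p X q hpq hp
    obtain ⟨r₁, k1, k2⟩ := hS.pathX h1 hqr
    obtain ⟨r₀, k3, k4⟩ := hS.stableX _ _ _ k2 h2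
    exact ⟨r₀, k1.trans k3, k4⟩

theorem CBRBisim.refl (p : P) : CBRBisim T p p := by
  refine IsCBRSimulation.bisim (R := Eq) (RX := fun p _ q => p = q)
    ⟨?_, ?_, ?_, ?_, ?_, ?_, ?_⟩ (fun _ _ => Eq.symm) (fun _ _ _ => Eq.symm) rfl
  · rintro p _ rfl α p' _ h
    exact ⟨p, p', .refl, Or.inr h, rfl, rfl⟩
  · exact fun _ _ h _ => h
  · rintro p _ _ rfl p' h
    exact ⟨p, p', .refl, Or.inr h, rfl, rfl⟩
  · rintro p _ _ rfl a _ p' h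
    exact ⟨p, p', .refl, h, rfl, rfl⟩
  · rintro p _ _ rfl _
    exact ⟨p, .refl, rfl⟩
  · rintro p _ _ rfl _ p' h
    exact ⟨p, p', .refl, h, rfl⟩
  · rintro p _ _ rfl h
    exact ⟨p, .refl, h⟩

theorem CBRBisim.trans {p q r : P} (h : CBRBisim T p q) (h' : CBRBisim T q r) :
    CBRBisim T p r :=
  CBRBisim.simulation.bisim_comp.bisim (fun _ _ ⟨m, h1, h2⟩ => ⟨m, h2.symm, h1.symm⟩)
    (fun _ _ _ ⟨m, h1, h2⟩ => ⟨m, h2.symm, h1.symm⟩) ⟨q, h, h'⟩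

theorem CBRBisimX.trans {X : Set A} {p q r : P} (h : CBRBisimX T X p q)
    (h' : CBRBisimX T X q r) : CBRBisimX T X p r :=
  CBRBisim.simulation.bisim_comp.bisimX (fun _ _ ⟨m, h1, h2⟩ => ⟨m, h2.symm, h1.symm⟩)
    (fun _ _ _ ⟨m, h1, h2⟩ => ⟨m, h2.symm, h1.symm⟩) ⟨q, h, h'⟩

/-- Every transition of `p` is matched by a transition of `q` up to concrete branching reactive
bisimilarity, in the environments that allow it. -/
structure CBRMatch (T : LTS A P) (p q : P) : Prop where
  step : ∀ α p', α ≠ Act.timeout → T p α p' → ∃ q', T q α q' ∧ CBRBisim T p' q'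
  timeout : ∀ X, Idle (T.initials p) X → ∀ p', T p Act.timeout p' →
    ∃ q', T q Act.timeout q' ∧ CBRBisimX T X p' q'

theorem CBRMatch.initials_le {p q : P} (h : CBRMatch T p q) : T.initials p ⊆ T.initials q := by
  rintro α ⟨h1, p', h2⟩
  exact ⟨h1, (h.step α p' h1 h2).imp fun _ => And.left⟩

theorem rootedCBRBisim_iff {p q : P} :
    RootedCBRBisim T p q ↔ CBRMatch T p q ∧ CBRMatch T q p := by
  constructor
  · rintro ⟨R, RX, hR, h⟩
    have key : ∀ {p q}, R p q → CBRMatch T p q := fun h =>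
      -- Time-outs of pairs are handled only through triples, so the pair is first settled in the
      -- environment `X`.
      ⟨hR.step _ _ h, fun X => hR.timeoutX _ X _ (hR.settle _ _ h X)⟩
    exact ⟨key h, key (hR.symm _ _ h)⟩
  -- The triples are the pairs in every environment; with this choice the clause on idling returns
  -- to pairs at no cost.
  · refine fun h => ⟨fun p q => CBRMatch T p q ∧ CBRMatch T q p,
      fun p _ q => CBRMatch T p q ∧ CBRMatch T q p, ?_, h⟩
    refine ⟨fun _ _ => And.symm, fun _ _ _ => And.symm, fun _ _ h => h.1.step, fun _ _ h _ => h,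
      ?_, ?_, fun _ _ _ h _ => h, fun p X q h => h.1.timeout X⟩
    · intro p X q h p' hp
      obtain ⟨q', h1, h2⟩ := h.1.step _ p' Act.tau_ne_timeout hp
      exact ⟨q', h1, h2.settle X⟩
    · exact fun p X q h a _ p' => h.1.step _ p' (Act.vis_ne_timeout _)

namespace RootedCBRBisim

theorem symm {p q : P} (h : RootedCBRBisim T p q) : RootedCBRBisim T q p :=
  rootedCBRBisim_iff.2 (rootedCBRBisim_iff.1 h).symm

theorem toMatch {p q : P} (h : RootedCBRBisim T p q) : CBRMatch T p q :=
  (rootedCBRBisim_iff.1 h).1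

theorem initials_eq {p q : P} (h : RootedCBRBisim T p q) : T.initials p = T.initials q :=
  h.toMatch.initials_le.antisymm h.symm.toMatch.initials_le

theorem equivalence : Equivalence (RootedCBRBisim T) where
  refl p := by
    have : CBRMatch T p p := ⟨fun _ p' _ h => ⟨p', h, .refl p'⟩,
      fun X _ p' h => ⟨p', h, (CBRBisim.refl p').settle X⟩⟩
    exact rootedCBRBisim_iff.2 ⟨this, this⟩
  symm := symm
  trans := by
    have key : ∀ {p q r : P}, RootedCBRBisim T p q → RootedCBRBisim T q r → CBRMatch T p r := by
      intro p q r h h'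
      refine ⟨fun α p' hα hp => ?_, fun X hX p' hp => ?_⟩
      · obtain ⟨q', h1, h2⟩ := h.toMatch.step α p' hα hp
        obtain ⟨r', h3, h4⟩ := h'.toMatch.step α q' hα h1
        exact ⟨r', h3, h2.trans h4⟩
      · obtain ⟨q', h1, h2⟩ := h.toMatch.timeout X hX p' hp
        obtain ⟨r', h3, h4⟩ := h'.toMatch.timeout X (by rwa [← h.initials_eq]) q' h1
        exact ⟨r', h3, h2.trans h4⟩
    exact fun {_ _ _} h h' => rootedCBRBisim_iff.2 ⟨key h h', key h'.symm h.symm⟩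

end RootedCBRBisim

/-- A symmetric relation whose transitions are matched one by one, up to bisimilarity of the
targets, is included in rooted bisimilarity. -/
theorem rootedCBRBisim_of_upTo {C : P → P → Prop} (symm : ∀ p q, C p q → C q p)
    (step : ∀ p q, C p q → ∀ α p', α ≠ Act.timeout → T p α p' →
      ∃ q', T q α q' ∧ Relation.Comp C (CBRBisim T) p' q')
    (timeout : ∀ p q, C p q → ∀ X, Idle (T.initials p) X → ∀ p', T p Act.timeout p' →
      ∃ q', T q Act.timeout q' ∧ Relation.Comp C (CBRBisimX T X) p' q')
    {p q : P} (h : C p q) : CBRBisim T p q ∧ RootedCBRBisim T p q := by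
  have hle : ∀ {p q}, C p q → T.initials p ⊆ T.initials q := by
    rintro p q hC α ⟨h1, p', h2⟩
    exact ⟨h1, (step p q hC α p' h1 h2).imp fun _ => And.left⟩
  have heq : ∀ {p q}, C p q → T.initials p = T.initials q := fun hC =>
    (hle hC).antisymm (hle (symm _ _ hC))
  have hsim : IsCBRSimulation T (Relation.Comp C (CBRBisim T))
      (fun p X => Relation.Comp C (CBRBisimX T X) p) := by
    refine ⟨?_, ?_, ?_, ?_, ?_, ?_, ?_⟩
    · rintro p q ⟨m, hm, hmq⟩ α p' hα hp
      obtain ⟨m', h1, n, h2, h3⟩ := step _ _ hm α p' hα hp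
      obtain ⟨q₁, q₂, k1, k2, k3, k4⟩ := CBRBisim.simulation.step _ _ hmq α m' hα h1
      exact ⟨q₁, q₂, k1, k2, ⟨m, hm, k3⟩, ⟨n, h2, h3.trans k4⟩⟩
    · rintro p q ⟨m, hm, hmq⟩ Y
      exact ⟨m, hm, hmq.settle Y⟩
    · rintro p X q ⟨m, hm, hmq⟩ p' hp
      obtain ⟨m', h1, n, h2, h3⟩ := step _ _ hm _ p' Act.tau_ne_timeout hp
      obtain ⟨q₁, q₂, k1, k2, k3, k4⟩ := CBRBisim.simulation.tauX _ _ _ hmq m' h1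
      exact ⟨q₁, q₂, k1, k2, ⟨m, hm, k3⟩, ⟨n, h2, (h3.settle X).trans k4⟩⟩
    · rintro p X q ⟨m, hm, hmq⟩ a ha p' hp
      obtain ⟨m', h1, n, h2, h3⟩ := step _ _ hm _ p' (Act.vis_ne_timeout _) hp
      obtain ⟨q₁, q₂, k1, k2, k3, k4⟩ := CBRBisim.simulation.visX _ _ _ hmq a ha m' h1
      exact ⟨q₁, q₂, k1, k2, ⟨m, hm, k3⟩, ⟨n, h2, h3.trans k4⟩⟩
    · rintro p X q ⟨m, hm, hmq⟩ hp
      obtain ⟨q₀, k1, k2⟩ := CBRBisim.simulation.idleX _ _ _ hmq (by rwa [← heq hm])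
      exact ⟨q₀, k1, m, hm, k2⟩
    · rintro p X q ⟨m, hm, hmq⟩ hp p' hp'
      obtain ⟨m', h1, n, h2, h3⟩ := timeout _ _ hm X hp p' hp'
      obtain ⟨q₁, q₂, k1, k2, k3⟩ :=
        CBRBisim.simulation.timeoutX _ _ _ hmq (by rwa [← heq hm]) m' h1
      exact ⟨q₁, q₂, k1, k2, n, h2, h3.trans k3⟩
    · rintro p X q ⟨m, hm, hmq⟩ hp
      exact CBRBisim.simulation.stableX _ _ _ hmq
        (by rwa [LTS.stable_iff, ← heq hm, ← LTS.stable_iff])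
  have hbis : ∀ {p q}, C p q → CBRBisim T p q := by
    intro p q h
    -- The relation is made symmetric by adding bisimilarity on the left.
    refine hsim.bisim_comp.bisim ?_ ?_ ⟨p, .refl p, q, h, .refl q⟩
    · rintro p q ⟨m, hm, n, hn, hq⟩
      exact ⟨n, hq.symm, m, symm _ _ hn, hm.symm⟩
    · rintro p X q ⟨m, hm, n, hn, hq⟩
      exact ⟨n, hq.symm, m, symm _ _ hn, hm.symm⟩
  have hmatch : ∀ {p q}, C p q → CBRMatch T p q := by
    refine fun h => ⟨fun α p' hα hp => ?_, fun X hX p' hp => ?_⟩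
    · obtain ⟨q', h1, n, h2, h3⟩ := step _ _ h α p' hα hp
      exact ⟨q', h1, (hbis h2).trans h3⟩
    · obtain ⟨q', h1, n, h2, h3⟩ := timeout _ _ h X hX p' hp
      exact ⟨q', h1, ((hbis h2).settle X).trans h3⟩
  exact ⟨hbis h, rootedCBRBisim_iff.2 ⟨hmatch h, hmatch (symm _ _ h)⟩⟩

end Simulations

section Operators

variable {A : Type u} {P : Type w} {T : LTS A P}

/-! ### Operators on labelled transition systems -/

/-- The relabellings of actions that underlie abstraction and renaming. -/
structure IsRelabelling (l : Act A → Act A → Prop) : Prop where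
  tau : ∀ α, l Act.tau α ↔ α = Act.tau
  timeout : ∀ α, l Act.timeout α ↔ α = Act.timeout
  of_timeout : ∀ β, l β Act.timeout → β = Act.timeout

/-- The operator `f` relabels the transitions of its argument according to `l`. -/
def IsRelabel (T : LTS A P) (l : Act A → Act A → Prop) (f : P → P) : Prop :=
  ∀ p α w, T (f p) α w ↔ ∃ β p', T p β p' ∧ l β α ∧ w = f p'

/-- The operator `f` is parallel composition with synchronisation on `S`. -/
def IsParallel (T : LTS A P) (S : Set A) (f : P → P → P) : Prop :=
  ∀ p q α w, T (f p q) α w ↔ (∃ p', T p α p' ∧ α ∉ Act.vis '' S ∧ w = f p' q) ∨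
    (∃ q', T q α q' ∧ α ∉ Act.vis '' S ∧ w = f p q') ∨
    ∃ a ∈ S, ∃ p' q', α = Act.vis a ∧ T p α p' ∧ T q α q' ∧ w = f p' q'

/-- The operator `f` places its argument in environments that allow a set of actions between
`L` and `U`. -/
def IsTheta (T : LTS A P) (L U : Set A) (f : P → P) : Prop :=
  ∀ p α w, T (f p) α w ↔ (∃ p', α = Act.tau ∧ T p α p' ∧ w = f p') ∨
    (α ∈ Act.vis '' U ∧ T p α w) ∨ T p α w ∧ Idle (T.initials p) L

/-- The operator `g` lets its argument time out only in the environment `X`, after which `f` is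
applied. -/
def IsPsi (T : LTS A P) (X : Set A) (f g : P → P) : Prop :=
  ∀ p α w, T (g p) α w ↔ (α ≠ Act.timeout ∧ T p α w) ∨
    ∃ p', α = Act.timeout ∧ Idle (T.initials p) X ∧ T p α p' ∧ w = f p'

/-- The operator `f` is the choice between its arguments. -/
def IsSum (T : LTS A P) (f : P → P → P) : Prop :=
  ∀ p q α w, T (f p q) α w ↔ T p α w ∨ T q α w

/-- The operator `f` is prefixing with `α`. -/
def IsPrefix (T : LTS A P) (α : Act A) (f : P → P) : Prop :=
  ∀ p β w, T (f p) β w ↔ β = α ∧ w = p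

namespace IsRelabel

variable {l : Act A → Act A → Prop} {f : P → P}

theorem step (hf : IsRelabel T l f) {α β : Act A} (h : l β α) (p p' : P) (hp : T p β p') :
    T (f p) α (f p') := (hf _ _ _).2 ⟨β, p', hp, h, rfl⟩

theorem path (hf : IsRelabel T l f) (hl : IsRelabelling l) {p p' : P} (h : T.TauPath p p') :
    T.TauPath (f p) (f p') := h.map (hf.step ((hl.tau _).2 rfl))

theorem optStep (hf : IsRelabel T l f) (hl : IsRelabelling l) {α β : Act A} (h : l β α)
    {p p' : P} (hp : T.OptStep p β p') : T.OptStep (f p) α (f p') :=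
  hp.map (by rintro rfl; exact (hl.tau _).1 h) (hf.step h)

theorem stable (hf : IsRelabel T l f) (hl : IsRelabelling l) {p : P} (h : T.Stable (f p)) :
    T.Stable p := fun _ hp => h _ (hf.step ((hl.tau _).2 rfl) _ _ hp)

end IsRelabel

namespace IsParallel

variable {S : Set A} {f : P → P → P}

/-- This symmetry reduces statements about the right component to statements about the left one. -/
theorem swap (hf : IsParallel T S f) : IsParallel T S (fun p q => f q p) := by
  intro p q α w
  rw [hf]
  constructor
  · rintro (h | h | ⟨a, ha, p', q', h1, h2, h3, h4⟩)
    · exact Or.inr (Or.inl h)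
    · exact Or.inl h
    · exact Or.inr (Or.inr ⟨a, ha, q', p', h1, h3, h2, h4⟩)
  · rintro (h | h | ⟨a, ha, p', q', h1, h2, h3, h4⟩)
    · exact Or.inr (Or.inl h)
    · exact Or.inl h
    · exact Or.inr (Or.inr ⟨a, ha, q', p', h1, h3, h2, h4⟩)

theorem left (hf : IsParallel T S f) {α : Act A} (hα : α ∉ Act.vis '' S) (q p p' : P)
    (h : T p α p') : T (f p q) α (f p' q) := (hf _ _ _ _).2 (Or.inl ⟨p', h, hα, rfl⟩)

theorem right (hf : IsParallel T S f) {α : Act A} (hα : α ∉ Act.vis '' S) (p q q' : P)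
    (h : T q α q') : T (f p q) α (f p q') := (hf _ _ _ _).2 (Or.inr (Or.inl ⟨q', h, hα, rfl⟩))

theorem sync (hf : IsParallel T S f) {a : A} (ha : a ∈ S) {p q p' q' : P}
    (hp : T p (Act.vis a) p') (hq : T q (Act.vis a) q') : T (f p q) (Act.vis a) (f p' q') :=
  (hf _ _ _ _).2 (Or.inr (Or.inr ⟨a, ha, p', q', rfl, hp, hq, rfl⟩))

theorem tau_notMem : (Act.tau : Act A) ∉ Act.vis '' S := by rintro ⟨_, _, h⟩; cases h

theorem timeout_notMem : (Act.timeout : Act A) ∉ Act.vis '' S := by rintro ⟨_, _, h⟩; cases h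

theorem vis_notMem {a : A} (ha : a ∉ S) : Act.vis a ∉ Act.vis '' S := by
  rintro ⟨_, h, h'⟩; cases h'; exact ha h

theorem path_left (hf : IsParallel T S f) {p p' : P} (h : T.TauPath p p') (q : P) :
    T.TauPath (f p q) (f p' q) := h.map (f := fun p => f p q) (hf.left tau_notMem q)

theorem path (hf : IsParallel T S f) {p p' q q' : P} (h : T.TauPath p p') (h' : T.TauPath q q') :
    T.TauPath (f p q) (f p' q') := (hf.path_left h q).trans (hf.swap.path_left h' p')

theorem optStep_left (hf : IsParallel T S f) {α : Act A} (hα : α ∉ Act.vis '' S) (q : P)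
    {p p' : P} (h : T.OptStep p α p') : T.OptStep (f p q) α (f p' q) :=
  h.map (f := fun p => f p q) id (hf.left hα q)

theorem stable_iff (hf : IsParallel T S f) {p q : P} :
    T.Stable (f p q) ↔ T.Stable p ∧ T.Stable q := by
  constructor
  · exact fun h => ⟨fun _ hp => h _ (hf.left tau_notMem q _ _ hp),
      fun _ hp => h _ (hf.right tau_notMem p _ _ hp)⟩
  · rintro ⟨h1, h2⟩ w hw
    rcases (hf _ _ _ _).1 hw with ⟨_, h, _⟩ | ⟨_, h, _⟩ | ⟨_, _, _, _, h, _⟩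
    · exact h1 _ h
    · exact h2 _ h
    · cases h

end IsParallel

namespace IsTheta

variable {L U : Set A} {f : P → P}

theorem tau (hf : IsTheta T L U f) (p p' : P) (h : T p Act.tau p') : T (f p) Act.tau (f p') :=
  (hf _ _ _).2 (Or.inl ⟨p', rfl, h, rfl⟩)

theorem vis (hf : IsTheta T L U f) {a : A} (ha : a ∈ U) {p p' : P} (h : T p (Act.vis a) p') :
    T (f p) (Act.vis a) p' := (hf _ _ _).2 (Or.inr (Or.inl ⟨⟨a, ha, rfl⟩, h⟩))

theorem idle (hf : IsTheta T L U f) {α : Act A} {p p' : P} (h : T p α p')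
    (hp : Idle (T.initials p) L) : T (f p) α p' := (hf _ _ _).2 (Or.inr (Or.inr ⟨h, hp⟩))

theorem path (hf : IsTheta T L U f) {p p' : P} (h : T.TauPath p p') :
    T.TauPath (f p) (f p') := h.map hf.tau

theorem stable_iff (hf : IsTheta T L U f) {p : P} : T.Stable (f p) ↔ T.Stable p := by
  constructor
  · exact fun h _ hp => h _ (hf.tau _ _ hp)
  · intro h w hw
    rcases (hf _ _ _).1 hw with ⟨_, _, h', _⟩ | ⟨⟨_, _, h'⟩, _⟩ | ⟨h', _⟩
    · exact h _ h'
    · cases h'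
    · exact h _ h'

end IsTheta

/-! ### Stability-respecting branching bisimilarity is a congruence -/

namespace SRBBisim

theorem relabel {l : Act A → Act A → Prop} {f : P → P} (hf : IsRelabel T l f)
    (hl : IsRelabelling l) {p q : P} (h : SRBBisim T p q) : SRBBisim T (f p) (f q) := by
  refine IsSRBSimulation.bisim (R := fun v w => ∃ p q, v = f p ∧ w = f q ∧ SRBBisim T p q)
    ⟨?_, ?_⟩ ?_ ⟨p, q, rfl, rfl, h⟩
  · rintro _ _ ⟨p, q, rfl, rfl, h⟩ α w hw
    obtain ⟨β, p', h1, h2, rfl⟩ := (hf _ _ _).1 hw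
    obtain ⟨q₁, q₂, k1, k2, k3, k4⟩ := simulation.step p q h β p' h1
    exact ⟨f q₁, f q₂, hf.path hl k1, hf.optStep hl h2 k2, ⟨p, q₁, rfl, rfl, k3⟩,
      ⟨p', q₂, rfl, rfl, k4⟩⟩
  · rintro _ _ ⟨p, q, rfl, rfl, h⟩ hs
    have hp := hf.stable hl hs
    obtain ⟨q₀, k1, k2, k3⟩ := h.exists_stable hp
    refine ⟨f q₀, hf.path hl k1, fun w hw => ?_⟩
    -- A τ-step of `f q₀` may come from a visible action `β` of `q₀`. Since `p` and `q₀` are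
    -- bisimilar and both stable, `p` has a `β`-step too, and then `f p` would not be stable.
    obtain ⟨β, q', h1, h2, rfl⟩ := (hf _ _ _).1 hw
    obtain ⟨p', h3, _⟩ := k2.symm.step_of_stable k3 hp h1
    exact hs _ (hf.step h2 _ _ h3)
  · rintro _ _ ⟨p, q, rfl, rfl, h⟩
    exact ⟨q, p, rfl, rfl, h.symm⟩

theorem par {S : Set A} {f : P → P → P} (hf : IsParallel T S f) {p₁ p₂ q₁ q₂ : P}
    (h₁ : SRBBisim T p₁ q₁) (h₂ : SRBBisim T p₂ q₂) : SRBBisim T (f p₁ p₂) (f q₁ q₂) := by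
  refine IsSRBSimulation.bisim (R := fun v w => ∃ p₁ p₂ q₁ q₂, v = f p₁ p₂ ∧ w = f q₁ q₂ ∧
    SRBBisim T p₁ q₁ ∧ SRBBisim T p₂ q₂) ⟨?_, ?_⟩ ?_ ⟨_, _, _, _, rfl, rfl, h₁, h₂⟩
  · rintro _ _ ⟨p₁, p₂, q₁, q₂, rfl, rfl, h₁, h₂⟩ α w hw
    rcases (hf _ _ _ _).1 hw with ⟨p', h1, hα, rfl⟩ | ⟨p', h1, hα, rfl⟩ |
      ⟨a, ha, p₁', p₂', rfl, h1, h2, rfl⟩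
    · obtain ⟨r, r', k1, k2, k3, k4⟩ := simulation.step _ _ h₁ α p' h1
      exact ⟨f r q₂, f r' q₂, hf.path_left k1 _, hf.optStep_left hα _ k2,
        ⟨_, _, _, _, rfl, rfl, k3, h₂⟩, ⟨_, _, _, _, rfl, rfl, k4, h₂⟩⟩
    · obtain ⟨r, r', k1, k2, k3, k4⟩ := simulation.step _ _ h₂ α p' h1
      exact ⟨f q₁ r, f q₁ r', hf.swap.path_left k1 _, hf.swap.optStep_left hα _ k2,
        ⟨_, _, _, _, rfl, rfl, h₁, k3⟩, ⟨_, _, _, _, rfl, rfl, h₁, k4⟩⟩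
    · obtain ⟨r, r', k1, k2, k3, k4⟩ := simulation.step _ _ h₁ _ _ h1
      obtain ⟨s, s', m1, m2, m3, m4⟩ := simulation.step _ _ h₂ _ _ h2
      exact ⟨f r s, f r' s', hf.path k1 m1,
        Or.inr (hf.sync ha (k2.of_ne (Act.vis_ne_tau _)) (m2.of_ne (Act.vis_ne_tau _))),
        ⟨_, _, _, _, rfl, rfl, k3, m3⟩, ⟨_, _, _, _, rfl, rfl, k4, m4⟩⟩
  · rintro _ _ ⟨p₁, p₂, q₁, q₂, rfl, rfl, h₁, h₂⟩ hs
    rw [hf.stable_iff] at hs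
    obtain ⟨r, k1, k2⟩ := simulation.stable _ _ h₁ hs.1
    obtain ⟨s, m1, m2⟩ := simulation.stable _ _ h₂ hs.2
    exact ⟨f r s, hf.path k1 m1, hf.stable_iff.2 ⟨k2, m2⟩⟩
  · rintro _ _ ⟨p₁, p₂, q₁, q₂, rfl, rfl, h₁, h₂⟩
    exact ⟨_, _, _, _, rfl, rfl, h₁.symm, h₂.symm⟩

/-- Only the rule for τ keeps the operator; the other rules drop it, so bisimilarity itself is
joined to the relation. -/
theorem theta {L U : Set A} {f : P → P} (hf : IsTheta T L U f) {p q : P}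
    (h : SRBBisim T p q) : SRBBisim T (f p) (f q) := by
  refine IsSRBSimulation.bisim (R := fun v w => (∃ p q, v = f p ∧ w = f q ∧ SRBBisim T p q) ∨
    SRBBisim T v w) ⟨?_, ?_⟩ ?_ (Or.inl ⟨p, q, rfl, rfl, h⟩)
  · rintro _ _ (⟨p, q, rfl, rfl, h⟩ | h) α w hw
    · rcases (hf _ _ _).1 hw with ⟨p', rfl, h1, rfl⟩ | ⟨⟨a, ha, rfl⟩, h1⟩ | ⟨h1, hi⟩
      · obtain ⟨q₁, q₂, k1, k2, k3, k4⟩ := simulation.step p q h _ p' h1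
        exact ⟨f q₁, f q₂, hf.path k1, k2.map id hf.tau, Or.inl ⟨_, _, rfl, rfl, k3⟩,
          Or.inl ⟨_, _, rfl, rfl, k4⟩⟩
      · obtain ⟨q₁, q₂, k1, k2, k3, k4⟩ := simulation.step p q h _ w h1
        exact ⟨f q₁, q₂, hf.path k1, Or.inr (hf.vis ha (k2.of_ne (Act.vis_ne_tau _))),
          Or.inl ⟨_, _, rfl, rfl, k3⟩, Or.inr k4⟩
      -- Idling includes stability, so `q` can first move to a stable bisimilar `q₀`. It has the
      -- same initial actions as `p` and hence satisfies the same negative premise.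
      · obtain ⟨q₀, k1, k2, k3⟩ := h.exists_stable hi.stable
        obtain ⟨q', k4, k5⟩ := k2.step_of_stable hi.stable k3 h1
        exact ⟨f q₀, q', hf.path k1,
          Or.inr (hf.idle k4 (by rwa [← k2.initials_eq hi.stable k3])),
          Or.inl ⟨_, _, rfl, rfl, k2⟩, Or.inr k5⟩
    · obtain ⟨q₁, q₂, k1, k2, k3, k4⟩ := simulation.step _ _ h α w hw
      exact ⟨q₁, q₂, k1, k2, Or.inr k3, Or.inr k4⟩
  · rintro _ _ (⟨p, q, rfl, rfl, h⟩ | h) hs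
    · obtain ⟨q₀, k1, k2⟩ := simulation.stable _ _ h (hf.stable_iff.1 hs)
      exact ⟨f q₀, hf.path k1, hf.stable_iff.2 k2⟩
    · exact simulation.stable _ _ h hs
  · rintro _ _ (⟨p, q, rfl, rfl, h⟩ | h)
    · exact Or.inl ⟨q, p, rfl, rfl, h.symm⟩
    · exact Or.inr h.symm

end SRBBisim

/-! ### Rooted stability-respecting branching bisimilarity and the operators. -/

namespace RootedSRBBisim

theorem relabel {l : Act A → Act A → Prop} {f : P → P} (hf : IsRelabel T l f)
    (hl : IsRelabelling l) {p q : P} (h : RootedSRBBisim T p q) :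
    RootedSRBBisim T (f p) (f q) := by
  have key : ∀ {p q}, RootedSRBBisim T p q → SRBMatch T (f p) (f q) := by
    intro p q h α w hw
    obtain ⟨β, p', h1, h2, rfl⟩ := (hf _ _ _).1 hw
    obtain ⟨q', k1, k2⟩ := h.step β p' h1
    exact ⟨f q', hf.step h2 _ _ k1, k2.relabel hf hl⟩
  exact rootedSRBBisim_iff.2 ⟨key h, key h.symm⟩

theorem par {S : Set A} {f : P → P → P} (hf : IsParallel T S f) {p₁ p₂ q₁ q₂ : P}
    (h₁ : RootedSRBBisim T p₁ q₁) (h₂ : RootedSRBBisim T p₂ q₂) :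
    RootedSRBBisim T (f p₁ p₂) (f q₁ q₂) := by
  have key : ∀ {p₁ p₂ q₁ q₂}, RootedSRBBisim T p₁ q₁ → RootedSRBBisim T p₂ q₂ →
      SRBMatch T (f p₁ p₂) (f q₁ q₂) := by
    intro p₁ p₂ q₁ q₂ h₁ h₂ α w hw
    rcases (hf _ _ _ _).1 hw with ⟨p', h1, hα, rfl⟩ | ⟨p', h1, hα, rfl⟩ |
      ⟨a, ha, p₁', p₂', rfl, h1, h2, rfl⟩
    · obtain ⟨q', k1, k2⟩ := h₁.step _ _ h1
      exact ⟨f q' q₂, hf.left hα _ _ _ k1, k2.par hf h₂.bisim⟩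
    · obtain ⟨q', k1, k2⟩ := h₂.step _ _ h1
      exact ⟨f q₁ q', hf.right hα _ _ _ k1, h₁.bisim.par hf k2⟩
    · obtain ⟨q', k1, k2⟩ := h₁.step _ _ h1
      obtain ⟨q'', k3, k4⟩ := h₂.step _ _ h2
      exact ⟨f q' q'', hf.sync ha k1 k3, k2.par hf k4⟩
  exact rootedSRBBisim_iff.2 ⟨key h₁ h₂, key h₁.symm h₂.symm⟩

theorem theta {L U : Set A} {f : P → P} (hf : IsTheta T L U f) {p q : P}
    (h : RootedSRBBisim T p q) : RootedSRBBisim T (f p) (f q) := by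
  have key : ∀ {p q}, RootedSRBBisim T p q → SRBMatch T (f p) (f q) := by
    intro p q h α w hw
    rcases (hf _ _ _).1 hw with ⟨p', rfl, h1, rfl⟩ | ⟨⟨a, ha, rfl⟩, h1⟩ | ⟨h1, hi⟩
    · obtain ⟨q', k1, k2⟩ := h.step _ p' h1
      exact ⟨f q', hf.tau _ _ k1, k2.theta hf⟩
    · obtain ⟨q', k1, k2⟩ := h.step _ w h1
      exact ⟨q', hf.vis ha k1, k2⟩
    · obtain ⟨q', k1, k2⟩ := h.step _ w h1
      exact ⟨q', hf.idle k1 (by rwa [← h.initials_eq]), k2⟩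
  exact rootedSRBBisim_iff.2 ⟨key h, key h.symm⟩

theorem psi {X : Set A} {f g : P → P} (hf : IsTheta T X X f) (hg : IsPsi T X f g) {p q : P}
    (h : RootedSRBBisim T p q) : RootedSRBBisim T (g p) (g q) := by
  have key : ∀ {p q}, RootedSRBBisim T p q → SRBMatch T (g p) (g q) := by
    intro p q h α w hw
    rcases (hg _ _ _).1 hw with ⟨hα, h1⟩ | ⟨p', rfl, hi, h1, rfl⟩
    · obtain ⟨q', k1, k2⟩ := h.step _ w h1
      exact ⟨q', (hg _ _ _).2 (Or.inl ⟨hα, k1⟩), k2⟩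
    · obtain ⟨q', k1, k2⟩ := h.step _ p' h1
      exact ⟨f q', (hg _ _ _).2 (Or.inr ⟨q', rfl, by rwa [← h.initials_eq], k1, rfl⟩),
        k2.theta hf⟩
  exact rootedSRBBisim_iff.2 ⟨key h, key h.symm⟩

theorem sum {f : P → P → P} (hf : IsSum T f) {p₁ p₂ q₁ q₂ : P}
    (h₁ : RootedSRBBisim T p₁ q₁) (h₂ : RootedSRBBisim T p₂ q₂) :
    RootedSRBBisim T (f p₁ p₂) (f q₁ q₂) := by
  have key : ∀ {p₁ p₂ q₁ q₂}, RootedSRBBisim T p₁ q₁ → RootedSRBBisim T p₂ q₂ →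
      SRBMatch T (f p₁ p₂) (f q₁ q₂) := by
    intro p₁ p₂ q₁ q₂ h₁ h₂ α w hw
    rcases (hf _ _ _ _).1 hw with h | h
    · obtain ⟨q', k1, k2⟩ := h₁.step _ _ h
      exact ⟨q', (hf _ _ _ _).2 (Or.inl k1), k2⟩
    · obtain ⟨q', k1, k2⟩ := h₂.step _ _ h
      exact ⟨q', (hf _ _ _ _).2 (Or.inr k1), k2⟩
  exact rootedSRBBisim_iff.2 ⟨key h₁ h₂, key h₁.symm h₂.symm⟩

theorem prefixing {α : Act A} {f : P → P} (hf : IsPrefix T α f) {p q : P}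
    (h : RootedSRBBisim T p q) : RootedSRBBisim T (f p) (f q) := by
  have key : ∀ {p q}, RootedSRBBisim T p q → SRBMatch T (f p) (f q) := by
    intro p q h β w hw
    obtain ⟨rfl, rfl⟩ := (hf _ _ _).1 hw
    exact ⟨q, (hf _ _ _).2 ⟨rfl, rfl⟩, h.bisim⟩
  exact rootedSRBBisim_iff.2 ⟨key h, key h.symm⟩

end RootedSRBBisim

end Operators

section Reactive

variable {A : Type u} {P : Type w} {T : LTS A P}

/-! ### Concrete branching reactive bisimilarity is a congruence -/

/-- The environment of `p` when `f p`, for `f` relabelling by `l`, is in the environment `X`. -/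
def relabelEnv (l : Act A → Act A → Prop) (X : Set A) : Set A :=
  {a | ∃ α, l (Act.vis a) α ∧ (α = Act.tau ∨ α ∈ Act.vis '' X)}

theorem IsRelabel.idle {l : Act A → Act A → Prop} {f : P → P} (hf : IsRelabel T l f)
    (hl : IsRelabelling l) {p : P} {X : Set A} (h : Idle (T.initials (f p)) X) :
    Idle (T.initials p) (relabelEnv l X) := by
  refine (hf.stable hl h.stable).idle ?_
  rintro a ⟨_, h1, rfl | ⟨b, hb, rfl⟩⟩ q hq
  · exact h.stable _ (hf.step h1 _ _ hq)
  · exact h.not_vis hb (hf.step h1 _ _ hq)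

theorem IsRelabel.timeout_inv {l : Act A → Act A → Prop} {f : P → P} (hf : IsRelabel T l f)
    (hl : IsRelabelling l) {p w : P} (h : T (f p) Act.timeout w) :
    ∃ p', T p Act.timeout p' ∧ w = f p' := by
  obtain ⟨β, p', h1, h2, h3⟩ := (hf _ _ _).1 h
  obtain rfl := hl.of_timeout _ h2
  exact ⟨p', h1, h3⟩

theorem IsRelabelling.ne_timeout {l : Act A → Act A → Prop} (hl : IsRelabelling l)
    {α β : Act A} (h : l β α) (hα : α ≠ Act.timeout) : β ≠ Act.timeout := by
  rintro rfl
  exact hα ((hl.timeout _).1 h)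

/-- In `relabelEnv l X` the component is allowed every action that becomes an action of `X`, and
also every action that becomes τ, since the environment cannot block the latter. -/
theorem IsRelabel.bisimulation {l : Act A → Act A → Prop} {f : P → P} (hf : IsRelabel T l f)
    (hl : IsRelabelling l) :
    IsCBRBisimulation T (fun v w => ∃ p q, v = f p ∧ w = f q ∧ CBRBisim T p q)
      (fun v X w => ∃ p q, v = f p ∧ w = f q ∧ CBRBisimX T (relabelEnv l X) p q) := by
  refine IsCBRSimulation.bisimulation ⟨?_, ?_, ?_, ?_, ?_, ?_, ?_⟩ ?_ ?_
  · rintro _ _ ⟨p, q, rfl, rfl, h⟩ α w hα hw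
    obtain ⟨β, p', h1, h2, rfl⟩ := (hf _ _ _).1 hw
    obtain ⟨q₁, q₂, k1, k2, k3, k4⟩ :=
      CBRBisim.simulation.step p q h β p' (hl.ne_timeout h2 hα) h1
    exact ⟨f q₁, f q₂, hf.path hl k1, hf.optStep hl h2 k2, ⟨p, q₁, rfl, rfl, k3⟩,
      ⟨p', q₂, rfl, rfl, k4⟩⟩
  · rintro _ _ ⟨p, q, rfl, rfl, h⟩ Y
    exact ⟨p, q, rfl, rfl, h.settle _⟩
  · rintro _ X _ ⟨p, q, rfl, rfl, h⟩ w hw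
    obtain ⟨β, p', h1, h2, rfl⟩ := (hf _ _ _).1 hw
    cases β with
    | vis a =>
      obtain ⟨q₁, q₂, k1, k2, k3, k4⟩ :=
        CBRBisim.simulation.visX _ _ _ h a ⟨_, h2, Or.inl rfl⟩ _ h1
      -- A visible action of the component leads to a pair, although the composite only performs τ
      -- and stays in `X`; the pair is settled in the translated environment.
      exact ⟨f q₁, f q₂, hf.path hl k1, Or.inr (hf.step h2 _ _ k2), ⟨p, q₁, rfl, rfl, k3⟩,
        ⟨p', q₂, rfl, rfl, k4.settle _⟩⟩
    | tau =>
      obtain ⟨q₁, q₂, k1, k2, k3, k4⟩ := CBRBisim.simulation.tauX _ _ _ h _ h1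
      exact ⟨f q₁, f q₂, hf.path hl k1, hf.optStep hl h2 k2, ⟨p, q₁, rfl, rfl, k3⟩,
        ⟨p', q₂, rfl, rfl, k4⟩⟩
    | timeout => exact (hl.ne_timeout h2 Act.tau_ne_timeout rfl).elim
  · rintro _ X _ ⟨p, q, rfl, rfl, h⟩ b hb w hw
    obtain ⟨β, p', h1, h2, rfl⟩ := (hf _ _ _).1 hw
    cases β with
    | vis a =>
      obtain ⟨q₁, q₂, k1, k2, k3, k4⟩ :=
        CBRBisim.simulation.visX _ _ _ h a ⟨_, h2, Or.inr ⟨b, hb, rfl⟩⟩ _ h1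
      exact ⟨f q₁, f q₂, hf.path hl k1, hf.step h2 _ _ k2, ⟨p, q₁, rfl, rfl, k3⟩,
        ⟨p', q₂, rfl, rfl, k4⟩⟩
    | tau => exact (Act.vis_ne_tau b ((hl.tau _).1 h2)).elim
    | timeout => exact (hl.ne_timeout h2 (Act.vis_ne_timeout _) rfl).elim
  · rintro _ X _ ⟨p, q, rfl, rfl, h⟩ hi
    obtain ⟨q₀, k1, k2, _⟩ := h.exists_idle (hf.idle hl hi)
    exact ⟨f q₀, hf.path hl k1, p, q₀, rfl, rfl, k2⟩
  · rintro _ X _ ⟨p, q, rfl, rfl, h⟩ hi w hw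
    obtain ⟨p', h1, rfl⟩ := hf.timeout_inv hl hw
    obtain ⟨q₀, k1, k2, k3⟩ := h.exists_idle (hf.idle hl hi)
    obtain ⟨q', k4, k5⟩ := k2.timeout_of_stable (hf.idle hl hi) k3 h1
    exact ⟨f q₀, f q', hf.path hl k1, hf.step ((hl.timeout _).2 rfl) _ _ k4,
      p', q', rfl, rfl, k5⟩
  · rintro _ X _ ⟨p, q, rfl, rfl, h⟩ hs
    have hp := hf.stable hl hs
    obtain ⟨q₀, k1, k2, k3⟩ := h.exists_stable hp
    refine ⟨f q₀, hf.path hl k1, fun w hw => ?_⟩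
    obtain ⟨β, q', h1, h2, rfl⟩ := (hf _ _ _).1 hw
    cases β with
    | vis a =>
      -- An action that becomes τ belongs to `relabelEnv l X`, so `p` would share it with `q₀`,
      -- contradicting the stability of `f p`.
      obtain ⟨p', h3, _⟩ := k2.symm.vis_of_stable hp ⟨_, h2, Or.inl rfl⟩ h1
      exact hs _ (hf.step h2 _ _ h3)
    | tau => exact k3 _ h1
    | timeout => exact (hl.ne_timeout h2 Act.tau_ne_timeout rfl).elim
  · rintro _ _ ⟨p, q, rfl, rfl, h⟩
    exact ⟨q, p, rfl, rfl, h.symm⟩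
  · rintro _ _ _ ⟨p, q, rfl, rfl, h⟩
    exact ⟨q, p, rfl, rfl, h.symm⟩

theorem CBRBisim.relabel {l : Act A → Act A → Prop} {f : P → P} (hf : IsRelabel T l f)
    (hl : IsRelabelling l) {p q : P} (h : CBRBisim T p q) : CBRBisim T (f p) (f q) :=
  ⟨_, _, hf.bisimulation hl, p, q, rfl, rfl, h⟩

theorem CBRBisimX.relabel {l : Act A → Act A → Prop} {f : P → P} (hf : IsRelabel T l f)
    (hl : IsRelabelling l) {p q : P} {X : Set A} (h : CBRBisimX T (relabelEnv l X) p q) :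
    CBRBisimX T X (f p) (f q) :=
  ⟨_, _, hf.bisimulation hl, p, q, rfl, rfl, h⟩

/-! ### Parallel composition and reactive bisimilarity. -/

/-- The environment of the component `p` of `f p q`, for `f` parallel composition with
synchronisation on `S`, when `f p q` is in the environment `X` and `I` is the set of initial
actions of `q`. -/
def parEnv (S X : Set A) (I : Set (Act A)) : Set A := {a | a ∈ X ∧ (a ∈ S → Act.vis a ∈ I)}

/-- Parallel compositions with pairwise bisimilar components. -/
def ParRel (T : LTS A P) (f : P → P → P) (v w : P) : Prop :=
  ∃ p₁ p₂ q₁ q₂, v = f p₁ p₂ ∧ w = f q₁ q₂ ∧ CBRBisim T p₁ q₁ ∧ CBRBisim T p₂ q₂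

/-- Parallel compositions in the environment `X`, with bisimilar second components that are
idle as far as `X` is concerned. -/
def ParRelX (T : LTS A P) (S : Set A) (f : P → P → P) (X : Set A) (v w : P) : Prop :=
  ∃ p₁ p₂ q₁ q₂, v = f p₁ p₂ ∧ w = f q₁ q₂ ∧ CBRBisimX T (parEnv S X (T.initials p₂)) p₁ q₁ ∧
    CBRBisim T p₂ q₂ ∧ T.Stable q₂ ∧ Idle (T.initials p₂) (X \ S)

namespace ParRel

variable {S X : Set A} {f : P → P → P} {v w v' : P} {α : Act A}

theorem symm (h : ParRel T f v w) : ParRel T f w v := by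
  obtain ⟨p₁, p₂, q₁, q₂, rfl, rfl, h₁, h₂⟩ := h
  exact ⟨_, _, _, _, rfl, rfl, h₁.symm, h₂.symm⟩

theorem swap (h : ParRel T f v w) : ParRel T (fun p q => f q p) v w := by
  obtain ⟨p₁, p₂, q₁, q₂, rfl, rfl, h₁, h₂⟩ := h
  exact ⟨p₂, p₁, q₂, q₁, rfl, rfl, h₂, h₁⟩

theorem step (hf : IsParallel T S f) (h : ParRel T f v w) (hα : α ≠ Act.timeout)
    (hv : T v α v') : ∃ w₁ w₂, T.TauPath w w₁ ∧ T.OptStep w₁ α w₂ ∧ ParRel T f v w₁ ∧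
      ParRel T f v' w₂ := by
  obtain ⟨p₁, p₂, q₁, q₂, rfl, rfl, h₁, h₂⟩ := h
  rcases (hf _ _ _ _).1 hv with ⟨p', h1, hS, rfl⟩ | ⟨p', h1, hS, rfl⟩ |
    ⟨a, ha, p₁', p₂', rfl, h1, h2, rfl⟩
  · obtain ⟨r, r', k1, k2, k3, k4⟩ := CBRBisim.simulation.step _ _ h₁ α p' hα h1
    exact ⟨f r q₂, f r' q₂, hf.path_left k1 _, hf.optStep_left hS _ k2,
      ⟨_, _, _, _, rfl, rfl, k3, h₂⟩, ⟨_, _, _, _, rfl, rfl, k4, h₂⟩⟩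
  · obtain ⟨r, r', k1, k2, k3, k4⟩ := CBRBisim.simulation.step _ _ h₂ α p' hα h1
    exact ⟨f q₁ r, f q₁ r', hf.swap.path_left k1 _, hf.swap.optStep_left hS _ k2,
      ⟨_, _, _, _, rfl, rfl, h₁, k3⟩, ⟨_, _, _, _, rfl, rfl, h₁, k4⟩⟩
  · obtain ⟨r, r', k1, k2, k3, k4⟩ := CBRBisim.simulation.step _ _ h₁ _ _ hα h1
    obtain ⟨s, s', m1, m2, m3, m4⟩ := CBRBisim.simulation.step _ _ h₂ _ _ hα h2
    exact ⟨f r s, f r' s', hf.path k1 m1,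
      Or.inr (hf.sync ha (k2.of_ne (Act.vis_ne_tau _)) (m2.of_ne (Act.vis_ne_tau _))),
      ⟨_, _, _, _, rfl, rfl, k3, m3⟩, ⟨_, _, _, _, rfl, rfl, k4, m4⟩⟩

theorem stable (hf : IsParallel T S f) (h : ParRel T f v w) (hv : T.Stable v) :
    ∃ w₀, T.TauPath w w₀ ∧ T.Stable w₀ := by
  obtain ⟨p₁, p₂, q₁, q₂, rfl, rfl, h₁, h₂⟩ := h
  rw [hf.stable_iff] at hv
  obtain ⟨r, k1, _, k2⟩ := h₁.exists_stable hv.1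
  obtain ⟨s, m1, _, m2⟩ := h₂.exists_stable hv.2
  exact ⟨f r s, hf.path k1 m1, hf.stable_iff.2 ⟨k2, m2⟩⟩

end ParRel

namespace IsParallel

variable {S X : Set A} {f : P → P → P} {p q : P}

theorem idle_left (hf : IsParallel T S f) (h : Idle (T.initials (f p q)) X) :
    Idle (T.initials p) (parEnv S X (T.initials q)) := by
  refine (hf.stable_iff.1 h.stable).1.idle ?_
  rintro a ⟨haX, haS⟩ p' hp
  by_cases ha : a ∈ S
  · obtain ⟨_, q', hq⟩ := haS ha
    exact h.not_vis haX (hf.sync ha hp hq)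
  · exact h.not_vis haX (hf.left (vis_notMem ha) _ _ _ hp)

theorem idle_right (hf : IsParallel T S f) (h : Idle (T.initials (f p q)) X) :
    Idle (T.initials q) (X \ S) := by
  refine (hf.stable_iff.1 h.stable).2.idle ?_
  rintro a ⟨haX, haS⟩ p' hp
  exact h.not_vis haX (hf.right (vis_notMem haS) _ _ _ hp)

theorem timeout_inv (hf : IsParallel T S f) {w : P} (h : T (f p q) Act.timeout w) :
    (∃ p', T p Act.timeout p' ∧ w = f p' q) ∨ ∃ q', T q Act.timeout q' ∧ w = f p q' := by
  rcases (hf _ _ _ _).1 h with ⟨p', h1, hS, rfl⟩ | ⟨p', h1, hS, rfl⟩ |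
    ⟨_, _, _, _, h', _⟩
  · exact Or.inl ⟨p', h1, rfl⟩
  · exact Or.inr ⟨p', h1, rfl⟩
  · cases h'

end IsParallel

/-- The component that times out is afterwards known to be related only in `parEnv`. Its partner did
not move, and as the composition was idle the partner is stable and has no action in `X \ S`; on the
other side the partner can first be brought to a stable bisimilar state. -/
theorem ParRel.timeout_left {S X : Set A} {f : P → P → P} (hf : IsParallel T S f)
    {p₁ p₂ q₁ q₂ p' : P} (h₁ : CBRBisim T p₁ q₁) (h₂ : CBRBisim T p₂ q₂)
    (hi : Idle (T.initials (f p₁ p₂)) X) (hp : T p₁ Act.timeout p') :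
    ∃ w₁ w₂, T.TauPath (f q₁ q₂) w₁ ∧ T w₁ Act.timeout w₂ ∧ ParRelX T S f X (f p' p₂) w₂ := by
  obtain ⟨r, k1, k2, k3⟩ := h₁.exists_stable (hf.idle_left hi).stable
  obtain ⟨r', k4, k5⟩ := k2.timeout_of_stable (hf.idle_left hi) k3 hp
  obtain ⟨s, m1, m2, m3⟩ := h₂.exists_stable (hf.idle_right hi).stable
  exact ⟨f r s, f r' s, hf.path k1 m1, hf.left IsParallel.timeout_notMem _ _ _ k4,
    _, _, _, _, rfl, rfl, k5, m2, m3, hf.idle_right hi⟩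

theorem ParRel.timeout {S X : Set A} {f : P → P → P} (hf : IsParallel T S f) {v v' w : P}
    (h : ParRel T f v w) (hi : Idle (T.initials v) X) (hv : T v Act.timeout v') :
    ∃ w₁ w₂, T.TauPath w w₁ ∧ T w₁ Act.timeout w₂ ∧
      (ParRelX T S f X v' w₂ ∨ ParRelX T S (fun p q => f q p) X v' w₂) := by
  obtain ⟨p₁, p₂, q₁, q₂, rfl, rfl, h₁, h₂⟩ := h
  rcases hf.timeout_inv hv with ⟨p', h1, rfl⟩ | ⟨p', h1, rfl⟩
  · obtain ⟨w₁, w₂, k1, k2, k3⟩ := timeout_left hf h₁ h₂ hi h1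
    exact ⟨w₁, w₂, k1, k2, Or.inl k3⟩
  · obtain ⟨w₁, w₂, k1, k2, k3⟩ := timeout_left hf.swap h₂ h₁ hi h1
    exact ⟨w₁, w₂, k1, k2, Or.inr k3⟩

namespace ParRelX

variable {S X : Set A} {f : P → P → P} {v w v' : P} {α : Act A}

theorem symm (h : ParRelX T S f X v w) : ParRelX T S f X w v := by
  obtain ⟨p₁, p₂, q₁, q₂, rfl, rfl, h₁, h₂, h3, h4⟩ := h
  -- The environment is computed from the left-hand partner. Both partners are stable and bisimilar,
  -- so the right-hand one gives the same environment.
  have := h₂.initials_eq h4.stable h3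
  rw [this] at h₁
  exact ⟨_, _, _, _, rfl, rfl, h₁.symm, h₂.symm, h4.stable, by rwa [← this]⟩

theorem tau (hf : IsParallel T S f) (h : ParRelX T S f X v w) (hv : T v Act.tau v') :
    ∃ w₁ w₂, T.TauPath w w₁ ∧ T.OptStep w₁ Act.tau w₂ ∧ ParRelX T S f X v w₁ ∧
      ParRelX T S f X v' w₂ := by
  obtain ⟨p₁, p₂, q₁, q₂, rfl, rfl, h₁, h₂, h3, h4⟩ := h
  rcases (hf _ _ _ _).1 hv with ⟨p', h1, hS, rfl⟩ | ⟨p', h1, hS, rfl⟩ |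
    ⟨a, ha, p₁', p₂', h', h1, h2, rfl⟩
  · obtain ⟨r, r', k1, k2, k3, k4⟩ := CBRBisim.simulation.tauX _ _ _ h₁ p' h1
    exact ⟨f r q₂, f r' q₂, hf.path_left k1 _, hf.optStep_left hS _ k2,
      ⟨_, _, _, _, rfl, rfl, k3, h₂, h3, h4⟩, ⟨_, _, _, _, rfl, rfl, k4, h₂, h3, h4⟩⟩
  · exact (h4.stable _ h1).elim
  · cases h'

theorem vis (hf : IsParallel T S f) (h : ParRelX T S f X v w) {a : A} (haX : a ∈ X)
    (hv : T v (Act.vis a) v') :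
    ∃ w₁ w₂, T.TauPath w w₁ ∧ T w₁ (Act.vis a) w₂ ∧ ParRelX T S f X v w₁ ∧
      ParRel T f v' w₂ := by
  obtain ⟨p₁, p₂, q₁, q₂, rfl, rfl, h₁, h₂, h3, h4⟩ := h
  rcases (hf _ _ _ _).1 hv with ⟨p', h1, hS, rfl⟩ | ⟨p', h1, hS, rfl⟩ |
    ⟨b, ha, p₁', p₂', h', h1, h2, rfl⟩
  · have haS : a ∉ S := fun h => hS ⟨a, h, rfl⟩
    obtain ⟨r, r', k1, k2, k3, k4⟩ :=
      CBRBisim.simulation.visX _ _ _ h₁ a ⟨haX, fun h => (haS h).elim⟩ p' h1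
    exact ⟨f r q₂, f r' q₂, hf.path_left k1 _, hf.left hS _ _ _ k2,
      ⟨_, _, _, _, rfl, rfl, k3, h₂, h3, h4⟩, ⟨_, _, _, _, rfl, rfl, k4, h₂⟩⟩
  -- The partner cannot perform an action of `X` alone.
  · exact (h4.not_vis ⟨haX, fun h => hS ⟨a, h, rfl⟩⟩ h1).elim
  · cases h'
    obtain ⟨r, r', k1, k2, k3, k4⟩ :=
      -- The partner offers `a`, so `a` lies in `parEnv` even though it has to synchronise.
      CBRBisim.simulation.visX _ _ _ h₁ a ⟨haX, fun _ => LTS.initials_vis h2⟩ _ h1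
    obtain ⟨s, m1, m2⟩ := h₂.step_of_stable h4.stable h3 (Act.vis_ne_timeout _) h2
    exact ⟨f r q₂, f r' s, hf.path_left k1 _, hf.sync ha k2 m1,
      ⟨_, _, _, _, rfl, rfl, k3, h₂, h3, h4⟩, ⟨_, _, _, _, rfl, rfl, k4, m2⟩⟩

theorem idle (hf : IsParallel T S f) (h : ParRelX T S f X v w) (hi : Idle (T.initials v) X) :
    ∃ w₀, T.TauPath w w₀ ∧ ParRel T f v w₀ := by
  obtain ⟨p₁, p₂, q₁, q₂, rfl, rfl, h₁, h₂, h3, h4⟩ := h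
  obtain ⟨r, k1, k2, _⟩ := h₁.exists_idle (hf.idle_left hi)
  exact ⟨f r q₂, hf.path_left k1 _, _, _, _, _, rfl, rfl, k2, h₂⟩

theorem stable (hf : IsParallel T S f) (h : ParRelX T S f X v w) (hv : T.Stable v) :
    ∃ w₀, T.TauPath w w₀ ∧ T.Stable w₀ := by
  obtain ⟨p₁, p₂, q₁, q₂, rfl, rfl, h₁, h₂, h3, h4⟩ := h
  obtain ⟨r, k1, _, k2⟩ := h₁.exists_stable (hf.stable_iff.1 hv).1
  exact ⟨f r q₂, hf.path_left k1 _, hf.stable_iff.2 ⟨k2, h3⟩⟩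

end ParRelX

/-- A time-out of one component leads to `ParRelX`, with the partner frozen; the two versions of
`ParRelX` record which component timed out. There only the active component can perform τ, which
preserves the relation. A visible action allowed by `X`, or idling of the whole on `X`, leads back
to `ParRel`. -/
theorem IsParallel.bisimulation {S : Set A} {f : P → P → P} (hf : IsParallel T S f) :
    IsCBRBisimulation T (ParRel T f) (fun v X w => ParRel T f v w ∨ ParRelX T S f X v w ∨
      ParRelX T S (fun p q => f q p) X v w) := by
  refine IsCBRSimulation.bisimulation ⟨?_, ?_, ?_, ?_, ?_, ?_, ?_⟩ ?_ ?_
  · exact fun v w h α v' => h.step hf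
  · exact fun v w h Y => Or.inl h
  · rintro v X w (h | h | h) v' hv
    · obtain ⟨w₁, w₂, k1, k2, k3, k4⟩ := h.step hf Act.tau_ne_timeout hv
      exact ⟨w₁, w₂, k1, k2, Or.inl k3, Or.inl k4⟩
    · obtain ⟨w₁, w₂, k1, k2, k3, k4⟩ := h.tau hf hv
      exact ⟨w₁, w₂, k1, k2, Or.inr (Or.inl k3), Or.inr (Or.inl k4)⟩
    · obtain ⟨w₁, w₂, k1, k2, k3, k4⟩ := h.tau hf.swap hv
      exact ⟨w₁, w₂, k1, k2, Or.inr (Or.inr k3), Or.inr (Or.inr k4)⟩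
  · rintro v X w (h | h | h) a ha v' hv
    · obtain ⟨w₁, w₂, k1, k2, k3, k4⟩ := h.step hf (Act.vis_ne_timeout _) hv
      exact ⟨w₁, w₂, k1, k2.of_ne (Act.vis_ne_tau _), Or.inl k3, k4⟩
    · obtain ⟨w₁, w₂, k1, k2, k3, k4⟩ := h.vis hf ha hv
      exact ⟨w₁, w₂, k1, k2, Or.inr (Or.inl k3), k4⟩
    · obtain ⟨w₁, w₂, k1, k2, k3, k4⟩ := h.vis hf.swap ha hv
      exact ⟨w₁, w₂, k1, k2, Or.inr (Or.inr k3), k4.swap⟩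
  · rintro v X w (h | h | h) hi
    · exact ⟨w, .refl, h⟩
    · exact h.idle hf hi
    · obtain ⟨w₀, k1, k2⟩ := h.idle hf.swap hi
      exact ⟨w₀, k1, k2.swap⟩
  -- Every triple whose left side idles on `X` first reaches a pair by τ-steps on the right, so only
  -- time-outs of pairs need a direct argument.
  · have key : ∀ {v w v' : P} {X : Set A}, ParRel T f v w → Idle (T.initials v) X →
        T v Act.timeout v' → ∀ {w₀}, T.TauPath w₀ w → ∃ w₁ w₂, T.TauPath w₀ w₁ ∧
        T w₁ Act.timeout w₂ ∧ (ParRel T f v' w₂ ∨ ParRelX T S f X v' w₂ ∨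
          ParRelX T S (fun p q => f q p) X v' w₂) := by
      intro v w v' X h hi hv w₀ hw
      obtain ⟨w₁, w₂, k1, k2, k3⟩ := h.timeout hf hi hv
      exact ⟨w₁, w₂, hw.trans k1, k2, Or.inr k3⟩
    rintro v X w (h | h | h) hi v' hv
    · exact key h hi hv .refl
    · obtain ⟨w₀, k1, k2⟩ := h.idle hf hi
      exact key k2 hi hv k1
    · obtain ⟨w₀, k1, k2⟩ := h.idle hf.swap hi
      exact key k2.swap hi hv k1
  · rintro v X w (h | h | h) hi
    · exact h.stable hf hi
    · exact h.stable hf hi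
    · exact h.stable hf.swap hi
  · exact fun v w h => h.symm
  · exact fun v X w h => h.imp ParRel.symm (Or.imp ParRelX.symm ParRelX.symm)

theorem CBRBisim.par {S : Set A} {f : P → P → P} (hf : IsParallel T S f) {p₁ p₂ q₁ q₂ : P}
    (h₁ : CBRBisim T p₁ q₁) (h₂ : CBRBisim T p₂ q₂) : CBRBisim T (f p₁ p₂) (f q₁ q₂) :=
  ⟨_, _, hf.bisimulation, _, _, _, _, rfl, rfl, h₁, h₂⟩

theorem CBRBisimX.par {S X : Set A} {f : P → P → P} (hf : IsParallel T S f) {p₁ p₂ q₁ q₂ : P}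
    (h₁ : CBRBisimX T (parEnv S X (T.initials p₂)) p₁ q₁) (h₂ : CBRBisim T p₂ q₂)
    (hq : T.Stable q₂) (hp : Idle (T.initials p₂) (X \ S)) :
    CBRBisimX T X (f p₁ p₂) (f q₁ q₂) :=
  ⟨_, _, hf.bisimulation, Or.inr (Or.inl ⟨_, _, _, _, rfl, rfl, h₁, h₂, hq, hp⟩)⟩

/-! ### Environment operators and reactive bisimilarity. -/

/-- The relation `K` stands for either bisimilarity (any `L ⊆ U`) or `X`-bisimilarity (`L = U = X`).
The hypotheses list what θ can observe of its argument: τ, the actions in `U`, and everything once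
the argument idles on `L`, where `K` must improve to bisimilarity. -/
theorem IsTheta.bisimulation {L U : Set A} {f : P → P} (hf : IsTheta T L U f)
    {K : P → P → Prop} (symm : ∀ p q, K p q → K q p) (le : ∀ p q, CBRBisim T p q → K p q)
    (tau : ∀ p q, K p q → ∀ p', T p Act.tau p' →
      ∃ q₁ q₂, T.TauPath q q₁ ∧ T.OptStep q₁ Act.tau q₂ ∧ K p q₁ ∧ K p' q₂)
    (vis : ∀ p q, K p q → ∀ a ∈ U, ∀ p', T p (Act.vis a) p' →
      ∃ q₁ q₂, T.TauPath q q₁ ∧ T q₁ (Act.vis a) q₂ ∧ K p q₁ ∧ CBRBisim T p' q₂)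
    (idle : ∀ p q, K p q → Idle (T.initials p) L →
      ∃ q₀, T.TauPath q q₀ ∧ CBRBisim T p q₀ ∧ T.Stable q₀)
    (stable : ∀ p q, K p q → T.Stable p → ∃ q₀, T.TauPath q q₀ ∧ T.Stable q₀) :
    IsCBRBisimulation T (fun v w => (∃ p q, v = f p ∧ w = f q ∧ K p q) ∨ CBRBisim T v w)
      (fun v X w => (∃ p q, v = f p ∧ w = f q ∧ K p q) ∨ CBRBisimX T X v w) := by
  have step : ∀ p q, K p q → ∀ α w, α ≠ Act.timeout → T (f p) α w →
      ∃ w₁ w₂, T.TauPath (f q) w₁ ∧ T.OptStep w₁ α w₂ ∧ (∃ q₁, w₁ = f q₁ ∧ K p q₁) ∧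
        ((α = Act.tau ∧ ∃ p q, w = f p ∧ w₂ = f q ∧ K p q) ∨ CBRBisim T w w₂) := by
    intro p q h α w hα hw
    rcases (hf _ _ _).1 hw with ⟨p', rfl, h1, rfl⟩ | ⟨⟨a, ha, rfl⟩, h1⟩ | ⟨h1, hi⟩
    · obtain ⟨q₁, q₂, k1, k2, k3, k4⟩ := tau p q h p' h1
      exact ⟨f q₁, f q₂, hf.path k1, k2.map id hf.tau, ⟨q₁, rfl, k3⟩,
        Or.inl ⟨rfl, _, _, rfl, rfl, k4⟩⟩
    · obtain ⟨q₁, q₂, k1, k2, k3, k4⟩ := vis p q h a ha w h1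
      exact ⟨f q₁, q₂, hf.path k1, Or.inr (hf.vis ha k2), ⟨q₁, rfl, k3⟩, Or.inr k4⟩
    · obtain ⟨q₀, k1, k2, k3⟩ := idle p q h hi
      obtain ⟨q', k4, k5⟩ := k2.step_of_stable hi.stable k3 hα h1
      exact ⟨f q₀, q', hf.path k1,
        Or.inr (hf.idle k4 (by rwa [← k2.initials_eq hi.stable k3])),
        ⟨q₀, rfl, le _ _ k2⟩, Or.inr k5⟩
  refine IsCBRSimulation.bisimulation ⟨?_, ?_, ?_, ?_, ?_, ?_, ?_⟩ ?_ ?_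
  · rintro _ _ (⟨p, q, rfl, rfl, h⟩ | h) α w hα hw
    · obtain ⟨w₁, w₂, k1, k2, ⟨q₁, rfl, k3⟩, k4⟩ := step p q h α w hα hw
      exact ⟨_, w₂, k1, k2, Or.inl ⟨p, q₁, rfl, rfl, k3⟩, k4.imp And.right id⟩
    · obtain ⟨q₁, q₂, k1, k2, k3, k4⟩ := CBRBisim.simulation.step _ _ h α w hα hw
      exact ⟨q₁, q₂, k1, k2, Or.inr k3, Or.inr k4⟩
  · exact fun _ _ h Y => h.imp id fun h => h.settle Y
  · rintro _ X _ (⟨p, q, rfl, rfl, h⟩ | h) w hw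
    · obtain ⟨w₁, w₂, k1, k2, ⟨q₁, rfl, k3⟩, k4⟩ := step p q h _ w Act.tau_ne_timeout hw
      exact ⟨_, w₂, k1, k2, Or.inl ⟨p, q₁, rfl, rfl, k3⟩, k4.imp And.right fun h => h.settle X⟩
    · obtain ⟨q₁, q₂, k1, k2, k3, k4⟩ := CBRBisim.simulation.tauX _ _ _ h w hw
      exact ⟨q₁, q₂, k1, k2, Or.inr k3, Or.inr k4⟩
  · rintro _ X _ (⟨p, q, rfl, rfl, h⟩ | h) a ha w hw
    · obtain ⟨w₁, w₂, k1, k2, ⟨q₁, rfl, k3⟩, k4⟩ := step p q h _ w (Act.vis_ne_timeout a) hw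
      exact ⟨_, w₂, k1, k2.of_ne (Act.vis_ne_tau a), Or.inl ⟨p, q₁, rfl, rfl, k3⟩,
        k4.imp And.right id⟩
    · obtain ⟨q₁, q₂, k1, k2, k3, k4⟩ := CBRBisim.simulation.visX _ _ _ h a ha w hw
      exact ⟨q₁, q₂, k1, k2, Or.inr k3, Or.inr k4⟩
  · rintro _ X _ (⟨p, q, rfl, rfl, h⟩ | h) hi
    -- Triples built from `K` are the same for every `X`, so they are already pairs.
    · exact ⟨f q, .refl, Or.inl ⟨p, q, rfl, rfl, h⟩⟩
    · obtain ⟨q₀, k1, k2⟩ := CBRBisim.simulation.idleX _ _ _ h hi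
      exact ⟨q₀, k1, Or.inr k2⟩
  · rintro _ X _ (⟨p, q, rfl, rfl, h⟩ | h) hi w hw
    · rcases (hf _ _ _).1 hw with ⟨p', h', _⟩ | ⟨⟨a, ha, h'⟩, h1⟩ | ⟨h1, hL⟩
      · cases h'
      · cases h'
      -- A time-out passes θ only if `p` idles on `L`; then θ lets every action of `p` through, so
      -- idling of `f p` on `X` is inherited by `p`.
      · have hX : Idle (T.initials p) X :=
          hL.stable.idle fun a ha p' hp' => hi.not_vis ha (hf.idle hp' hL)
        obtain ⟨q₀, k1, k2, k3⟩ := idle p q h hL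
        obtain ⟨q', k4, k5⟩ := k2.timeout_of_stable hX k3 h1
        exact ⟨f q₀, q', hf.path k1, hf.idle k4 (by rwa [← k2.initials_eq hL.stable k3]),
          Or.inr k5⟩
    · obtain ⟨q₁, q₂, k1, k2, k3⟩ := CBRBisim.simulation.timeoutX _ _ _ h hi w hw
      exact ⟨q₁, q₂, k1, k2, Or.inr k3⟩
  · rintro _ X _ (⟨p, q, rfl, rfl, h⟩ | h) hs
    · obtain ⟨q₀, k1, k2⟩ := stable _ _ h (hf.stable_iff.1 hs)
      exact ⟨f q₀, hf.path k1, hf.stable_iff.2 k2⟩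
    · exact CBRBisim.simulation.stableX _ _ _ h hs
  · rintro _ _ (⟨p, q, rfl, rfl, h⟩ | h)
    · exact Or.inl ⟨q, p, rfl, rfl, symm _ _ h⟩
    · exact Or.inr h.symm
  · rintro _ _ _ (⟨p, q, rfl, rfl, h⟩ | h)
    · exact Or.inl ⟨q, p, rfl, rfl, symm _ _ h⟩
    · exact Or.inr h.symm

theorem CBRBisim.theta {L U : Set A} {f : P → P} (hf : IsTheta T L U f) {p q : P}
    (h : CBRBisim T p q) : CBRBisim T (f p) (f q) := by
  refine ⟨_, _, hf.bisimulation (K := CBRBisim T) (fun _ _ => symm) (fun _ _ => id) ?_ ?_ ?_ ?_,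
    Or.inl ⟨p, q, rfl, rfl, h⟩⟩
  · exact fun p q h p' => simulation.step p q h _ p' Act.tau_ne_timeout
  · intro p q h a _ p' hp
    obtain ⟨q₁, q₂, k1, k2, k3, k4⟩ := simulation.step p q h _ p' (Act.vis_ne_timeout a) hp
    exact ⟨q₁, q₂, k1, k2.of_ne (Act.vis_ne_tau a), k3, k4⟩
  · exact fun p q h hi => h.exists_stable hi.stable
  · exact fun p q h => simulation.stableX p ∅ q (h.settle ∅)

/-- Under θ_X the argument behaves as in the environment `X` until a visible action occurs or it
idles on `X`, and both events turn `X`-bisimilarity into bisimilarity. Hence the conclusion holds in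
every environment. -/
theorem CBRBisimX.theta {X : Set A} {f : P → P} (hf : IsTheta T X X f) {p q : P}
    (h : CBRBisimX T X p q) : CBRBisim T (f p) (f q) :=
  ⟨_, _, hf.bisimulation (K := CBRBisimX T X) (fun _ _ => symm) (fun _ _ h => h.settle X)
    (fun p q h p' => CBRBisim.simulation.tauX p X q h p')
    (fun p q h a => CBRBisim.simulation.visX p X q h a)
    (fun _ _ h => h.exists_idle)
    (fun p q h => CBRBisim.simulation.stableX p X q h),
    Or.inl ⟨p, q, rfl, rfl, h⟩⟩

theorem IsSum.idle {f : P → P → P} (hf : IsSum T f) {p q : P} {X : Set A}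
    (h : Idle (T.initials (f p q)) X) : Idle (T.initials p) X ∧ Idle (T.initials q) X := by
  constructor
  · exact LTS.Stable.idle (fun _ hp => h.stable _ ((hf _ _ _ _).2 (Or.inl hp)))
      fun a ha _ hp => h.not_vis ha ((hf _ _ _ _).2 (Or.inl hp))
  · exact LTS.Stable.idle (fun _ hp => h.stable _ ((hf _ _ _ _).2 (Or.inr hp)))
      fun a ha _ hp => h.not_vis ha ((hf _ _ _ _).2 (Or.inr hp))

/-! ### Rooted concrete branching reactive bisimilarity and the operators. -/

namespace RootedCBRBisim

theorem bisim {p q : P} (h : RootedCBRBisim T p q) : CBRBisim T p q := by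
  refine IsCBRSimulation.bisim (R := fun p q => RootedCBRBisim T p q ∨ CBRBisim T p q)
    (RX := fun p X q => RootedCBRBisim T p q ∨ CBRBisimX T X p q) ⟨?_, ?_, ?_, ?_, ?_, ?_, ?_⟩
    (fun _ _ h => h.imp symm CBRBisim.symm) (fun _ _ _ h => h.imp symm CBRBisimX.symm)
    (Or.inl h)
  · rintro p q (h | h) α p' hα hp
    · obtain ⟨q', h1, h2⟩ := h.toMatch.step α p' hα hp
      exact ⟨q, q', .refl, Or.inr h1, Or.inl h, Or.inr h2⟩
    · obtain ⟨q₁, q₂, h1, h2, h3, h4⟩ := CBRBisim.simulation.step p q h α p' hα hp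
      exact ⟨q₁, q₂, h1, h2, Or.inr h3, Or.inr h4⟩
  · exact fun _ _ h Y => h.imp id fun h => h.settle Y
  · rintro p X q (h | h) p' hp
    · obtain ⟨q', h1, h2⟩ := h.toMatch.step _ p' Act.tau_ne_timeout hp
      exact ⟨q, q', .refl, Or.inr h1, Or.inl h, Or.inr (h2.settle X)⟩
    · obtain ⟨q₁, q₂, h1, h2, h3, h4⟩ := CBRBisim.simulation.tauX p X q h p' hp
      exact ⟨q₁, q₂, h1, h2, Or.inr h3, Or.inr h4⟩
  · rintro p X q (h | h) a ha p' hp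
    · obtain ⟨q', h1, h2⟩ := h.toMatch.step _ p' (Act.vis_ne_timeout a) hp
      exact ⟨q, q', .refl, h1, Or.inl h, Or.inr h2⟩
    · obtain ⟨q₁, q₂, h1, h2, h3, h4⟩ := CBRBisim.simulation.visX p X q h a ha p' hp
      exact ⟨q₁, q₂, h1, h2, Or.inr h3, Or.inr h4⟩
  · rintro p X q (h | h) hp
    · exact ⟨q, .refl, Or.inl h⟩
    · obtain ⟨q₀, h1, h2⟩ := CBRBisim.simulation.idleX p X q h hp
      exact ⟨q₀, h1, Or.inr h2⟩
  · rintro p X q (h | h) hi p' hp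
    · obtain ⟨q', h1, h2⟩ := h.toMatch.timeout X hi p' hp
      exact ⟨q, q', .refl, h1, Or.inr h2⟩
    · obtain ⟨q₁, q₂, h1, h2, h3⟩ := CBRBisim.simulation.timeoutX p X q h hi p' hp
      exact ⟨q₁, q₂, h1, h2, Or.inr h3⟩
  · rintro p X q (h | h) hp
    · exact ⟨q, .refl, by rwa [LTS.stable_iff, ← h.initials_eq, ← LTS.stable_iff]⟩
    · exact CBRBisim.simulation.stableX p X q h hp

theorem relabel {l : Act A → Act A → Prop} {f : P → P} (hf : IsRelabel T l f)
    (hl : IsRelabelling l) {p q : P} (h : RootedCBRBisim T p q) :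
    RootedCBRBisim T (f p) (f q) := by
  have key : ∀ {p q}, RootedCBRBisim T p q → CBRMatch T (f p) (f q) := by
    refine fun h => ⟨fun α w hα hw => ?_, fun X hX w hw => ?_⟩
    · obtain ⟨β, p', h1, h2, rfl⟩ := (hf _ _ _).1 hw
      obtain ⟨q', k1, k2⟩ := h.toMatch.step β p' (hl.ne_timeout h2 hα) h1
      exact ⟨f q', hf.step h2 _ _ k1, k2.relabel hf hl⟩
    · obtain ⟨p', h1, rfl⟩ := hf.timeout_inv hl hw
      obtain ⟨q', k1, k2⟩ := h.toMatch.timeout _ (hf.idle hl hX) p' h1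
      exact ⟨f q', hf.step ((hl.timeout _).2 rfl) _ _ k1, k2.relabel hf hl⟩
  exact rootedCBRBisim_iff.2 ⟨key h, key h.symm⟩

theorem timeout_left {S X : Set A} {f : P → P → P} (hf : IsParallel T S f) {p₁ p₂ q₁ q₂ p' : P}
    (h₁ : RootedCBRBisim T p₁ q₁) (h₂ : RootedCBRBisim T p₂ q₂)
    (hX : Idle (T.initials (f p₁ p₂)) X) (hp : T p₁ Act.timeout p') :
    ∃ w, T (f q₁ q₂) Act.timeout w ∧ CBRBisimX T X (f p' p₂) w := by
  obtain ⟨q', k1, k2⟩ := h₁.toMatch.timeout _ (hf.idle_left hX) p' hp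
  refine ⟨f q' q₂, hf.left IsParallel.timeout_notMem _ _ _ k1,
    k2.par hf h₂.bisim ?_ (hf.idle_right hX)⟩
  -- Rooted bisimilar processes have equal initial actions even when unstable, so `q₂` is stable
  -- because `p₂` is.
  rw [LTS.stable_iff, ← h₂.initials_eq]
  exact (hf.idle_right hX).1

theorem par {S : Set A} {f : P → P → P} (hf : IsParallel T S f) {p₁ p₂ q₁ q₂ : P}
    (h₁ : RootedCBRBisim T p₁ q₁) (h₂ : RootedCBRBisim T p₂ q₂) :
    RootedCBRBisim T (f p₁ p₂) (f q₁ q₂) := by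
  have key : ∀ {p₁ p₂ q₁ q₂}, RootedCBRBisim T p₁ q₁ → RootedCBRBisim T p₂ q₂ →
      CBRMatch T (f p₁ p₂) (f q₁ q₂) := by
    refine fun {p₁ p₂ q₁ q₂} h₁ h₂ => ⟨fun α w hN hw => ?_, fun X hX w hw => ?_⟩
    · rcases (hf _ _ _ _).1 hw with ⟨p', h1, hα, rfl⟩ | ⟨p', h1, hα, rfl⟩ |
        ⟨a, ha, p₁', p₂', rfl, h1, h2, rfl⟩
      · obtain ⟨q', k1, k2⟩ := h₁.toMatch.step _ _ hN h1
        exact ⟨f q' q₂, hf.left hα _ _ _ k1, k2.par hf h₂.bisim⟩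
      · obtain ⟨q', k1, k2⟩ := h₂.toMatch.step _ _ hN h1
        exact ⟨f q₁ q', hf.right hα _ _ _ k1, h₁.bisim.par hf k2⟩
      · obtain ⟨q', k1, k2⟩ := h₁.toMatch.step _ _ hN h1
        obtain ⟨q'', k3, k4⟩ := h₂.toMatch.step _ _ hN h2
        exact ⟨f q' q'', hf.sync ha k1 k3, k2.par hf k4⟩
    · rcases hf.timeout_inv hw with ⟨p', h1, rfl⟩ | ⟨p', h1, rfl⟩
      · exact timeout_left hf h₁ h₂ hX h1
      · exact timeout_left hf.swap h₂ h₁ hX h1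
  exact rootedCBRBisim_iff.2 ⟨key h₁ h₂, key h₁.symm h₂.symm⟩

theorem theta {L U : Set A} {f : P → P} (hf : IsTheta T L U f) {p q : P}
    (h : RootedCBRBisim T p q) : RootedCBRBisim T (f p) (f q) := by
  have key : ∀ {p q}, RootedCBRBisim T p q → CBRMatch T (f p) (f q) := by
    refine fun {p q} h => ⟨fun α w hN hw => ?_, fun X hX w hw => ?_⟩
    · rcases (hf _ _ _).1 hw with ⟨p', rfl, h1, rfl⟩ | ⟨⟨a, ha, rfl⟩, h1⟩ | ⟨h1, hi⟩
      · obtain ⟨q', k1, k2⟩ := h.toMatch.step _ p' hN h1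
        exact ⟨f q', hf.tau _ _ k1, k2.theta hf⟩
      · obtain ⟨q', k1, k2⟩ := h.toMatch.step _ w hN h1
        exact ⟨q', hf.vis ha k1, k2⟩
      · obtain ⟨q', k1, k2⟩ := h.toMatch.step _ w hN h1
        exact ⟨q', hf.idle k1 (by rwa [← h.initials_eq]), k2⟩
    · rcases (hf _ _ _).1 hw with ⟨p', h', _⟩ | ⟨⟨a, ha, h'⟩, h1⟩ | ⟨h1, hi⟩
      · cases h'
      · cases h'
      · obtain ⟨q', k1, k2⟩ := h.toMatch.timeout X
          (hi.stable.idle fun a ha p' hp' => hX.not_vis ha (hf.idle hp' hi)) w h1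
        exact ⟨q', hf.idle k1 (by rwa [← h.initials_eq]), k2⟩
  exact rootedCBRBisim_iff.2 ⟨key h, key h.symm⟩

theorem psi {X : Set A} {f g : P → P} (hf : IsTheta T X X f) (hg : IsPsi T X f g) {p q : P}
    (h : RootedCBRBisim T p q) : RootedCBRBisim T (g p) (g q) := by
  have key : ∀ {p q}, RootedCBRBisim T p q → CBRMatch T (g p) (g q) := by
    refine fun {p q} h => ⟨fun α w hN hw => ?_, fun Y _ w hw => ?_⟩
    · rcases (hg _ _ _).1 hw with ⟨hα, h1⟩ | ⟨p', rfl, _⟩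
      · obtain ⟨q', k1, k2⟩ := h.toMatch.step _ w hα h1
        exact ⟨q', (hg _ _ _).2 (Or.inl ⟨hα, k1⟩), k2⟩
      · exact (hN rfl).elim
    · rcases (hg _ _ _).1 hw with ⟨hα, h1⟩ | ⟨p', _, hi, h1, rfl⟩
      · exact (hα rfl).elim
      -- The time-out is matched in the environment `X` of the operator, not in the ambient `Y`. The
      -- θ_X that guards the targets makes them bisimilar outright, hence also in `Y`.
      · obtain ⟨q', k1, k2⟩ := h.toMatch.timeout X hi p' h1
        exact ⟨f q', (hg _ _ _).2 (Or.inr ⟨q', rfl, by rwa [← h.initials_eq], k1, rfl⟩),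
          (k2.theta hf).settle Y⟩
  exact rootedCBRBisim_iff.2 ⟨key h, key h.symm⟩

theorem sum {f : P → P → P} (hf : IsSum T f) {p₁ p₂ q₁ q₂ : P}
    (h₁ : RootedCBRBisim T p₁ q₁) (h₂ : RootedCBRBisim T p₂ q₂) :
    RootedCBRBisim T (f p₁ p₂) (f q₁ q₂) := by
  have key : ∀ {p₁ p₂ q₁ q₂}, RootedCBRBisim T p₁ q₁ → RootedCBRBisim T p₂ q₂ →
      CBRMatch T (f p₁ p₂) (f q₁ q₂) := by
    refine fun {p₁ p₂ q₁ q₂} h₁ h₂ => ⟨fun α w hN hw => ?_, fun X hX w hw => ?_⟩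
    · rcases (hf _ _ _ _).1 hw with h | h
      · obtain ⟨q', k1, k2⟩ := h₁.toMatch.step _ _ hN h
        exact ⟨q', (hf _ _ _ _).2 (Or.inl k1), k2⟩
      · obtain ⟨q', k1, k2⟩ := h₂.toMatch.step _ _ hN h
        exact ⟨q', (hf _ _ _ _).2 (Or.inr k1), k2⟩
    · rcases (hf _ _ _ _).1 hw with h | h
      · obtain ⟨q', k1, k2⟩ := h₁.toMatch.timeout X (hf.idle hX).1 _ h
        exact ⟨q', (hf _ _ _ _).2 (Or.inl k1), k2⟩
      · obtain ⟨q', k1, k2⟩ := h₂.toMatch.timeout X (hf.idle hX).2 _ h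
        exact ⟨q', (hf _ _ _ _).2 (Or.inr k1), k2⟩
  exact rootedCBRBisim_iff.2 ⟨key h₁ h₂, key h₁.symm h₂.symm⟩

theorem prefixing {α : Act A} {f : P → P} (hf : IsPrefix T α f) {p q : P}
    (h : RootedCBRBisim T p q) : RootedCBRBisim T (f p) (f q) := by
  have key : ∀ {p q}, RootedCBRBisim T p q → CBRMatch T (f p) (f q) := by
    refine fun {p q} h => ⟨fun β w _ hw => ?_, fun X _ w hw => ?_⟩
    · obtain ⟨rfl, rfl⟩ := (hf _ _ _).1 hw
      exact ⟨q, (hf _ _ _).2 ⟨rfl, rfl⟩, h.bisim⟩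
    · obtain ⟨rfl, rfl⟩ := (hf _ _ _).1 hw
      exact ⟨q, (hf _ _ _).2 ⟨rfl, rfl⟩, h.bisim.settle X⟩
  exact rootedCBRBisim_iff.2 ⟨key h, key h.symm⟩

end RootedCBRBisim

end Reactive

section Processes

variable {A : Type u} {V : Type v}

/-! ### The operators on processes -/

theorem Exp.Closed.fv_subset {D : Set V} {S : D → Exp A V} {y : D} (h : Closed (.fix D S y))
    (z : D) : fv (S z) ⊆ D := by
  intro x hx
  by_contra hD
  have h1 : x ∈ fv (.fix D S y) := ⟨Set.mem_iUnion.2 ⟨z, hx⟩, hD⟩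
  rw [h.2] at h1
  exact h1
namespace Proc

def nil : Proc A V := ⟨.nil, trivial, rfl⟩

def act (α : Act A) (P : Proc A V) : Proc A V := ⟨.act α P.1, P.2⟩

def sum (P Q : Proc A V) : Proc A V := ⟨.sum P.1 Q.1, Exp.closed_sum.2 ⟨P.2, Q.2⟩⟩

def par (S : Set A) (P Q : Proc A V) : Proc A V := ⟨.par S P.1 Q.1, Exp.closed_par.2 ⟨P.2, Q.2⟩⟩

def hide (I : Set A) (P : Proc A V) : Proc A V := ⟨.hide I P.1, P.2⟩

def ren (R : Set (A × A)) (hR : ∀ a, {b | (a, b) ∈ R}.Finite) (P : Proc A V) : Proc A V :=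
  ⟨.ren R hR P.1, P.2⟩

def theta (L U : Set A) (hLU : L ⊆ U) (P : Proc A V) : Proc A V :=
  ⟨.theta L U hLU P.1, Exp.closed_theta.2 P.2⟩

def psi (X : Set A) (P : Proc A V) : Proc A V := ⟨.psi X P.1, Exp.closed_psi.2 P.2⟩

/-- `Step` evaluates negative premises with `derivedInitials certainInitials`. By `step_iff` this is
the set of actual initial actions of a process, which gives `isTheta` and `isPsi` their literal
form. -/
theorem derivedInitials_eq (P : Proc A V) :
    Exp.derivedInitials Exp.certainInitials P.1 = (procLTS A V).initials P := by
  have h0 : LTS.initials (Exp.Step (A := A) (V := V)) = Exp.certainInitials :=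
    Exp.certainInitials_eq
  ext α
  constructor
  · rintro ⟨h1, E', h2⟩
    rw [← h0, ← Exp.step_iff P.2] at h2
    exact ⟨h1, ⟨E', h2.closed P.2⟩, h2⟩
  · rintro ⟨h1, Q, h2⟩
    refine ⟨h1, Q.1, ?_⟩
    rw [← h0, ← Exp.step_iff P.2]
    exact h2

theorem isPrefix (α : Act A) : IsPrefix (procLTS A V) α (act α) := by
  rintro ⟨E, hE⟩ β ⟨W, hW⟩
  constructor
  · intro h
    change Exp.Derivable _ (Exp.act α E) β W at h
    cases h
    exact ⟨rfl, rfl⟩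
  · rintro ⟨rfl, h⟩
    cases h
    exact Exp.Derivable.act β E

theorem isSum : IsSum (procLTS A V) sum := by
  rintro ⟨E, hE⟩ ⟨F, hF⟩ β ⟨W, hW⟩
  constructor
  · intro h
    change Exp.Derivable _ (Exp.sum E F) β W at h
    cases h with
    | sum_left _ _ _ _ h => exact Or.inl h
    | sum_right _ _ _ _ h => exact Or.inr h
  · rintro (h | h)
    · exact Exp.Derivable.sum_left _ _ _ _ h
    · exact Exp.Derivable.sum_right _ _ _ _ h

theorem isParallel (S : Set A) : IsParallel (procLTS A V) S (par S) := by
  rintro ⟨E, hE⟩ ⟨F, hF⟩ β ⟨W, hW⟩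
  constructor
  · intro h
    change Exp.Derivable _ (Exp.par S E F) β W at h
    cases h with
    | par_left _ _ _ _ E' h hS => exact Or.inl ⟨⟨E', h.closed hE⟩, h, hS, rfl⟩
    | par_right _ _ _ _ F' h hS => exact Or.inr (Or.inl ⟨⟨F', h.closed hF⟩, h, hS, rfl⟩)
    | par_sync _ _ _ a E' F' h h' ha =>
      exact Or.inr (Or.inr ⟨a, ha, ⟨E', h.closed hE⟩, ⟨F', h'.closed hF⟩, rfl, h, h', rfl⟩)
  · rintro (⟨P', h, hS, e⟩ | ⟨P', h, hS, e⟩ | ⟨a, ha, P', Q', rfl, h, h', e⟩)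
    · cases e
      exact Exp.Derivable.par_left _ _ _ _ _ h hS
    · cases e
      exact Exp.Derivable.par_right _ _ _ _ _ h hS
    · cases e
      exact Exp.Derivable.par_sync _ _ _ _ _ _ h h' ha

/-- The relabelling of actions by abstraction from `I`. -/
def hideRel (I : Set A) (β α : Act A) : Prop :=
  (β ∉ Act.vis '' I ∧ α = β) ∨ (β ∈ Act.vis '' I ∧ α = Act.tau)

theorem isRelabelling_hideRel (I : Set A) : IsRelabelling (hideRel I) where
  tau := by intro α; simp [hideRel]
  timeout := by intro α; simp [hideRel]
  of_timeout := by
    rintro β (⟨_, h⟩ | ⟨_, h⟩)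
    · exact h.symm
    · cases h

theorem isRelabel_hide (I : Set A) : IsRelabel (procLTS A V) (hideRel I) (hide I) := by
  rintro ⟨E, hE⟩ β ⟨W, hW⟩
  constructor
  · intro h
    change Exp.Derivable _ (Exp.hide I E) β W at h
    cases h with
    | hide_out _ _ _ E' h hI => exact ⟨β, ⟨E', h.closed hE⟩, h, Or.inl ⟨hI, rfl⟩, rfl⟩
    | hide_in _ _ a E' h ha =>
      exact ⟨Act.vis a, ⟨E', h.closed hE⟩, h, Or.inr ⟨⟨a, ha, rfl⟩, rfl⟩, rfl⟩
  · rintro ⟨α, P', h, ⟨h1, rfl⟩ | ⟨⟨a, ha, rfl⟩, rfl⟩, e⟩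
    · cases e
      exact Exp.Derivable.hide_out _ _ _ _ h h1
    · cases e
      exact Exp.Derivable.hide_in _ _ _ _ h ha

/-- The relabelling of actions by the renaming `R`. -/
def renRel (R : Set (A × A)) (β α : Act A) : Prop :=
  (∃ a b, (a, b) ∈ R ∧ β = Act.vis a ∧ α = Act.vis b) ∨ (β = Act.tau ∧ α = Act.tau) ∨
    (β = Act.timeout ∧ α = Act.timeout)

theorem isRelabelling_renRel (R : Set (A × A)) : IsRelabelling (renRel R) where
  tau := by intro α; simp [renRel]
  timeout := by intro α; simp [renRel]
  of_timeout := by intro β; simp [renRel]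

theorem isRelabel_ren (R : Set (A × A)) (hR : ∀ a, {b | (a, b) ∈ R}.Finite) :
    IsRelabel (procLTS A V) (renRel R) (ren R hR) := by
  rintro ⟨E, hE⟩ β ⟨W, hW⟩
  constructor
  · intro h
    change Exp.Derivable _ (Exp.ren R hR E) β W at h
    cases h with
    | ren_vis _ _ _ a b E' h hab =>
      exact ⟨Act.vis a, ⟨E', h.closed hE⟩, h, Or.inl ⟨a, b, hab, rfl, rfl⟩, rfl⟩
    | ren_tau _ _ _ E' h =>
      exact ⟨Act.tau, ⟨E', h.closed hE⟩, h, Or.inr (Or.inl ⟨rfl, rfl⟩), rfl⟩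
    | ren_timeout _ _ _ E' h =>
      exact ⟨Act.timeout, ⟨E', h.closed hE⟩, h, Or.inr (Or.inr ⟨rfl, rfl⟩), rfl⟩
  · rintro ⟨α, P', h, ⟨a, b, hab, rfl, rfl⟩ | ⟨rfl, rfl⟩ | ⟨rfl, rfl⟩, e⟩
    · cases e
      exact Exp.Derivable.ren_vis _ _ _ _ _ _ h hab
    · cases e
      exact Exp.Derivable.ren_tau _ _ _ _ h
    · cases e
      exact Exp.Derivable.ren_timeout _ _ _ _ h

theorem isTheta (L U : Set A) (hLU : L ⊆ U) :
    IsTheta (procLTS A V) L U (theta L U hLU) := by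
  intro P β W
  obtain ⟨W, hW⟩ := W
  rw [← derivedInitials_eq]
  constructor
  · intro h
    change Exp.Derivable _ (Exp.theta L U hLU P.1) β W at h
    cases h with
    | theta_tau _ _ _ _ E' h => exact Or.inl ⟨⟨E', h.closed P.2⟩, rfl, h, rfl⟩
    | theta_vis _ _ _ _ a _ h ha => exact Or.inr (Or.inl ⟨⟨a, ha, rfl⟩, h⟩)
    | theta_idle _ _ _ _ _ _ h hi => exact Or.inr (Or.inr ⟨h, hi⟩)
  · rintro (⟨P', rfl, h, e⟩ | ⟨⟨a, ha, rfl⟩, h⟩ | ⟨h, hi⟩)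
    · cases e
      exact Exp.Derivable.theta_tau _ _ _ _ _ h
    · exact Exp.Derivable.theta_vis _ _ _ _ _ _ h ha
    · exact Exp.Derivable.theta_idle _ _ _ _ _ _ h hi

theorem isPsi (X : Set A) : IsPsi (procLTS A V) X (theta X X subset_rfl) (psi X) := by
  intro P β W
  obtain ⟨W, hW⟩ := W
  rw [← derivedInitials_eq]
  constructor
  · intro h
    change Exp.Derivable _ (Exp.psi X P.1) β W at h
    cases h with
    | psi_act _ _ _ _ h hα => exact Or.inl ⟨hα, h⟩
    | psi_timeout _ _ E' h hi => exact Or.inr ⟨⟨E', h.closed P.2⟩, rfl, hi, h, rfl⟩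
  · rintro (⟨hα, h⟩ | ⟨P', rfl, hi, h, e⟩)
    · exact Exp.Derivable.psi_act _ _ _ _ h hα
    · cases e
      exact Exp.Derivable.psi_timeout _ _ _ h hi

/-- The process `⟨S_y | S⟩` that has the same transitions as `⟨y | S⟩`. -/
noncomputable def unfold {D : Set V} {S : D → Exp A V} {y : D} (h : Exp.Closed (.fix D S y)) :
    Proc A V := ⟨Exp.subst (Exp.solution D S) (S y), h.unfold⟩

theorem unfold_step {D : Set V} {S : D → Exp A V} {y : D} (h : Exp.Closed (.fix D S y))
    {α : Act A} {W : Proc A V} :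
    procLTS A V ⟨.fix D S y, h⟩ α W ↔ procLTS A V (unfold h) α W := by
  obtain ⟨W, hW⟩ := W
  constructor
  · intro h
    change Exp.Derivable _ (Exp.fix D S y) α W at h
    cases h with
    | fix _ _ _ _ _ h => exact h
  · exact fun h => Exp.Derivable.fix _ _ _ _ _ h

theorem initials_unfold {D : Set V} {S : D → Exp A V} {y : D} (h : Exp.Closed (.fix D S y)) :
    (procLTS A V).initials (unfold h) = (procLTS A V).initials ⟨.fix D S y, h⟩ := by
  simp only [LTS.initials, unfold_step]

end Proc

namespace Exp

/-! ### Replacing a recursive specification inside an expression -/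

/-- The expression `F` arises from `E` by replacing subexpressions `⟨y | S⟩` by `⟨y | S'⟩`, outside
of the scope of environment operators. -/
inductive Replace (D : Set V) (S S' : D → Exp A V) : Exp A V → Exp A V → Prop
  | nil : Replace D S S' nil nil
  | var (x) : Replace D S S' (var x) (var x)
  | act (α E F) : Replace D S S' E F → Replace D S S' (act α E) (act α F)
  | sum (E₁ E₂ F₁ F₂) : Replace D S S' E₁ F₁ → Replace D S S' E₂ F₂ →
      Replace D S S' (sum E₁ E₂) (sum F₁ F₂)
  | par (X E₁ E₂ F₁ F₂) : Replace D S S' E₁ F₁ → Replace D S S' E₂ F₂ →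
      Replace D S S' (par X E₁ E₂) (par X F₁ F₂)
  | hide (I E F) : Replace D S S' E F → Replace D S S' (hide I E) (hide I F)
  | ren (R hR E F) : Replace D S S' E F → Replace D S S' (ren R hR E) (ren R hR F)
  | theta (L U h E) : Closed E → Replace D S S' (theta L U h E) (theta L U h E)
  | psi (X E) : Closed E → Replace D S S' (psi X E) (psi X E)
  | fix (C : Set V) (G H : C → Exp A V) (y) : (∀ z, Replace D S S' (G z) (H z)) →
      Replace D S S' (fix C G y) (fix C H y)
  | spec (y) : Replace D S S' (fix D S y) (fix D S' y)

namespace Replace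

variable {D : Set V} {S S' : D → Exp A V}

theorem symm {E F : Exp A V} (h : Replace D S S' E F) : Replace D S' S F E := by
  induction h with
  | nil => exact .nil
  | var x => exact .var x
  | act α E F _ ih => exact .act _ _ _ ih
  | sum _ _ _ _ _ _ ih₁ ih₂ => exact .sum _ _ _ _ ih₁ ih₂
  | par _ _ _ _ _ _ _ ih₁ ih₂ => exact .par _ _ _ _ _ ih₁ ih₂
  | hide _ _ _ _ ih => exact .hide _ _ _ ih
  | ren _ _ _ _ _ ih => exact .ren _ _ _ _ ih
  | theta _ _ _ _ h => exact .theta _ _ _ _ h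
  | psi _ _ h => exact .psi _ _ h
  | fix _ _ _ _ _ ih => exact .fix _ _ _ _ ih
  | spec y => exact .spec y

/-- The set `B` collects the variables bound further outside together with those still free.
Validity keeps the free variables of an argument of θ or ψ out of `B`, so such an argument is
closed, as the `theta` and `psi` constructors require. -/
theorem refl_of_validIn {E : Exp A V} : ∀ {B : Set V}, fv E ⊆ B → ValidIn B E →
    Replace D S S' E E := by
  have key : ∀ {B : Set V} {E : Exp A V}, fv E ⊆ B → Disjoint (fv E) B → ValidIn B E →
      Closed E := fun hB hd hv => ⟨hv.anti (Set.empty_subset _),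
    Set.eq_empty_of_forall_notMem fun x hx => Set.disjoint_left.1 hd hx (hB hx)⟩
  induction E with
  | nil => intros; exact .nil
  | var x => intros; exact .var x
  | act α E ih => exact fun hB hE => .act _ _ _ (ih hB hE)
  | sum E F ihE ihF =>
    exact fun hB hE => .sum _ _ _ _ (ihE (Set.union_subset_iff.1 hB).1 hE.1)
      (ihF (Set.union_subset_iff.1 hB).2 hE.2)
  | par X E F ihE ihF =>
    exact fun hB hE => .par _ _ _ _ _ (ihE (Set.union_subset_iff.1 hB).1 hE.1)
      (ihF (Set.union_subset_iff.1 hB).2 hE.2)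
  | hide I E ih => exact fun hB hE => .hide _ _ _ (ih hB hE)
  | ren R hR E ih => exact fun hB hE => .ren _ _ _ _ (ih hB hE)
  | theta L U hLU E ih => exact fun hB hE => .theta _ _ _ _ (key hB hE.1 hE.2)
  | psi X E ih => exact fun hB hE => .psi _ _ (key hB hE.1 hE.2)
  | fix C G y ih =>
    refine fun {B} hB hE => .fix _ _ _ _ fun z => ih z (B := B ∪ C) (fun x hx => ?_) (hE z)
    by_cases hC : x ∈ C
    · exact Or.inr hC
    · exact Or.inl (hB ⟨Set.mem_iUnion.2 ⟨z, hx⟩, hC⟩)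

/-- The three constructors that do not recurse, `theta`, `psi` and `spec`, concern closed
expressions, which no substitution changes. -/
theorem subst (hS : ∀ y, Closed (.fix D S y)) (hS' : ∀ y, Closed (.fix D S' y))
    {E F : Exp A V} (h : Replace D S S' E F) : ∀ {σ τ : V → Exp A V},
    (∀ x, Replace D S S' (σ x) (τ x)) → Replace D S S' (subst σ E) (subst τ F) := by
  induction h with
  | nil => exact fun _ => .nil
  | var x => exact fun h => h x
  | act α E F _ ih => exact fun h => .act _ _ _ (ih h)
  | sum _ _ _ _ _ _ ih₁ ih₂ => exact fun h => .sum _ _ _ _ (ih₁ h) (ih₂ h)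
  | par _ _ _ _ _ _ _ ih₁ ih₂ => exact fun h => .par _ _ _ _ _ (ih₁ h) (ih₂ h)
  | hide _ _ _ _ ih => exact fun h => .hide _ _ _ (ih h)
  | ren _ _ _ _ _ ih => exact fun h => .ren _ _ _ _ (ih h)
  | theta L U hLU E hE =>
    intro σ τ _
    simp only [Exp.subst, hE.subst_eq]
    exact .theta _ _ _ _ hE
  | psi X E hE =>
    intro σ τ _
    simp only [Exp.subst, hE.subst_eq]
    exact .psi _ _ hE
  | fix C G H y _ ih =>
    refine fun h => .fix _ _ _ _ fun z => ih z fun x => ?_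
    by_cases hx : x ∈ C
    · simp only [shield, hx, if_true]
      exact .var x
    · simp only [shield, hx, if_false]
      exact h x
  | spec y =>
    intro σ τ _
    rw [(hS y).subst_eq, (hS' y).subst_eq]
    exact .spec y

theorem solution {C : Set V} {G H : C → Exp A V}
    (h : ∀ y, Replace D S S' (Exp.fix C G y) (Exp.fix C H y)) (x : V) :
    Replace D S S' (solution C G x) (solution C H x) := by
  by_cases hx : x ∈ C
  · simp only [Exp.solution, hx, dif_pos]
    exact h _
  · simp only [Exp.solution, hx, dif_neg, not_false_eq_true]
    exact .var x

theorem refl_of_closed {E : Exp A V} (h : Closed E) : Replace D S S' E E :=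
  refl_of_validIn (B := ∅) h.2.subset h.1

/-- `S y` itself may be open, but its free variables lie in `D`, and it is valid in the scope of
`D`. -/
theorem refl_spec (hS : ∀ y, Closed (.fix D S y)) (y : D) : Replace D S S' (S y) (S y) :=
  refl_of_validIn (B := ∅ ∪ D) (fun _ hx => Or.inr ((hS y).fv_subset y hx)) ((hS y).1 y)

end Replace

end Exp

/-- The expression `S_y` of the specification `S`, with all `x ∈ D` replaced by `⟨x | S'⟩`. -/
noncomputable def Proc.component {D : Set V} {S S' : D → Exp A V}
    (hS : ∀ y, Exp.Closed (.fix D S y)) (hS' : ∀ y, Exp.Closed (.fix D S' y)) (y : D) :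
    Proc A V := by
  refine ⟨Exp.subst (Exp.solution D S') (S y),
    Exp.ValidIn.subst (hS' y).closedSubst (((hS y).1 y).anti (Set.empty_subset _)),
    Set.eq_empty_of_forall_notMem fun x hx => ?_⟩
  obtain ⟨h1, h2⟩ := Exp.fv_subst (hS' y).closedSubst hx
  by_cases hD : x ∈ D
  · simp [Exp.solution, hD] at h2
  · exact hD ((hS y).fv_subset y h1)

/-! ### Transitions under replacement of a specification. -/

/-- Transitions are preserved by the replacement of a specification by a related one, up to a
congruence. -/
theorem Exp.Replace.step {r : Proc A V → Proc A V → Prop} (ok : Act A → Prop)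
    (ok_of : ∀ α, α ≠ Act.timeout → ok α) (hr : Equivalence r)
    (par : ∀ X P₁ P₂ Q₁ Q₂, r P₁ Q₁ → r P₂ Q₂ → r (Proc.par X P₁ P₂) (Proc.par X Q₁ Q₂))
    (hide : ∀ I P Q, r P Q → r (Proc.hide I P) (Proc.hide I Q))
    (ren : ∀ R hR P Q, r P Q → r (Proc.ren R hR P) (Proc.ren R hR Q))
    {D : Set V} {S S' : D → Exp A V} (hS : ∀ y, Closed (.fix D S y))
    (hS' : ∀ y, Closed (.fix D S' y))
    (hSS' : ∀ y α P, ok α → procLTS A V (Proc.component hS hS' y) α P →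
      ∃ Q, procLTS A V (Proc.component hS' hS' y) α Q ∧ r P Q)
    {E E' : Exp A V} {α : Act A} (h : Step E α E') : ok α → Closed E → ∀ {F}, Closed F →
    Replace D S S' E F → ∃ M Q : Proc A V, Step F α Q.1 ∧ Replace D S S' E' M.1 ∧ r M Q := by
  unfold Step at h
  induction h with
  | act α E =>
    rintro - hE F hF (_ | _ | ⟨_, _, F, h⟩)
    exact ⟨⟨F, hF⟩, ⟨F, hF⟩, .act _ _, h, hr.refl _⟩
  | sum_left E₁ E₂ α E' _ ih =>
    rintro hα hE F hF (_ | _ | _ | ⟨_, _, F₁, F₂, h₁, h₂⟩)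
    obtain ⟨M, Q, k1, k2, k3⟩ := ih hα (closed_sum.1 hE).1 (closed_sum.1 hF).1 h₁
    exact ⟨M, Q, .sum_left _ _ _ _ k1, k2, k3⟩
  | sum_right E₁ E₂ α E' _ ih =>
    rintro hα hE F hF (_ | _ | _ | ⟨_, _, F₁, F₂, h₁, h₂⟩)
    obtain ⟨M, Q, k1, k2, k3⟩ := ih hα (closed_sum.1 hE).2 (closed_sum.1 hF).2 h₂
    exact ⟨M, Q, .sum_right _ _ _ _ k1, k2, k3⟩
  | par_left X E₁ E₂ α E' _ hX ih =>
    rintro hα hE F hF (_ | _ | _ | _ | ⟨_, _, _, F₁, F₂, h₁, h₂⟩)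
    obtain ⟨M, Q, k1, k2, k3⟩ := ih hα (closed_par.1 hE).1 (closed_par.1 hF).1 h₁
    exact ⟨M.par X ⟨F₂, (closed_par.1 hF).2⟩, Q.par X ⟨F₂, _⟩, .par_left _ _ _ _ _ k1 hX,
      .par _ _ _ _ _ k2 h₂, par _ _ _ _ _ k3 (hr.refl _)⟩
  | par_right X E₁ E₂ α E' _ hX ih =>
    rintro hα hE F hF (_ | _ | _ | _ | ⟨_, _, _, F₁, F₂, h₁, h₂⟩)
    obtain ⟨M, Q, k1, k2, k3⟩ := ih hα (closed_par.1 hE).2 (closed_par.1 hF).2 h₂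
    exact ⟨.par X ⟨F₁, (closed_par.1 hF).1⟩ M, .par X ⟨F₁, _⟩ Q, .par_right _ _ _ _ _ k1 hX,
      .par _ _ _ _ _ h₁ k2, par _ _ _ _ _ (hr.refl _) k3⟩
  | par_sync X E₁ E₂ a E₁' E₂' _ _ ha ih₁ ih₂ =>
    rintro hα hE F hF (_ | _ | _ | _ | ⟨_, _, _, F₁, F₂, h₁, h₂⟩)
    obtain ⟨M, Q, k1, k2, k3⟩ := ih₁ hα (closed_par.1 hE).1 (closed_par.1 hF).1 h₁
    obtain ⟨N, R, m1, m2, m3⟩ := ih₂ hα (closed_par.1 hE).2 (closed_par.1 hF).2 h₂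
    exact ⟨M.par X N, Q.par X R, .par_sync _ _ _ _ _ _ k1 m1 ha,
      .par _ _ _ _ _ k2 m2, par _ _ _ _ _ k3 m3⟩
  | hide_out I E α E' _ hI ih =>
    rintro hα hE F hF (_ | _ | _ | _ | _ | ⟨_, _, F, h⟩)
    obtain ⟨M, Q, k1, k2, k3⟩ := ih hα hE (F := F) hF h
    exact ⟨M.hide I, Q.hide I, .hide_out _ _ _ _ k1 hI, .hide _ _ _ k2, hide _ _ _ k3⟩
  | hide_in I E a E' _ hI ih =>
    rintro hα hE F hF (_ | _ | _ | _ | _ | ⟨_, _, F, h⟩)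
    -- The premise carries the hidden action `a` rather than τ, so the condition `ok` has to be
    -- supplied anew.
    obtain ⟨M, Q, k1, k2, k3⟩ := ih (ok_of _ (Act.vis_ne_timeout a)) hE (F := F) hF h
    exact ⟨M.hide I, Q.hide I, .hide_in _ _ _ _ k1 hI, .hide _ _ _ k2, hide _ _ _ k3⟩
  | ren_vis R hR E a b E' _ hab ih =>
    rintro hα hE F hF (_ | _ | _ | _ | _ | _ | ⟨_, _, _, F, h⟩)
    obtain ⟨M, Q, k1, k2, k3⟩ := ih (ok_of _ (Act.vis_ne_timeout a)) hE (F := F) hF h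
    exact ⟨M.ren R hR, Q.ren R hR, .ren_vis _ _ _ _ _ _ k1 hab, .ren _ _ _ _ k2, ren _ _ _ _ k3⟩
  | ren_tau R hR E E' _ ih =>
    rintro hα hE F hF (_ | _ | _ | _ | _ | _ | ⟨_, _, _, F, h⟩)
    obtain ⟨M, Q, k1, k2, k3⟩ := ih hα hE (F := F) hF h
    exact ⟨M.ren R hR, Q.ren R hR, .ren_tau _ _ _ _ k1, .ren _ _ _ _ k2, ren _ _ _ _ k3⟩
  | ren_timeout R hR E E' _ ih =>
    rintro hα hE F hF (_ | _ | _ | _ | _ | _ | ⟨_, _, _, F, h⟩)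
    obtain ⟨M, Q, k1, k2, k3⟩ := ih hα hE (F := F) hF h
    exact ⟨M.ren R hR, Q.ren R hR, .ren_timeout _ _ _ _ k1, .ren _ _ _ _ k2, ren _ _ _ _ k3⟩
  | theta_tau L U hLU E E' h _ =>
    -- `Replace` relates expressions of the form θ(…) only to themselves, so the same transition
    -- serves on both sides and its negative premise needs no transfer.
    rintro hα hE F hF (_ | _ | _ | _ | _ | _ | _ | _)
    have h' := Derivable.theta_tau L U hLU _ _ h
    exact ⟨⟨_, h'.closed hE⟩, ⟨_, h'.closed hE⟩, h', .refl_of_closed (h'.closed hE), hr.refl _⟩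
  | theta_vis L U hLU E a E' h ha _ =>
    rintro hα hE F hF (_ | _ | _ | _ | _ | _ | _ | _)
    have h' := Derivable.theta_vis L U hLU _ _ _ h ha
    exact ⟨⟨_, h'.closed hE⟩, ⟨_, h'.closed hE⟩, h', .refl_of_closed (h'.closed hE), hr.refl _⟩
  | theta_idle L U hLU E α E' h hi _ =>
    rintro hα hE F hF (_ | _ | _ | _ | _ | _ | _ | _)
    have h' := Derivable.theta_idle L U hLU _ _ _ h hi
    exact ⟨⟨_, h'.closed hE⟩, ⟨_, h'.closed hE⟩, h', .refl_of_closed (h'.closed hE), hr.refl _⟩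
  | psi_act X E α E' h hN _ =>
    rintro hα hE F hF (_ | _ | _ | _ | _ | _ | _ | _ | _)
    have h' := Derivable.psi_act X _ _ _ h hN
    exact ⟨⟨_, h'.closed hE⟩, ⟨_, h'.closed hE⟩, h', .refl_of_closed (h'.closed hE), hr.refl _⟩
  | psi_timeout X E E' h hi _ =>
    rintro hα hE F hF (_ | _ | _ | _ | _ | _ | _ | _ | _)
    have h' := Derivable.psi_timeout X _ _ h hi
    exact ⟨⟨_, h'.closed hE⟩, ⟨_, h'.closed hE⟩, h', .refl_of_closed (h'.closed hE), hr.refl _⟩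
  | fix C G y α E' _ ih =>
    intro hα hE F hF hEF
    cases hEF with
    | fix _ _ H _ h =>
      obtain ⟨M, Q, k1, k2, k3⟩ := ih hα hE.unfold hF.unfold
        ((h y).subst hS hS' (.solution fun y => .fix _ _ _ y h))
      exact ⟨M, Q, .fix _ _ _ _ _ k1, k2, k3⟩
    | spec y =>
      -- The intermediate process is ⟨S_y|S'⟩: the induction hypothesis leads to it from ⟨S_y|S⟩,
      -- and the assumption on S and S' leads from it to ⟨S'_y|S'⟩.
      obtain ⟨M, Q, k1, k2, k3⟩ := ih hα hE.unfold (Proc.component hS hS' y).2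
        ((Replace.refl_spec hS y).subst hS hS' (.solution .spec))
      obtain ⟨R, k4, k5⟩ := hSS' y α Q hα k1
      exact ⟨M, R, .fix _ _ _ _ _ k4, k2, hr.trans k3 k5⟩

end Processes

/-! ### Time-outs under replacement, and congruence for recursion. -/

section FullCongruence

variable {A : Type u} {V : Type v}

/-- Time-outs are preserved by the replacement of a specification by a related one, up to concrete
branching `X`-bisimilarity. -/
theorem Exp.Replace.timeout {D : Set V} {S S' : D → Exp A V} (hS : ∀ y, Closed (.fix D S y))
    (hS' : ∀ y, Closed (.fix D S' y))
    (hSS' : ∀ y, CBRMatch (procLTS A V) (Proc.component hS hS' y) (Proc.component hS' hS' y))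
    (initials : ∀ P Q : Proc A V, Replace D S S' P.1 Q.1 →
      (procLTS A V).initials P = (procLTS A V).initials Q)
    {E E' : Exp A V} {α : Act A} (h : Step E α E') : α = Act.timeout →
    ∀ (hE : Closed E) {F}, Closed F → ∀ {X}, Replace D S S' E F →
    Idle ((procLTS A V).initials ⟨E, hE⟩) X →
    ∃ M Q : Proc A V, Step F Act.timeout Q.1 ∧ Replace D S S' E' M.1 ∧
      CBRBisimX (procLTS A V) X M Q := by
  unfold Step at h
  have rfl_of : ∀ {E E' : Exp A V} {X : Set A}, Closed E → Step E Act.timeout E' →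
      ∃ M Q : Proc A V, Step E Act.timeout Q.1 ∧ Replace D S S' E' M.1 ∧
        CBRBisimX (procLTS A V) X M Q := fun hE h =>
    ⟨⟨_, Derivable.closed h hE⟩, ⟨_, Derivable.closed h hE⟩, h,
      .refl_of_closed (Derivable.closed h hE), (CBRBisim.refl _).settle _⟩
  induction h with
  | act α E =>
    rintro rfl hE F hF X (_ | _ | ⟨_, _, F, h⟩) _
    exact ⟨⟨F, hF⟩, ⟨F, hF⟩, .act _ _, h, (CBRBisim.refl _).settle _⟩
  | sum_left E₁ E₂ α E' _ ih =>
    rintro hα hE F hF X (_ | _ | _ | ⟨_, _, F₁, F₂, h₁, h₂⟩) hi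
    have hE' := closed_sum.1 hE
    obtain ⟨M, Q, k1, k2, k3⟩ := ih hα hE'.1 (closed_sum.1 hF).1 h₁
      (Proc.isSum.idle (p := (⟨E₁, hE'.1⟩ : Proc A V)) (q := (⟨E₂, hE'.2⟩ : Proc A V)) hi).1
    exact ⟨M, Q, .sum_left _ _ _ _ k1, k2, k3⟩
  | sum_right E₁ E₂ α E' _ ih =>
    rintro hα hE F hF X (_ | _ | _ | ⟨_, _, F₁, F₂, h₁, h₂⟩) hi
    have hE' := closed_sum.1 hE
    obtain ⟨M, Q, k1, k2, k3⟩ := ih hα hE'.2 (closed_sum.1 hF).2 h₂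
      (Proc.isSum.idle (p := (⟨E₁, hE'.1⟩ : Proc A V)) (q := (⟨E₂, hE'.2⟩ : Proc A V)) hi).2
    exact ⟨M, Q, .sum_right _ _ _ _ k1, k2, k3⟩
  | par_left Y E₁ E₂ α E' _ hY ih =>
    rintro hα hE F hF X (_ | _ | _ | _ | ⟨_, _, _, F₁, F₂, h₁, h₂⟩) hi
    have hE' := closed_par.1 hE
    have hF' := closed_par.1 hF
    have hp := Proc.isParallel Y (V := V)
    obtain ⟨P, rfl⟩ : ∃ P : Proc A V, P.1 = E₂ := ⟨⟨_, hE'.2⟩, rfl⟩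
    obtain ⟨Q, rfl⟩ : ∃ Q : Proc A V, Q.1 = F₂ := ⟨⟨_, hF'.2⟩, rfl⟩
    -- In the conclusion both compositions have the partner `Q`, so the environment of the active
    -- component is rewritten in terms of the initial actions of `Q`.
    have hI := initials P Q h₂
    have h1 : Idle ((procLTS A V).initials ⟨E₁, hE'.1⟩)
        (parEnv Y X ((procLTS A V).initials P)) := hp.idle_left hi
    have h2 : Idle ((procLTS A V).initials P) (X \ Y) :=
      hp.idle_right (p := (⟨E₁, hE'.1⟩ : Proc A V)) hi
    rw [hI] at h1 h2
    obtain ⟨M, R, k1, k2, k3⟩ := ih hα hE'.1 hF'.1 h₁ h1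
    subst hα
    exact ⟨M.par Y Q, R.par Y Q, .par_left _ _ _ _ _ k1 hY,
      .par _ _ _ _ _ k2 h₂, k3.par hp (.refl _) h2.stable h2⟩
  | par_right Y E₁ E₂ α E' _ hY ih =>
    rintro hα hE F hF X (_ | _ | _ | _ | ⟨_, _, _, F₁, F₂, h₁, h₂⟩) hi
    have hE' := closed_par.1 hE
    have hF' := closed_par.1 hF
    have hp := (Proc.isParallel Y (V := V)).swap
    obtain ⟨P, rfl⟩ : ∃ P : Proc A V, P.1 = E₁ := ⟨⟨_, hE'.1⟩, rfl⟩
    obtain ⟨Q, rfl⟩ : ∃ Q : Proc A V, Q.1 = F₁ := ⟨⟨_, hF'.1⟩, rfl⟩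
    have hI := initials P Q h₁
    have h1 : Idle ((procLTS A V).initials ⟨E₂, hE'.2⟩)
        (parEnv Y X ((procLTS A V).initials P)) := hp.idle_left hi
    have h2 : Idle ((procLTS A V).initials P) (X \ Y) :=
      hp.idle_right (p := (⟨E₂, hE'.2⟩ : Proc A V)) hi
    rw [hI] at h1 h2
    obtain ⟨M, R, k1, k2, k3⟩ := ih hα hE'.2 hF'.2 h₂ h1
    subst hα
    exact ⟨Q.par Y M, Q.par Y R, .par_right _ _ _ _ _ k1 hY,
      .par _ _ _ _ _ h₁ k2, k3.par hp (.refl _) h2.stable h2⟩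
  | par_sync => exact nofun
  | hide_out I E α E' _ hI ih =>
    rintro hα hE F hF X (_ | _ | _ | _ | _ | ⟨_, _, F, h⟩) hi
    have hr := Proc.isRelabel_hide I (V := V)
    have hl := Proc.isRelabelling_hideRel I
    obtain ⟨M, Q, k1, k2, k3⟩ := ih hα hE (F := F) hF h (hr.idle hl (p := ⟨E, hE⟩) hi)
    subst hα
    exact ⟨M.hide I, Q.hide I, .hide_out _ _ _ _ k1 hI, .hide _ _ _ k2, k3.relabel hr hl⟩
  | hide_in => exact nofun
  | ren_vis => exact nofun
  | ren_tau => exact nofun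
  | ren_timeout R hR E E' _ ih =>
    rintro hα hE F hF X (_ | _ | _ | _ | _ | _ | ⟨_, _, _, F, h⟩) hi
    have hr := Proc.isRelabel_ren R hR (V := V)
    have hl := Proc.isRelabelling_renRel R
    obtain ⟨M, Q, k1, k2, k3⟩ := ih hα hE (F := F) hF h (hr.idle hl (p := ⟨E, hE⟩) hi)
    exact ⟨M.ren R hR, Q.ren R hR, .ren_timeout _ _ _ _ k1, .ren _ _ _ _ k2, k3.relabel hr hl⟩
  | theta_tau => exact nofun
  | theta_vis => exact nofun
  | theta_idle L U hLU E α E' h hi _ =>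
    rintro rfl hE F hF X (_ | _ | _ | _ | _ | _ | _ | _) _
    exact rfl_of hE (.theta_idle L U hLU _ _ _ h hi)
  | psi_act X E α E' h hN _ => exact fun hα => (hN hα).elim
  | psi_timeout X E E' h hi _ =>
    rintro - hE F hF X (_ | _ | _ | _ | _ | _ | _ | _ | _) _
    exact rfl_of hE (.psi_timeout _ _ _ h hi)
  | fix C G y α E' _ ih =>
    intro hα hE F hF X hEF hi
    -- A recursive process and its unfolding have the same initial actions, so the induction
    -- hypothesis applies to the unfolding.
    rw [← Proc.initials_unfold] at hi
    cases hEF with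
    | fix _ _ H _ h =>
      obtain ⟨M, Q, k1, k2, k3⟩ := ih hα hE.unfold hF.unfold
        ((h y).subst hS hS' (.solution fun y => .fix _ _ _ y h)) hi
      exact ⟨M, Q, .fix _ _ _ _ _ k1, k2, k3⟩
    | spec y =>
      have hR : Replace D S S' (Proc.unfold hE).1 (Proc.component hS hS' y).1 :=
        (Replace.refl_spec hS y).subst hS hS' (.solution .spec)
      obtain ⟨M, Q, k1, k2, k3⟩ := ih hα hE.unfold (Proc.component hS hS' y).2 hR hi
      -- To match the time-out from ⟨S_y|S'⟩ to ⟨S'_y|S'⟩, the former must idle on `X` too.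
      rw [initials _ _ hR] at hi
      obtain ⟨R, k4, k5⟩ := (hSS' y).timeout X hi Q k1
      exact ⟨M, R, .fix _ _ _ _ _ k4, k2, k3.trans k5⟩

theorem CBRBisim.equivalence {P : Type w} {T : LTS A P} : Equivalence (CBRBisim T) :=
  ⟨.refl, .symm, .trans⟩

theorem SRBBisim.equivalence {P : Type w} {T : LTS A P} : Equivalence (SRBBisim T) :=
  ⟨.refl, .symm, .trans⟩

/-- Two instances of the assumption are needed, with the variables in `D` solved by S' and by S,
because the relation given to the up-to principle must be symmetric and replaces in both directions.
-/
theorem RootedCBRBisim.fix {D : Set V} {S S' : D → Exp A V}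
    (hS : ∀ y, Exp.Closed (.fix D S y)) (hS' : ∀ y, Exp.Closed (.fix D S' y))
    (h : ∀ y, RootedCBRBisim (procLTS A V) (Proc.component hS hS' y) (Proc.component hS' hS' y))
    (h' : ∀ y, RootedCBRBisim (procLTS A V) (Proc.component hS' hS y) (Proc.component hS hS y))
    (x : D) : RootedCBRBisim (procLTS A V) ⟨.fix D S x, hS x⟩ ⟨.fix D S' x, hS' x⟩ := by
  have step : ∀ {S S' : D → Exp A V} (hS : ∀ y, Exp.Closed (.fix D S y))
      (hS' : ∀ y, Exp.Closed (.fix D S' y)),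
      (∀ y, RootedCBRBisim (procLTS A V) (Proc.component hS hS' y)
        (Proc.component hS' hS' y)) → ∀ P Q : Proc A V, Exp.Replace D S S' P.1 Q.1 →
      ∀ α P', α ≠ Act.timeout → procLTS A V P α P' →
        ∃ M Q', procLTS A V Q α Q' ∧ Exp.Replace D S S' P'.1 M.1 ∧
          CBRBisim (procLTS A V) M Q' := by
    intro S S' hS hS' h P Q hPQ α P' hα hP
    exact Exp.Replace.step (· ≠ Act.timeout) (fun _ => id) CBRBisim.equivalence
      (fun X _ _ _ _ => .par (Proc.isParallel X))
      (fun I _ _ => .relabel (Proc.isRelabel_hide I) (Proc.isRelabelling_hideRel I))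
      (fun R hR _ _ => .relabel (Proc.isRelabel_ren R hR) (Proc.isRelabelling_renRel R))
      hS hS' (fun y => (h y).toMatch.step) hP hα P.2 Q.2 hPQ
  have le : ∀ {S S' : D → Exp A V} (hS : ∀ y, Exp.Closed (.fix D S y))
      (hS' : ∀ y, Exp.Closed (.fix D S' y)),
      (∀ y, RootedCBRBisim (procLTS A V) (Proc.component hS hS' y)
        (Proc.component hS' hS' y)) → ∀ P Q : Proc A V, Exp.Replace D S S' P.1 Q.1 →
      (procLTS A V).initials P ⊆ (procLTS A V).initials Q := by
    rintro S S' hS hS' h P Q hPQ α ⟨h1, P', h2⟩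
    obtain ⟨_, Q', k, _⟩ := step hS hS' h P Q hPQ α P' h1 h2
    exact ⟨h1, Q', k⟩
  -- Matching the actions other than time-outs in both directions already fixes the initial actions;
  -- the treatment of time-outs relies on this.
  have initials : ∀ P Q : Proc A V, Exp.Replace D S S' P.1 Q.1 →
      (procLTS A V).initials P = (procLTS A V).initials Q := fun P Q hPQ =>
    (le hS hS' h P Q hPQ).antisymm (le hS' hS h' Q P hPQ.symm)
  refine (rootedCBRBisim_of_upTo
    (C := fun P Q => Exp.Replace D S S' P.1 Q.1 ∨ Exp.Replace D S' S P.1 Q.1)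
    ?_ ?_ ?_ (Or.inl (Exp.Replace.spec x))).2
  · exact fun P Q hPQ => hPQ.symm.imp Exp.Replace.symm Exp.Replace.symm
  · rintro P Q (hPQ | hPQ) α P' hα hP
    · obtain ⟨M, Q', k1, k2, k3⟩ := step hS hS' h P Q hPQ α P' hα hP
      exact ⟨Q', k1, M, Or.inl k2, k3⟩
    · obtain ⟨M, Q', k1, k2, k3⟩ := step hS' hS h' P Q hPQ α P' hα hP
      exact ⟨Q', k1, M, Or.inr k2, k3⟩
  · rintro P Q (hPQ | hPQ) X hX P' hP
    · obtain ⟨M, Q', k1, k2, k3⟩ := Exp.Replace.timeout hS hS' (fun y => (h y).toMatch)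
        initials hP rfl P.2 Q.2 hPQ hX
      exact ⟨Q', k1, M, Or.inl k2, k3⟩
    · obtain ⟨M, Q', k1, k2, k3⟩ := Exp.Replace.timeout hS' hS (fun y => (h' y).toMatch)
        (fun P Q hPQ => (initials Q P hPQ.symm).symm) hP rfl P.2 Q.2 hPQ hX
      exact ⟨Q', k1, M, Or.inr k2, k3⟩

theorem RootedSRBBisim.fix {D : Set V} {S S' : D → Exp A V}
    (hS : ∀ y, Exp.Closed (.fix D S y)) (hS' : ∀ y, Exp.Closed (.fix D S' y))
    (h : ∀ y, RootedSRBBisim (procLTS A V) (Proc.component hS hS' y) (Proc.component hS' hS' y))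
    (h' : ∀ y, RootedSRBBisim (procLTS A V) (Proc.component hS' hS y) (Proc.component hS hS y))
    (x : D) : RootedSRBBisim (procLTS A V) ⟨.fix D S x, hS x⟩ ⟨.fix D S' x, hS' x⟩ := by
  have step : ∀ {S S' : D → Exp A V} (hS : ∀ y, Exp.Closed (.fix D S y))
      (hS' : ∀ y, Exp.Closed (.fix D S' y)),
      (∀ y, RootedSRBBisim (procLTS A V) (Proc.component hS hS' y)
        (Proc.component hS' hS' y)) → ∀ P Q : Proc A V, Exp.Replace D S S' P.1 Q.1 →
      ∀ α P', procLTS A V P α P' →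
        ∃ M Q', procLTS A V Q α Q' ∧ Exp.Replace D S S' P'.1 M.1 ∧
          SRBBisim (procLTS A V) M Q' := by
    intro S S' hS hS' h P Q hPQ α P' hP
    exact Exp.Replace.step (fun _ => True) (fun _ _ => trivial) SRBBisim.equivalence
      (fun X _ _ _ _ => .par (Proc.isParallel X))
      (fun I _ _ => .relabel (Proc.isRelabel_hide I) (Proc.isRelabelling_hideRel I))
      (fun R hR _ _ => .relabel (Proc.isRelabel_ren R hR) (Proc.isRelabelling_renRel R))
      hS hS' (fun y α P _ => (h y).step α P) hP trivial P.2 Q.2 hPQ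
  refine (rootedSRBBisim_of_upTo
    (C := fun P Q => Exp.Replace D S S' P.1 Q.1 ∨ Exp.Replace D S' S P.1 Q.1)
    ?_ ?_ (Or.inl (Exp.Replace.spec x))).2
  · exact fun P Q hPQ => hPQ.symm.imp Exp.Replace.symm Exp.Replace.symm
  · rintro P Q (hPQ | hPQ) α P' hP
    · obtain ⟨M, Q', k1, k2, k3⟩ := step hS hS' h P Q hPQ α P' hP
      exact ⟨Q', k1, M, Or.inl k2, k3⟩
    · obtain ⟨M, Q', k1, k2, k3⟩ := step hS' hS h' P Q hPQ α P' hP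
      exact ⟨Q', k1, M, Or.inr k2, k3⟩

/-! ### From processes to valid expressions -/

theorem Exp.subst_congr {E : Exp A V} : ∀ {σ τ : V → Exp A V}, (∀ x ∈ fv E, σ x = τ x) →
    subst σ E = subst τ E := by
  induction E with
  | nil => intros; rfl
  | var y => intro σ τ h; exact h y rfl
  | act α E ih => intro σ τ h; simp only [subst, ih h]
  | sum E F ihE ihF =>
    intro σ τ h
    simp only [subst, ihE fun x hx => h x (Or.inl hx), ihF fun x hx => h x (Or.inr hx)]
  | par S E F ihE ihF =>
    intro σ τ h
    simp only [subst, ihE fun x hx => h x (Or.inl hx), ihF fun x hx => h x (Or.inr hx)]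
  | hide I E ih => intro σ τ h; simp only [subst, ih h]
  | ren R hR E ih => intro σ τ h; simp only [subst, ih h]
  | theta L U hLU E ih => intro σ τ h; simp only [subst, ih h]
  | psi X E ih => intro σ τ h; simp only [subst, ih h]
  | fix D S y ih =>
    intro σ τ h
    simp only [subst]
    congr 1
    funext z
    apply ih z
    intro x hx
    by_cases hD : x ∈ D
    · simp [shield, hD]
    · simpa [shield, hD] using h x ⟨Set.mem_iUnion.2 ⟨z, hx⟩, hD⟩

open Classical in
/-- The substitution of processes `x ↦ ⟨x | S⟩` for `x ∈ D`. -/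
noncomputable def Proc.solution {D : Set V} {S : D → Exp A V}
    (hS : ∀ y, Exp.Closed (.fix D S y)) : V → Proc A V :=
  fun x => if h : x ∈ D then ⟨.fix D S ⟨x, h⟩, hS _⟩ else .nil

/-- The free variables of `S y` lie in `D`, so the default value `Proc.nil` of `Proc.solution`
outside `D` is irrelevant. Thus the assumption on open expressions is used at two substitutions
only, the solutions of the two specifications. -/
theorem ValidExp.inst_solution {D : Set V} {S : D → ValidExp A V} {S' : D → Exp A V}
    (hS : ∀ y, Exp.Closed (.fix D (fun y => (S y).1) y)) (hS' : ∀ y, Exp.Closed (.fix D S' y))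
    (y : D) : (S y).inst (Proc.solution hS') = Proc.component hS hS' y := by
  refine Subtype.ext (Exp.subst_congr fun x hx => ?_)
  have hD := (hS y).fv_subset y hx
  simp [Proc.solution, Exp.solution, hD]

theorem ValidExp.inst_of_closed {E : Exp A V} (h : E.Closed) (ρ : V → Proc A V) :
    ValidExp.inst ⟨E, h.1⟩ ρ = ⟨E, h⟩ := Subtype.ext (h.subst_eq _)

/-- A relation on processes that is preserved by the operators and by recursion extends to a full
congruence. -/
theorem isFullCongruence_openExt {r : Proc A V → Proc A V → Prop} (hr : Equivalence r)
    (act : ∀ α P Q, r P Q → r (P.act α) (Q.act α))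
    (sum : ∀ P₁ Q₁ P₂ Q₂, r P₁ Q₁ → r P₂ Q₂ → r (P₁.sum P₂) (Q₁.sum Q₂))
    (par : ∀ X P₁ Q₁ P₂ Q₂, r P₁ Q₁ → r P₂ Q₂ → r (P₁.par X P₂) (Q₁.par X Q₂))
    (hide : ∀ I P Q, r P Q → r (P.hide I) (Q.hide I))
    (ren : ∀ R hR P Q, r P Q → r (P.ren R hR) (Q.ren R hR))
    (theta : ∀ L U hLU P Q, r P Q → r (P.theta L U hLU) (Q.theta L U hLU))
    (psi : ∀ X P Q, r P Q → r (P.psi X) (Q.psi X))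
    (fix : ∀ (D : Set V) (S S' : D → Exp A V) (hS : ∀ y, Exp.Closed (.fix D S y))
      (hS' : ∀ y, Exp.Closed (.fix D S' y)),
      (∀ y, r (Proc.component hS hS' y) (Proc.component hS' hS' y)) →
      (∀ y, r (Proc.component hS' hS y) (Proc.component hS hS y)) →
      ∀ x, r ⟨.fix D S x, hS x⟩ ⟨.fix D S' x, hS' x⟩) :
    IsFullCongruence (openExt r) where
  equivalence := ⟨fun _ _ => hr.refl _, fun h ρ => hr.symm (h ρ),
    fun h h' ρ => hr.trans (h ρ) (h' ρ)⟩
  -- Instantiation commutes definitionally with every operator other than recursion.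
  act := fun α _ _ h ρ => act α _ _ (h ρ)
  sum := fun _ _ _ _ h h' ρ => sum _ _ _ _ (h ρ) (h' ρ)
  par := fun X _ _ _ _ h h' ρ => par X _ _ _ _ (h ρ) (h' ρ)
  hide := fun I _ _ h ρ => hide I _ _ (h ρ)
  ren := fun R hR _ _ h ρ => ren R hR _ _ (h ρ)
  theta := fun L U hLU _ _ h ρ => theta L U hLU _ _ (h ρ)
  psi := fun X _ _ h ρ => psi X _ _ (h ρ)
  fix := by
    intro D S S' x h h' hr' ρ
    -- Whether ⟨y|S⟩ is closed does not depend on the selected variable, so one closed component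
    -- makes all of them closed.
    have hS : ∀ y, Exp.Closed (.fix D (fun y => (S y).1) y) := fun _ => h
    have hS' : ∀ y, Exp.Closed (.fix D (fun y => (S' y).1) y) := fun _ => h'
    -- Both recursive expressions are closed, so the arbitrary substitution `ρ` leaves them
    -- unchanged.
    refine Eq.mpr (congrArg₂ r (ValidExp.inst_of_closed h ρ) (ValidExp.inst_of_closed h' ρ))
      (fix D _ _ hS hS' (fun y => ?_) (fun y => ?_) x)
    · rw [← ValidExp.inst_solution, ← ValidExp.inst_solution]
      exact hr' y _
    · rw [← ValidExp.inst_solution, ← ValidExp.inst_solution]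
      exact hr.symm (hr' y _)

end FullCongruence

end CCSP

theorem mainTheorem2 {A : Type*} {V : Type*} [Countable V] :
    CCSP.IsFullCongruence (CCSP.openExt (CCSP.RootedCBRBisim (CCSP.procLTS A V))) ∧
      CCSP.IsFullCongruence (CCSP.openExt (CCSP.RootedSRBBisim (CCSP.procLTS A V))) := by
  open CCSP in
  constructor
  · exact isFullCongruence_openExt RootedCBRBisim.equivalence
      (fun α _ _ => .prefixing (Proc.isPrefix α))
      (fun _ _ _ _ => .sum Proc.isSum)
      (fun X _ _ _ _ => .par (Proc.isParallel X))
      (fun I _ _ => .relabel (Proc.isRelabel_hide I) (Proc.isRelabelling_hideRel I))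
      (fun R hR _ _ => .relabel (Proc.isRelabel_ren R hR) (Proc.isRelabelling_renRel R))
      (fun L U hLU _ _ => .theta (Proc.isTheta L U hLU))
      (fun X _ _ => .psi (Proc.isTheta X X subset_rfl) (Proc.isPsi X))
      (fun _ _ _ => .fix)
  · exact isFullCongruence_openExt RootedSRBBisim.equivalence
      (fun α _ _ => .prefixing (Proc.isPrefix α))
      (fun _ _ _ _ => .sum Proc.isSum)
      (fun X _ _ _ _ => .par (Proc.isParallel X))
      (fun I _ _ => .relabel (Proc.isRelabel_hide I) (Proc.isRelabelling_hideRel I))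
      (fun R hR _ _ => .relabel (Proc.isRelabel_ren R hR) (Proc.isRelabelling_renRel R))
      (fun L U hLU _ _ => .theta (Proc.isTheta L U hLU))
      (fun X _ _ => .psi (Proc.isTheta X X subset_rfl) (Proc.isPsi X))
      (fun _ _ _ => .fix)
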